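/- Let $S$ be the scattering matrix of a diagonal scattering theory with one particle species: a meromorphic function on $\mathbb C$ with $S(\theta)S(-\theta)=1$, $S(\theta)=S(i\pi-\theta)$ and $S(0)=-1$. Put $\varphi(\theta)=\frac{d}{d\theta}(-i\log S(\theta))=-iS'(\theta)/S(\theta)$. Let $(F_n)_{n\ge 0}$ be the form factors of a local operator: functions of $n$ complex rapidities whose only singularities, at points $(x_1,\dots,x_n)$ where no difference $x_i-x_j$ $(i\ne j)$ is a zero or pole of $S$, are at most simple kinematical poles at $x_i-x_j\in i\pi+2\pi i\mathbb Z$, and which satisfy, at regular points, the exchange axiom $$F_n(\dots,\theta_j,\theta_{j+1},\dots)=S(\theta_j-\theta_{j+1})F_n(\dots,\theta_{j+1},\theta_j,\dots)$$ and the kinematical pole axiom $$-i\operatorname*{Res}_{\theta=\theta'}F_{n+2}(\theta+i\pi,\theta',\theta_1,\dots,\theta_n)=\Big(1-\prod_{k=1}^n S(\theta'-\theta_k)\Big)F_n(\theta_1,\dots,\theta_n).$$ For pairwise distinct rapidities, the connected diagonal form factor $F_{2N,c}(\theta_1,\dots,\theta_N)$ is the finite piece of $F_{2N}(\theta_1+i\pi+\eta_1,\dots,\theta_N+i\pi+\eta_N,\theta_N,\dots,\theta_1)$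 as $\eta\to0$, that is, the constant term of its Laurent expansion in $\eta_1,\dots,\eta_N$ (which has at most a simple pole in each $\eta_i$). At coinciding rapidities, $F_{2N,c}$ is the limit of its values at pairwise distinct rapidities. Let $n,m\ge1$, $k\ge0$, and let $\theta_1,\dots,\theta_{k+2}\in\mathbb C$ be rapidities that are pairwise distinct modulo $i\pi$, such that no difference $\theta_i-\theta_j$ $(i\neq j)$ is a zero or pole of $S$ (for distinct real rapidities and $|S|=1$ on $\mathbb R$ both conditions are automatic). Write $\varphi_{ij}=\varphi(\theta_i-\theta_j)$ and assume $\varphi_{12}\neq0$. For a finite sequence $s=(s_1,\dots,s_l)$ of labels let $[s]_\varphi=\varphi_{s_1s_2}\varphi_{s_2s_3}\cdots\varphi_{s_{l-1}s_l}$ (equal to $1$ if $l=1$), and for a multiset $M=\{a_1,\dots,a_N\}$ of labels write $F_c(M)=F_{2N,c}(\theta_{a_1},\dots,\theta_{a_N})$. For a multiset $M$ let $S_{a,b}(M)$ be the set of distinct sequences that contain every member of $M$ exactly once (with multiplicity), start with $a$ and end with $b$; let $\tilde S_{1,2}(M)$ be the set of those $s\in S_{1,2}(M)$ in which the first number after the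 rightmost $1$ is $2$. Let $B=\{3,4,\dots,k+2\}$ and let $A=\{1^{(\times n)},2^{(\times m)},B\}$ be the multiset consisting of $n$ copies of $1$, $m$ copies of $2$, and $B$. Then the degenerate connected form factor $F_c(A)$ exists, i.e. the limit defining it exists, and $$F_c(A)=n!\,m!\sum_{B=B^+\cup B^-}\Big(\frac{F_c(1,2,B^+)}{\varphi_{12}}\sum_{s\in\tilde S_{1,2}(A\setminus B^+)}[s]_\varphi+F_c(1,B^+)\sum_{s\in S_{1,1}(A\setminus B^+)}[s]_\varphi+F_c(2,B^+)\sum_{s\in S_{2,2}(A\setminus B^+)}[s]_\varphi\Big),$$ where the sum runs over all partitions of $B$ into two disjoint, possibly empty, subsets $B^+,B^-$. -/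

import Mathlib

open Complex Filter Topology

noncomputable section

namespace DiagFF

/-- Two-particle scattering matrix of a diagonal theory with one particle species:
a meromorphic function (in normal form, so that the value `0` is taken exactly at the zeros
and at the poles) with `S(θ) S(-θ) = 1`, `S(θ) = S(iπ - θ)` and `S(0) = -1`. -/
structure IsScatteringMatrix (S : ℂ → ℂ) : Prop where
  meromorphic : MeromorphicNFOn S Set.univ
  unitarity : ∀ θ : ℂ, S (-θ) = (S θ)⁻¹
  crossing : ∀ θ : ℂ, S (Real.pi * I - θ) = S θ
  at_zero : S 0 = -1

/-- The derivative of the phase shift, `φ = d/dθ (-i log S) = -i S'/S`. -/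
def phi (S : ℂ → ℂ) (θ : ℂ) : ℂ := -I * logDeriv S θ

/-- All differences of the rapidities are regular points of `S`, neither zeros nor poles. -/
def Regular (S : ℂ → ℂ) {n : ℕ} (x : Fin n → ℂ) : Prop :=
  ∀ i j, i ≠ j → S (x i - x j) ≠ 0

/-- `∏_{i<j} cosh((x_i - x_j)/2)`. It has a simple zero along each hyperplane
`x_i - x_j = iπ (mod 2πi)`, `i ≠ j`, and no other zeros. -/
def kin {n : ℕ} (x : Fin n → ℂ) : ℂ :=
  ∏ i : Fin n, ∏ j ∈ Finset.Ioi i, Complex.cosh ((x i - x j) / 2)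

/-- Near `x` the only singularities of `f` are (at most) simple kinematical poles,
located at `x_i - x_j = iπ (mod 2πi)`. -/
def OnlyKinematicalPolesAt {n : ℕ} (f : (Fin n → ℂ) → ℂ) (x : Fin n → ℂ) : Prop :=
  ∃ G : (Fin n → ℂ) → ℂ, AnalyticAt ℂ G x ∧ ∀ᶠ y in 𝓝 x, kin y ≠ 0 → f y = G y / kin y

/-- `F n` is the elementary `n`-particle form factor of a local operator, in a theory with
scattering matrix `S`. Nothing is required of the value of `F n` at its poles. -/
structure IsFormFactor (S : ℂ → ℂ) (F : (n : ℕ) → (Fin n → ℂ) → ℂ) : Prop where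
  /-- The singularities are the kinematical poles and those inherited from `S`. -/
  analytic : ∀ (n : ℕ) (x : Fin n → ℂ), Regular S x → OnlyKinematicalPolesAt (F n) x
  /-- Exchange axiom. -/
  exchange : ∀ (n : ℕ) (x : Fin n → ℂ), Regular S x → kin x ≠ 0 →
    ∀ (j : ℕ) (hj : j + 1 < n),
      F n x = S (x ⟨j, by omega⟩ - x ⟨j + 1, hj⟩) *
        F n (x ∘ Equiv.swap ⟨j, by omega⟩ ⟨j + 1, hj⟩)
  /-- Kinematical pole axiom
  `-i Res_{θ=θ'} F_{n+2}(θ+iπ, θ', x_1, …, x_n) = (1 - ∏ S(θ'-x_k)) F_n(x_1, …, x_n)`;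
  the residue at the simple pole is the limit of `(θ-θ')F_{n+2}`. -/
  kinematical : ∀ (n : ℕ) (x : Fin n → ℂ) (θ' : ℂ), Regular S x → kin x ≠ 0 →
    (∀ k, S (θ' - x k) ≠ 0 ∧ Complex.sinh (θ' - x k) ≠ 0) →
      Tendsto
        (fun θ : ℂ => -I * ((θ - θ') *
          F (n + 2) (Fin.cons (θ + Real.pi * I) (Fin.cons θ' x))))
        (𝓝[≠] θ') (𝓝 ((1 - ∏ k, S (θ' - x k)) * F n x))

/-- The arguments `(θ_1+iπ+η_1, …, θ_N+iπ+η_N, θ_N, …, θ_1)`. -/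
def diagArgs {N : ℕ} (θ η : Fin N → ℂ) : Fin (N + N) → ℂ :=
  Fin.append (fun i => θ i + Real.pi * I + η i) (fun i => θ (Fin.rev i))

/-- `c` is the finite piece of `F_{2N}(θ_1+iπ+η_1, …, θ_N+iπ+η_N, θ_N, …, θ_1)` at `η → 0`:
the function equals `G(η)/(η_1⋯η_N)` with `G` analytic at `0`, and `c` is what remains when all
terms singular or with ratios of the `η`'s are discarded, i.e. the constant term of the
Laurent expansion. It is the coefficient of `η_1⋯η_N` in `G`, which is `∂_1⋯∂_N G (0)`. -/
def IsFinitePiece (F : (n : ℕ) → (Fin n → ℂ) → ℂ) {N : ℕ} (θ : Fin N → ℂ) (c : ℂ) : Prop :=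
  ∃ G : (Fin N → ℂ) → ℂ, AnalyticAt ℂ G 0 ∧
    (∀ᶠ η in 𝓝 (0 : Fin N → ℂ), (∀ i, η i ≠ 0) →
      F (N + N) (diagArgs θ η) = G η / ∏ i, η i) ∧
    c = iteratedFDeriv ℂ N G 0 (fun i => Pi.single i 1)

open Classical in
/-- The connected diagonal form factor `F_{2N,c}(θ_1, …, θ_N)` at pairwise distinct rapidities. -/
def connected (F : (n : ℕ) → (Fin n → ℂ) → ℂ) {N : ℕ} (θ : Fin N → ℂ) : ℂ :=
  if h : ∃ c, IsFinitePiece F θ c then h.choose else 0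

/-- `c` is the value of the connected diagonal form factor at a possibly degenerate point `θ`:
the limit of its values at pairwise distinct rapidities tending to `θ`. -/
def HasDegenerateValue (F : (n : ℕ) → (Fin n → ℂ) → ℂ) {N : ℕ} (θ : Fin N → ℂ) (c : ℂ) : Prop :=
  Tendsto (fun ϑ : Fin N → ℂ => connected F ϑ)
    (𝓝[{ϑ : Fin N → ℂ | Function.Injective ϑ}] θ) (𝓝 c)

/-- The rapidities `(θ_{l_1}, …, θ_{l_N})` of a list of labels. -/
def rapidities (θ : ℕ → ℂ) (l : List ℕ) : Fin l.length → ℂ := fun i => θ (l.get i)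

/-- `[s]_φ = φ_{s_1 s_2} φ_{s_2 s_3} ⋯ φ_{s_{n-1} s_n}`, with `φ_{jk} = φ(θ_j - θ_k)`. -/
def bracket (S : ℂ → ℂ) (θ : ℕ → ℂ) : List ℕ → ℂ
  | [] => 1
  | [_] => 1
  | a :: b :: s => phi S (θ a - θ b) * bracket S θ (b :: s)

/-- `S_{a,b}(A)`: the set of all sequences that contain every member of the multiset `A` exactly
once (with multiplicity), start with `a` and end with `b`. -/
def paths (a b : ℕ) (A : Multiset ℕ) : Finset (List ℕ) :=
  A.lists.toFinset.filter fun s => s.head? = some a ∧ s.getLast? = some b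

open Classical in
/-- `S̃_{1,2}(A)`: the sequences in `S_{1,2}(A)` in which the first number after the
rightmost `1` is `2`. -/
def paths' (A : Multiset ℕ) : Finset (List ℕ) :=
  (paths 1 2 A).filter fun s => ∃ u v : List ℕ, s = u ++ 1 :: 2 :: v ∧ 1 ∉ v

end DiagFF

end

open Complex Filter Topology

namespace DiagFF

/-! ### Division of analytic functions by linear forms -/

section Division

variable {E : Type*} [NormedAddCommGroup E] [NormedSpace ℂ E]

/-- The quotient of `p (y, …, y) - p (π y, …, π y)` by `ℓ y`, where `π y = y - ℓ y • v`. -/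
noncomputable def divTerm {n : ℕ} (p : ContinuousMultilinearMap ℂ (fun _ : Fin (n + 1) => E) ℂ)
    (π : E →L[ℂ] E) (v : E) : ContinuousMultilinearMap ℂ (fun _ : Fin n => E) ℂ :=
  ∑ k : Fin (n + 1), (p.curryMid k v).compContinuousLinearMap
    (fun i => if i.castSucc < k then π else ContinuousLinearMap.id ℂ E)

theorem mul_divTerm {n : ℕ} (p : ContinuousMultilinearMap ℂ (fun _ : Fin (n + 1) => E) ℂ)
    (ℓ : E →L[ℂ] ℂ) (v : E) (π : E →L[ℂ] E) (hπ : ∀ y, π y = y - ℓ y • v) (y : E) :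
    ℓ y * divTerm p π v (fun _ => y) = p (fun _ => y) - p (fun _ => π y) := by
  set T : ℕ → ℂ := fun k => p (fun i => if i.1 < k then π y else y) with hT
  have hstep : ∀ k : Fin (n + 1), ℓ y * (p.curryMid k v).compContinuousLinearMap
      (fun i => if i.castSucc < k then π else ContinuousLinearMap.id ℂ E) (fun _ => y)
        = T k - T (k + 1) := by
    intro k
    set m : Fin (n + 1) → E := fun i => if i.1 < k then π y else y with hm
    have h1 : T k = p (Function.update m k y) := by
      simp only [hT]; congr 1; ext i
      by_cases h : i = k
      · subst h; simp
      · simp [Function.update_of_ne h, hm]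
    have h2 : T (k + 1) = p (Function.update m k (y - ℓ y • v)) := by
      simp only [hT]; congr 1; ext i
      by_cases h : i = k
      · subst h; simp [hπ]
      · have : i.1 ≠ k.1 := fun h' => h (Fin.ext h')
        simp only [Function.update_of_ne h, hm]
        congr 1
        simp; omega
    have h3 : (p.curryMid k v).compContinuousLinearMap
      (fun i => if i.castSucc < k then π else ContinuousLinearMap.id ℂ E) (fun _ => y)
        = p (Function.update m k v) := by
      rw [ContinuousMultilinearMap.compContinuousLinearMap_apply,
        ContinuousMultilinearMap.curryMid_apply]
      congr 1
      ext i
      refine Fin.succAboveCases k ?_ (fun j => ?_) i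
      · simp
      · rw [Fin.insertNth_apply_succAbove, Function.update_of_ne (Fin.succAbove_ne k j)]
        by_cases hj : j.castSucc < k
        · have : (k.succAbove j).1 < k.1 := by
            rw [Fin.succAbove_of_castSucc_lt _ _ hj]; exact hj
          simp only [hm, hj, this, if_true]
        · have : ¬ (k.succAbove j).1 < k.1 := by
            rw [Fin.succAbove_of_le_castSucc _ _ (not_lt.1 hj)]
            have := not_lt.1 hj
            simp [Fin.le_def] at this ⊢; omega
          simp only [hm, hj, this, if_false]; rfl
    rw [h1, h2, h3, p.map_update_sub, p.map_update_smul]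
    simp
  rw [divTerm, sum_apply, Finset.mul_sum, Finset.sum_congr rfl
    (fun k _ => hstep k), Fin.sum_univ_eq_sum_range (fun k => T k - T (k + 1)),
    Finset.sum_range_sub']
  have e0 : T 0 = p fun _ => y := by simp [hT]
  have e1 : T (n + 1) = p fun _ => π y := by
    simp only [hT]; congr 1; ext i; rw [if_pos i.2]
  rw [e0, e1]

theorem norm_divTerm_le {n : ℕ} (p : ContinuousMultilinearMap ℂ (fun _ : Fin (n + 1) => E) ℂ)
    (π : E →L[ℂ] E) (v : E) : ‖divTerm p π v‖ ≤ (n + 1) * (‖p‖ * ‖v‖ * (max 1 ‖π‖) ^ n) := by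
  refine (norm_sum_le _ _).trans ?_
  have : ∀ k : Fin (n + 1), ‖(p.curryMid k v).compContinuousLinearMap
      (fun i => if i.castSucc < k then π else ContinuousLinearMap.id ℂ E)‖
        ≤ ‖p‖ * ‖v‖ * (max 1 ‖π‖) ^ n := by
    intro k
    refine (ContinuousMultilinearMap.norm_compContinuousLinearMap_le _ _).trans ?_
    refine mul_le_mul ?_ ?_ (Finset.prod_nonneg fun _ _ => norm_nonneg _) (by positivity)
    · refine ((p.curryMid k).le_opNorm v).trans ?_
      rw [ContinuousMultilinearMap.norm_curryMid]
    · refine (Finset.prod_le_prod (g := fun _ => max 1 ‖π‖)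
        (fun _ _ => norm_nonneg _) ?_).trans (by simp)
      intro i _
      split_ifs
      · exact le_max_right _ _
      · exact ContinuousLinearMap.norm_id_le.trans (le_max_left _ _)
  refine (Finset.sum_le_sum fun k _ => this k).trans ?_
  simp

/-- An analytic function vanishing on the kernel of a nonzero linear form near a point of that
kernel is divisible by the form. -/
theorem exists_analyticAt_eq_mul {f : E → ℂ} {x₀ : E} (hf : AnalyticAt ℂ f x₀) (ℓ : E →L[ℂ] ℂ)
    (hℓ : ℓ ≠ 0) (h0 : ℓ x₀ = 0) (hz : ∀ᶠ x in 𝓝 x₀, ℓ x = 0 → f x = 0) :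
    ∃ g : E → ℂ, AnalyticAt ℂ g x₀ ∧ ∀ᶠ x in 𝓝 x₀, f x = ℓ x * g x := by
  obtain ⟨v, hv⟩ : ∃ v, ℓ v = 1 := by
    obtain ⟨w, hw⟩ : ∃ w, ℓ w ≠ 0 := by
      by_contra! h
      exact hℓ (ContinuousLinearMap.ext h)
    exact ⟨(ℓ w)⁻¹ • w, by simp [hw]⟩
  set π : E →L[ℂ] E := ContinuousLinearMap.id ℂ E - ℓ.smulRight v with hπd
  have hπ : ∀ y, π y = y - ℓ y • v := fun y => by simp [hπd]
  obtain ⟨p, hp⟩ := hf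
  obtain ⟨C, r, hC, hr, hpn⟩ := p.le_mul_pow_of_radius_pos hp.radius_pos
  set c := max 1 ‖π‖ with hc
  have hc0 : 0 < c := lt_of_lt_of_le one_pos (le_max_left _ _)
  let q : FormalMultilinearSeries ℂ E ℂ := fun n => divTerm (p (n + 1)) π v
  have hq : ∀ n, ‖q n‖ * ((2 * r * c)⁻¹) ^ n ≤ C * r * ‖v‖ := by
    intro n
    have h2 : ((n : ℝ) + 1) ≤ 2 ^ n := by exact_mod_cast Nat.lt_two_pow_self
    calc ‖q n‖ * ((2 * r * c)⁻¹) ^ n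
        ≤ (2 ^ n * ((C * r ^ (n + 1)) * ‖v‖ * c ^ n)) * ((2 * r * c)⁻¹) ^ n := by
          refine mul_le_mul_of_nonneg_right ((norm_divTerm_le _ _ _).trans ?_) (by positivity)
          gcongr
          exact hpn (n + 1)
      _ = C * r * ‖v‖ * ((2 * r * c) ^ n * ((2 * r * c)⁻¹) ^ n) := by ring
      _ = C * r * ‖v‖ := by rw [← mul_pow, mul_inv_cancel₀ (by positivity), one_pow, mul_one]
  have hR : 0 < q.radius := by
    refine lt_of_lt_of_le ?_ (q.le_radius_of_bound (r := ⟨(2 * r * c)⁻¹, by positivity⟩) _ hq)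
    exact ENNReal.coe_pos.2 (show (0 : ℝ) < (2 * r * c)⁻¹ by positivity)
  have hqs := q.hasFPowerSeriesOnBall hR
  refine ⟨fun x => q.sum (x - x₀), ?_, ?_⟩
  · have : AnalyticAt ℂ q.sum (x₀ - x₀) := by rw [sub_self]; exact hqs.analyticAt
    exact this.fun_comp (f := fun x => x - x₀) (analyticAt_id.sub analyticAt_const)
  · have hs := hp.eventually_hasSum
    have hs' : ∀ᶠ y in 𝓝 (0 : E), HasSum (fun n => p n fun _ => π y) (f (x₀ + π y)) := by
      have : Tendsto π (𝓝 0) (𝓝 0) := by simpa using π.continuous.tendsto 0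
      exact this.eventually hs
    have hz' : ∀ᶠ y in 𝓝 (0 : E), f (x₀ + π y) = 0 := by
      have : Tendsto (fun y => x₀ + π y) (𝓝 0) (𝓝 x₀) := by
        have : Continuous fun y => x₀ + π y := by fun_prop
        simpa using this.tendsto 0
      filter_upwards [this.eventually hz] with y hy
      exact hy (by simp [hπ, h0, hv])
    have hq' := hqs.eventually_hasSum
    have key : ∀ᶠ y in 𝓝 (0 : E), f (x₀ + y) = ℓ y * q.sum y := by
      filter_upwards [hs, hs', hz', hq'] with y h1 h2 h3 h4
      rw [h3] at h2
      have h5 := h1.sub h2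
      rw [← hasSum_nat_add_iff' 1] at h5
      have h6 := h4.mul_left (ℓ y)
      have : (fun n => ℓ y * (q n) fun _ => y)
          = fun n => ((p (n + 1)) fun _ => y) - (p (n + 1)) fun _ => π y := by
        ext n; exact mul_divTerm _ _ _ _ hπ _
      rw [this] at h6
      have h7 := h5.unique h6
      have h8 : ((p 0) fun _ => y) = (p 0) fun _ => π y := by
        congr 1; exact Subsingleton.elim _ _
      simpa [h8] using h7
    have ht : Tendsto (fun x => x - x₀) (𝓝 x₀) (𝓝 0) := by
      have : Continuous fun x : E => x - x₀ := by fun_prop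
      simpa using this.tendsto x₀
    filter_upwards [ht.eventually key] with x hx
    simpa [h0] using hx

/-- If `f` is continuous near `x₀` and vanishes near `x₀` at the points of `ker ℓ` outside finitely
many hyperplanes, none of which contains `ker ℓ`, then it vanishes on `ker ℓ` near `x₀`. -/
theorem eventually_eq_zero_of_generic {ι : Type*} (s : Finset ι) (L : ι → E →L[ℂ] ℂ)
    (ℓ : E →L[ℂ] ℂ) (d : E) (hd : ℓ d = 0) (hL : ∀ i ∈ s, L i d ≠ 0) {f : E → ℂ} {x₀ : E}
    (hf : ∀ᶠ x in 𝓝 x₀, ContinuousAt f x)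
    (h : ∀ᶠ x in 𝓝 x₀, ℓ x = 0 → (∀ i ∈ s, L i x ≠ 0) → f x = 0) :
    ∀ᶠ x in 𝓝 x₀, ℓ x = 0 → f x = 0 := by
  filter_upwards [hf, eventually_eventually_nhds.2 h] with x hx h hℓ
  have hc : Tendsto (fun z : ℂ => x + z • d) (𝓝[≠] 0) (𝓝 x) := by
    have : Continuous fun z : ℂ => x + z • d := by fun_prop
    have := this.tendsto 0
    simp only [zero_smul, add_zero] at this
    exact this.mono_left nhdsWithin_le_nhds
  have hne : ∀ᶠ z in 𝓝[≠] (0 : ℂ), ∀ i ∈ s, L i (x + z • d) ≠ 0 := by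
    rw [Filter.eventually_all_finset]
    intro i hi
    by_cases h0 : L i x = 0
    · filter_upwards [self_mem_nhdsWithin] with z hz
      simpa [h0, hL i hi] using hz
    · have : Tendsto (fun z : ℂ => L i (x + z • d)) (𝓝[≠] 0) (𝓝 (L i x)) :=
        ((L i).continuous.tendsto x).comp hc
      exact this.eventually_ne h0
  have h1 : Tendsto (fun z : ℂ => f (x + z • d)) (𝓝[≠] 0) (𝓝 (f x)) := hx.tendsto.comp hc
  have h2 : (fun z : ℂ => f (x + z • d)) =ᶠ[𝓝[≠] 0] fun _ => 0 := by
    filter_upwards [hc.eventually h, hne] with z hz hz'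
    exact hz (by simp [hℓ, hd]) hz'
  exact tendsto_nhds_unique (h1.congr' h2) tendsto_const_nhds |>.symm ▸ rfl

/-- An analytic function vanishing on finitely many distinct hyperplanes is divisible by the
product of the corresponding linear forms. -/
theorem exists_analyticAt_eq_prod_mul {ι : Type*} [DecidableEq ι] (s : Finset ι)
    (L : ι → E →L[ℂ] ℂ) (d : ι → E) (hd : ∀ i ∈ s, L i (d i) = 0)
    (hne : ∀ i ∈ s, ∀ j ∈ s, i ≠ j → L j (d i) ≠ 0) (hL : ∀ i ∈ s, L i ≠ 0) {x₀ : E}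
    (h0 : ∀ i ∈ s, L i x₀ = 0) {f : E → ℂ} (hf : AnalyticAt ℂ f x₀)
    (hz : ∀ i ∈ s, ∀ᶠ x in 𝓝 x₀, L i x = 0 → f x = 0) :
    ∃ g : E → ℂ, AnalyticAt ℂ g x₀ ∧ ∀ᶠ x in 𝓝 x₀, f x = (∏ i ∈ s, L i x) * g x := by
  induction s using Finset.induction_on with
  | empty => exact ⟨f, hf, by simp⟩
  | insert a s ha ih =>
    simp only [Finset.mem_insert, forall_eq_or_imp] at hd hne hL h0 hz
    obtain ⟨g, hg, hfg⟩ := ih hd.2 (fun i hi => (hne.2 i hi).2) hL.2 h0.2 hz.2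
    have hga : ∀ᶠ x in 𝓝 x₀, L a x = 0 → g x = 0 := by
      refine eventually_eq_zero_of_generic s L (L a) (d a) hd.1
        (fun i hi => hne.1.2 i hi (by rintro rfl; exact ha hi))
        (hg.eventually_analyticAt.mono fun x hx => hx.continuousAt) ?_
      filter_upwards [hfg, hz.1] with x h1 h2 h3 h4
      have := h2 h3
      rw [h1] at this
      exact (mul_eq_zero.1 this).resolve_left (Finset.prod_ne_zero_iff.2 h4)
    obtain ⟨g', hg', hgg'⟩ := exists_analyticAt_eq_mul hg (L a) hL.1 h0.1 hga
    refine ⟨g', hg', ?_⟩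
    filter_upwards [hfg, hgg'] with x h1 h2
    rw [Finset.prod_insert ha, h1, h2]; ring

end Division

/-! ### Iterated derivatives of analytic functions -/

section Calculus

variable {E E' : Type*} [NormedAddCommGroup E] [NormedSpace ℂ E]
  [NormedAddCommGroup E'] [NormedSpace ℂ E']

theorem analyticAt_iteratedFDeriv {f : E → ℂ} {x : E} (hf : AnalyticAt ℂ f x) (n : ℕ) :
    AnalyticAt ℂ (iteratedFDeriv ℂ n f) x :=
  AnalyticOnNhd.iteratedFDeriv (s := {y | AnalyticAt ℂ f y}) (fun _ hy => hy) n x hf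

theorem iteratedFDeriv_comp_clm {f : E → ℂ} (g : E' →L[ℂ] E) {x : E'}
    (hf : AnalyticAt ℂ f (g x)) (n : ℕ) :
    iteratedFDeriv ℂ n (fun y => f (g y)) x
      = (iteratedFDeriv ℂ n f (g x)).compContinuousLinearMap fun _ => g := by
  set s : Set E := {y | AnalyticAt ℂ f y}
  have hs : IsOpen s := isOpen_analyticAt ℂ f
  have hs' : IsOpen (g ⁻¹' s) := hs.preimage g.continuous
  have hfs : AnalyticOnNhd ℂ f s := fun _ hy => hy
  have := g.iteratedFDerivWithin_comp_right (hfs.contDiffOn hs.uniqueDiffOn (n := n))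
    hs.uniqueDiffOn hs'.uniqueDiffOn (x := x) hf (le_refl _)
  rw [iteratedFDerivWithin_of_isOpen n hs' hf, iteratedFDerivWithin_of_isOpen n hs hf] at this
  exact this

theorem iteratedFDeriv_comp_add_clm {f : E → ℂ} (g : E' →L[ℂ] E) {a : E}
    (hf : AnalyticAt ℂ f a) (n : ℕ) (v : Fin n → E') :
    iteratedFDeriv ℂ n (fun y => f (a + g y)) 0 v = iteratedFDeriv ℂ n f a (fun i => g (v i)) := by
  have h1 : AnalyticAt ℂ (fun y => f (a + y)) (g 0) := by
    rw [map_zero]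
    have : AnalyticAt ℂ f (a + 0) := by rwa [add_zero]
    exact this.fun_comp (f := fun y => a + y) (analyticAt_const.add analyticAt_id)
  rw [iteratedFDeriv_comp_clm g h1 n, ContinuousMultilinearMap.compContinuousLinearMap_apply,
    iteratedFDeriv_comp_add_left]
  simp

theorem iteratedFDeriv_mul_eq_zero {f g : E → ℂ} {x : E} (hf : AnalyticAt ℂ f x)
    (hg : AnalyticAt ℂ g x) {a b : ℕ} (ha : ∀ i < a, iteratedFDeriv ℂ i f x = 0)
    (hb : ∀ i < b, iteratedFDeriv ℂ i g x = 0) {k : ℕ} (hk : k < a + b) :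
    iteratedFDeriv ℂ k (fun y => f y * g y) x = 0 := by
  set s : Set E := {y | AnalyticAt ℂ f y} ∩ {y | AnalyticAt ℂ g y}
  have hs : IsOpen s := (isOpen_analyticAt ℂ f).inter (isOpen_analyticAt ℂ g)
  have hx : x ∈ s := ⟨hf, hg⟩
  have hfs : AnalyticOnNhd ℂ f s := fun _ hy => hy.1
  have hgs : AnalyticOnNhd ℂ g s := fun _ hy => hy.2
  have := norm_iteratedFDerivWithin_mul_le (hfs.contDiffOn hs.uniqueDiffOn (n := k))
    (hgs.contDiffOn hs.uniqueDiffOn (n := k)) hs.uniqueDiffOn hx (le_refl _)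
  rw [← norm_le_zero_iff, ← iteratedFDerivWithin_of_isOpen k hs hx]
  refine this.trans (le_of_eq (Finset.sum_eq_zero fun i hi => ?_))
  rw [iteratedFDerivWithin_of_isOpen _ hs hx, iteratedFDerivWithin_of_isOpen _ hs hx]
  rw [Finset.mem_range] at hi
  by_cases h : i < a
  · simp [ha i h]
  · simp [hb (k - i) (by omega)]

/-- Leibniz rule for the product with a linear form. -/
theorem iteratedFDeriv_linear_mul (κ : E →L[ℂ] ℂ) {g : E → ℂ} (n : ℕ) :
    ∀ {x : E}, AnalyticAt ℂ g x → ∀ v : Fin (n + 1) → E,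
    iteratedFDeriv ℂ (n + 1) (fun y => κ y * g y) x v = κ x * iteratedFDeriv ℂ (n + 1) g x v
      + ∑ k, κ (v k) * iteratedFDeriv ℂ n g x (fun i => v (k.succAbove i)) := by
  induction n with
  | zero =>
    intro x hg v
    have h := (κ.hasFDerivAt (x := x)).mul hg.differentiableAt.hasFDerivAt
    rw [iteratedFDeriv_one_apply, iteratedFDeriv_one_apply]
    have h' : fderiv ℂ (fun y => κ y * g y) x = _ := h.fderiv
    rw [h']
    simp [mul_comm]
  | succ n ih =>
    intro x hg v
    have key : ∀ (f : E → ℂ) (m : ℕ), AnalyticAt ℂ f x → ∀ w : Fin (m + 1) → E,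
        iteratedFDeriv ℂ (m + 1) f x w
          = fderiv ℂ (fun y => iteratedFDeriv ℂ m f y (Fin.tail w)) x (w 0) := by
      intro f m hf w
      rw [iteratedFDeriv_succ_apply_left]
      have h := (analyticAt_iteratedFDeriv hf m).differentiableAt.hasFDerivAt
      have h2 := ((ContinuousMultilinearMap.apply ℂ (fun _ : Fin m => E) ℂ
        (Fin.tail w)).hasFDerivAt (x := iteratedFDeriv ℂ m f x)).comp x h
      have h3 : fderiv ℂ (fun y => iteratedFDeriv ℂ m f y (Fin.tail w)) x = _ := h2.fderiv
      rw [h3]; rfl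
    have hκg : AnalyticAt ℂ (fun y => κ y * g y) x := (κ.analyticAt x).mul hg
    rw [key _ _ hκg]
    have heq : (fun y => iteratedFDeriv ℂ (n + 1) (fun y => κ y * g y) y (Fin.tail v)) =ᶠ[𝓝 x]
        fun y => κ y * iteratedFDeriv ℂ (n + 1) g y (Fin.tail v)
        + ∑ k, κ (Fin.tail v k) * iteratedFDeriv ℂ n g y (fun i => Fin.tail v (k.succAbove i)) :=
      hg.eventually_analyticAt.mono fun y hy => ih hy (Fin.tail v)
    rw [heq.fderiv_eq]
    have hd : ∀ (m : ℕ) (w : Fin m → E),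
        DifferentiableAt ℂ (fun y => iteratedFDeriv ℂ m g y w) x := by
      intro m w
      have h := (analyticAt_iteratedFDeriv hg m).differentiableAt
      exact ((ContinuousMultilinearMap.apply ℂ (fun _ : Fin m => E) ℂ w).differentiableAt).comp x h
    rw [fderiv_fun_add (κ.differentiableAt.fun_mul (hd _ _))
      (DifferentiableAt.fun_sum fun k _ => (hd _ _).const_mul _),
      fderiv_fun_mul κ.differentiableAt (hd _ _),
      fderiv_fun_sum (fun k _ => (hd _ _).const_mul _), κ.fderiv, Fin.sum_univ_succ (fun k =>
        κ (v k) * iteratedFDeriv ℂ (n + 1) g x (fun i => v (k.succAbove i)))]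
    have e1 : ∀ k : Fin (n + 1), iteratedFDeriv ℂ (n + 1) g x
        (fun i => v (k.succ.succAbove i)) = fderiv ℂ (fun y => iteratedFDeriv ℂ n g y
          (fun i => Fin.tail v (k.succAbove i))) x (v 0) := by
      intro k
      rw [key g n hg]
      have : Fin.tail (fun i => v (k.succ.succAbove i)) = fun i => Fin.tail v (k.succAbove i) := by
        ext i; simp [Fin.tail]
      rw [this]; simp
    have e2 : (fun i => v (Fin.succAbove 0 i)) = Fin.tail v := by ext i; simp [Fin.tail]
    simp only [add_apply, smul_apply, smul_eq_mul, sum_apply, e1, e2, key g _ hg v,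
      fderiv_const_mul (hd _ _)]
    simp only [Fin.tail]
    ring

theorem iteratedDeriv_id_mul {g : ℂ → ℂ} (hg : AnalyticAt ℂ g 0) (n : ℕ) :
    iteratedDeriv (n + 1) (fun z => z * g z) 0 = (n + 1) * iteratedDeriv n g 0 := by
  have := iteratedFDeriv_linear_mul (ContinuousLinearMap.id ℂ ℂ) n hg (fun _ => 1)
  simp only [ContinuousLinearMap.id_apply] at this
  rw [iteratedDeriv_eq_iteratedFDeriv, this, iteratedDeriv_eq_iteratedFDeriv]
  simp

/-- If the analytic germ `R(z, w)` vanishes to order `N` in `z`, uniformly in `w`, then along the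
diagonal it is equivalent to its leading term at `w = 0`. -/
theorem tendsto_diag_div_pow (N : ℕ) : ∀ {R : ℂ × ℂ → ℂ}, AnalyticAt ℂ R 0 →
    (∀ᶠ w in 𝓝 (0 : ℂ), ∀ k < N, iteratedDeriv k (fun z => R (z, w)) 0 = 0) →
    Tendsto (fun z => R (z, z) / z ^ N) (𝓝[≠] 0)
      (𝓝 (iteratedDeriv N (fun z => R (z, 0)) 0 / N.factorial)) := by
  induction N with
  | zero =>
    intro R hR _
    have h : Tendsto (fun z : ℂ => R (z, z)) (𝓝 0) (𝓝 (R 0)) := by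
      have h2 : Tendsto (fun z : ℂ => (z, z)) (𝓝 0) (𝓝 (0 : ℂ × ℂ)) := by
        have : Continuous fun z : ℂ => (z, z) := by fun_prop
        exact this.tendsto 0
      exact hR.continuousAt.tendsto.comp h2
    have h3 := h.mono_left (nhdsWithin_le_nhds (s := {0}ᶜ))
    simp only [pow_zero, div_one, iteratedDeriv_zero, Nat.factorial_zero, Nat.cast_one]
    exact h3
  | succ N ih =>
    intro R hR h0
    have hne : ContinuousLinearMap.fst ℂ ℂ ℂ ≠ 0 := fun h => by
      have := DFunLike.congr_fun h ((1 : ℂ), (0 : ℂ)); simp at this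
    obtain ⟨R', hR', hRR⟩ := exists_analyticAt_eq_mul hR (ContinuousLinearMap.fst ℂ ℂ ℂ) hne rfl (by
      have h1 : Tendsto (fun p : ℂ × ℂ => p.2) (𝓝 0) (𝓝 0) := continuous_snd.tendsto _
      filter_upwards [h1.eventually h0] with p hp hp1
      have := hp 0 (Nat.succ_pos N)
      rw [iteratedDeriv_zero] at this
      rw [show p = (0, p.2) from Prod.ext hp1 rfl]; exact this)
    have hslice : ∀ᶠ w in 𝓝 (0 : ℂ), AnalyticAt ℂ (fun z => R' (z, w)) 0 ∧
        ∀ᶠ z in 𝓝 (0 : ℂ), R (z, w) = z * R' (z, w) := by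
      have h1 : Tendsto (fun w : ℂ => ((0 : ℂ), w)) (𝓝 0) (𝓝 0) := by
        have : Continuous fun w : ℂ => ((0 : ℂ), w) := by fun_prop
        exact this.tendsto 0
      filter_upwards [h1.eventually hR'.eventually_analyticAt,
        h1.eventually (eventually_eventually_nhds.2 hRR)] with w hw1 hw2
      refine ⟨hw1.fun_comp (f := fun z : ℂ => (z, w)) (analyticAt_id.prod analyticAt_const), ?_⟩
      have h3 : Tendsto (fun z : ℂ => (z, w)) (𝓝 0) (𝓝 (0, w)) := by
        have : Continuous fun z : ℂ => (z, w) := by fun_prop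
        exact this.tendsto 0
      exact h3.eventually hw2
    have hder : ∀ᶠ w in 𝓝 (0 : ℂ), ∀ k, iteratedDeriv (k + 1) (fun z => R (z, w)) 0
        = (k + 1) * iteratedDeriv k (fun z => R' (z, w)) 0 := by
      filter_upwards [hslice] with w hw k
      rw [← iteratedDeriv_id_mul hw.1 k]
      exact Filter.EventuallyEq.iteratedDeriv_eq (k + 1) hw.2
    have h1 := ih hR' (by
      filter_upwards [h0, hder] with w hw hw' k hk
      have := hw (k + 1) (by omega)
      rw [hw' k] at this
      exact (mul_eq_zero.1 this).resolve_left (by exact_mod_cast Nat.succ_ne_zero k))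
    have h2 : iteratedDeriv (N + 1) (fun z => R (z, 0)) 0 / (N + 1).factorial
        = iteratedDeriv N (fun z => R' (z, 0)) 0 / N.factorial := by
      rw [hder.self_of_nhds N, Nat.factorial_succ]
      have : (N : ℂ) + 1 ≠ 0 := by exact_mod_cast Nat.succ_ne_zero N
      push_cast
      rw [mul_div_mul_left _ _ this]
    rw [h2]
    refine h1.congr' ?_
    have h3 : Tendsto (fun z : ℂ => (z, z)) (𝓝[≠] 0) (𝓝 (0 : ℂ × ℂ)) := by
      have : Continuous fun z : ℂ => (z, z) := by fun_prop
      exact (this.tendsto 0).mono_left nhdsWithin_le_nhds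
    filter_upwards [h3.eventually hRR, self_mem_nhdsWithin] with z hz hz0
    rw [hz]
    have : z ≠ 0 := hz0
    simp only [ContinuousLinearMap.coe_fst']
    field_simp
    ring

/-- Polarization: the derivative of the homogeneous form of a symmetric multilinear map. -/
theorem iteratedFDeriv_diag {n : ℕ} (D : ContinuousMultilinearMap ℂ (fun _ : Fin n => E) ℂ)
    (hD : ∀ (v : Fin n → E) (σ : Equiv.Perm (Fin n)), D (v ∘ σ) = D v) (x : E) (v : Fin n → E) :
    iteratedFDeriv ℂ n (fun ξ => D fun _ => ξ) x v = n.factorial * D v := by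
  rw [ContinuousMultilinearMap.iteratedFDeriv_comp_diagonal]
  have : ∀ σ : Equiv.Perm (Fin n), (D fun i => v (σ i)) = D v := fun σ => hD v σ
  simp [this, Fintype.card_perm]

/-- A symmetric multilinear map whose homogeneous form is invariant under translations by multiples
of `τ` is annihilated by `τ`. -/
theorem apply_eq_zero_of_translation {n : ℕ}
    (D : ContinuousMultilinearMap ℂ (fun _ : Fin (n + 1) => E) ℂ)
    (hD : ∀ (v : Fin (n + 1) → E) (σ : Equiv.Perm (Fin (n + 1))), D (v ∘ σ) = D v) {τ : E}
    (hτ : ∀ (ξ : E) (c : ℂ), D (fun _ => ξ + c • τ) = D fun _ => ξ) (v : Fin (n + 1) → E)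
    (k : Fin (n + 1)) (hk : v k = τ) : D v = 0 := by
  wlog hk' : k = Fin.last n generalizing v k
  · rw [← hD v (Equiv.swap k (Fin.last n))]
    exact this _ (Fin.last n) (by simp [hk]) rfl
  subst hk'
  have h := iteratedFDeriv_diag D hD 0 v
  set Q : E → ℂ := fun ξ => D fun _ => ξ with hQ
  have hQd : Differentiable ℂ Q := by
    have : ContDiff ℂ 1 Q := D.contDiff.comp (contDiff_pi.2 fun _ => contDiff_id)
    exact this.differentiable one_ne_zero
  have hfd : ∀ y, fderiv ℂ Q y τ = 0 := by
    intro y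
    have h1 : HasDerivAt (fun c : ℂ => y + c • τ) τ 0 := by
      simpa using ((hasDerivAt_id (0 : ℂ)).smul_const τ).const_add y
    have h2 : HasDerivAt (fun c : ℂ => Q (y + c • τ)) (fderiv ℂ Q y τ) 0 := by
      have h3 : HasFDerivAt Q (fderiv ℂ Q y) (y + (0 : ℂ) • τ) := by
        simpa using (hQd y).hasFDerivAt
      exact h3.comp_hasDerivAt 0 h1
    have h4 : (fun c : ℂ => Q (y + c • τ)) = fun _ => Q y := by ext c; exact hτ y c
    rw [h4] at h2
    exact h2.unique (hasDerivAt_const _ _)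
  have h5 : iteratedFDeriv ℂ (n + 1) Q 0 v = 0 := by
    rw [iteratedFDeriv_succ_apply_right, hk]
    have han : AnalyticAt ℂ (fderiv ℂ Q) 0 := by
      have : ContDiff ℂ ⊤ Q := D.contDiff.comp (contDiff_pi.2 fun _ => contDiff_id)
      exact (this.contDiffAt.analyticAt).fderiv
    have h6 := (ContinuousLinearMap.apply ℂ ℂ τ).iteratedFDeriv_comp_left
      (f := fderiv ℂ Q) (x := 0) (n := n) (i := n) (han.contDiffAt) le_rfl
    have h7 : (ContinuousLinearMap.apply ℂ ℂ τ) ∘ fderiv ℂ Q = fun _ => 0 := by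
      ext y; exact hfd y
    rw [h7] at h6
    have h8 := DFunLike.congr_fun h6 (Fin.init v)
    simp only [ContinuousLinearMap.compContinuousMultilinearMap_coe, Function.comp] at h8
    rw [← ContinuousLinearMap.apply_apply (𝕜 := ℂ) τ, ← h8]
    have : iteratedFDeriv ℂ n (fun _ : E => (0 : ℂ)) 0 = 0 := by
      exact congrFun (iteratedFDeriv_fun_zero (𝕜 := ℂ)) 0
    rw [this]; rfl
  rw [h5] at h
  exact (mul_eq_zero.1 h.symm).resolve_left (by exact_mod_cast Nat.factorial_ne_zero _)

end Calculus

/-! ### The scattering matrix -/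

namespace IsScatteringMatrix

variable {S : ℂ → ℂ} (hS : IsScatteringMatrix S)
include hS

theorem analyticAt {z : ℂ} (hz : S z ≠ 0) : AnalyticAt ℂ S z := by
  rcases meromorphicNFAt_iff_analyticAt_or.1 (hS.meromorphic (Set.mem_univ z)) with h | h
  · exact h
  · exact absurd h.2.2 hz

theorem sub_ne_zero_symm {a b : ℂ} (h : S (a - b) ≠ 0) : S (b - a) ≠ 0 := by
  rw [← neg_sub, hS.unitarity]; exact inv_ne_zero h

theorem add_pi (y : ℂ) : S (y + Real.pi * I) = (S y)⁻¹ := by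
  rw [← hS.unitarity, ← hS.crossing (-y)]; congr 1; ring

theorem sub_pi (y : ℂ) : S (y - Real.pi * I) = (S y)⁻¹ := by
  rw [← hS.crossing y, ← hS.unitarity]; congr 1; ring

end IsScatteringMatrix

/-! ### Form factors as functions of lists of rapidities -/

/-- The form factor as a function of the list of its arguments. -/
def listFF (F : (n : ℕ) → (Fin n → ℂ) → ℂ) (l : List ℂ) : ℂ := F l.length l.get

/-- The difference of two rapidities is not a zero or pole of `S`, nor a kinematical pole. -/
def Generic (S : ℂ → ℂ) (a b : ℂ) : Prop := S (a - b) ≠ 0 ∧ cosh ((a - b) / 2) ≠ 0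

theorem listFF_ofFn (F : (n : ℕ) → (Fin n → ℂ) → ℂ) {n : ℕ} (f : Fin n → ℂ) :
    listFF F (List.ofFn f) = F n f := by
  have h : (⟨(List.ofFn f).length, (List.ofFn f).get⟩ : Σ n, Fin n → ℂ) = ⟨n, f⟩ :=
    List.equivSigmaTuple.right_inv ⟨n, f⟩
  exact congrArg (fun s : Σ n, Fin n → ℂ => F s.1 s.2) h

section

variable {S : ℂ → ℂ} (hS : IsScatteringMatrix S)
include hS

theorem Generic.symm {a b : ℂ} (h : Generic S a b) : Generic S b a := by
  refine ⟨hS.sub_ne_zero_symm h.1, ?_⟩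
  rw [← neg_sub, neg_div, cosh_neg]; exact h.2

theorem regular_get {l : List ℂ} (hl : l.Pairwise (Generic S)) : Regular S l.get := by
  intro i j hij
  rw [List.pairwise_iff_get] at hl
  rcases lt_or_gt_of_ne hij with h | h
  · exact (hl i j h).1
  · exact hS.sub_ne_zero_symm (hl j i h).1

omit hS in
theorem kin_get_ne_zero {l : List ℂ} (hl : l.Pairwise (Generic S)) : kin l.get ≠ 0 := by
  rw [List.pairwise_iff_get] at hl
  unfold kin
  refine Finset.prod_ne_zero_iff.2 fun i _ => Finset.prod_ne_zero_iff.2 fun j hj => ?_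
  exact (hl i j (Finset.mem_Ioi.1 hj)).2

theorem pairwise_generic_perm {l l' : List ℂ} (hl : l.Pairwise (Generic S)) (h : l.Perm l') :
    l'.Pairwise (Generic S) :=
  h.pairwise hl (fun hab => hab.symm hS)

variable {F : (n : ℕ) → (Fin n → ℂ) → ℂ} (hF : IsFormFactor S F)
include hF

theorem listFF_exchange {u v : List ℂ} {a b : ℂ} (hl : (u ++ a :: b :: v).Pairwise (Generic S)) :
    listFF F (u ++ a :: b :: v) = S (a - b) * listFF F (u ++ b :: a :: v) := by
  have hj : u.length + 1 < (u ++ a :: b :: v).length := by simp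
  have h := hF.exchange _ _ (regular_get hS hl) (kin_get_ne_zero hl) u.length hj
  rw [listFF, h]
  congr 1
  · simp
  · rw [← listFF_ofFn F]
    congr 1
    refine List.ext_getElem (by simp; omega) fun i h1 h2 => ?_
    rw [List.getElem_ofFn]
    simp only [Function.comp, List.get_eq_getElem]
    rcases lt_trichotomy i u.length with h3 | h3 | h3
    · rw [Equiv.swap_apply_of_ne_of_ne (by simp [Fin.ext_iff]; omega)
        (by simp [Fin.ext_iff]; omega)]
      simp [List.getElem_append_left h3]
    · subst h3
      simp
    · obtain ⟨d, rfl⟩ := Nat.exists_eq_add_of_lt h3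
      rcases Nat.eq_zero_or_pos d with h4 | h4
      · subst h4
        have : (⟨u.length + 0 + 1, by simp⟩ : Fin (u ++ a :: b :: v).length)
          = ⟨u.length + 1, hj⟩ := rfl
        rw [this, Equiv.swap_apply_right]
        simp
      · rw [Equiv.swap_apply_of_ne_of_ne (by simp [Fin.ext_iff]; omega)
          (by simp [Fin.ext_iff]; omega)]
        obtain ⟨e, rfl⟩ := Nat.exists_eq_add_of_lt h4
        rw [List.getElem_append_right (by simp; omega), List.getElem_append_right (by omega)]
        have : u.length + (0 + e + 1) + 1 - u.length = e + 1 + 1 := by omega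
        simp only [this, List.getElem_cons_succ]

/-- Moving an argument to the front. -/
theorem listFF_move (u v : List ℂ) (a : ℂ) (hl : (u ++ a :: v).Pairwise (Generic S)) :
    listFF F (u ++ a :: v) = (u.map fun y => S (y - a)).prod * listFF F (a :: (u ++ v)) := by
  induction u using List.reverseRecOn generalizing v with
  | nil => simp
  | append_singleton u b ih =>
    have e : u ++ [b] ++ a :: v = u ++ b :: a :: v := by simp
    rw [e] at hl ⊢
    rw [listFF_exchange hS hF hl, ih _ (pairwise_generic_perm hS hl
      (List.Perm.append_left u (List.Perm.swap _ _ _)))]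
    simp only [List.map_append, List.prod_append, List.map_cons, List.map_nil, List.prod_cons,
      List.prod_nil, List.append_assoc, List.cons_append, List.nil_append]
    ring

/-- Form factors vanish at coinciding arguments, because `S(0) = -1`. -/
theorem listFF_eq_zero {l : List ℂ} (hl : l.Pairwise (Generic S)) (h : ¬ l.Nodup) :
    listFF F l = 0 := by
  obtain ⟨a, ha⟩ : ∃ a, [a, a].Sublist l := by
    by_contra! hc
    exact h (List.nodup_iff_sublist.2 hc)
  obtain ⟨u, v, rfl⟩ := List.append_of_mem (ha.subset (List.mem_cons_self ..))
  have hav : a ∈ u ++ v := by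
    have h2 : 2 ≤ (u ++ a :: v).count a := by simpa using ha.count_le a
    rw [List.count_append, List.count_cons_self] at h2
    rw [← List.count_pos_iff, List.count_append]
    omega
  obtain ⟨u', v', huv⟩ := List.append_of_mem hav
  have h1 : (a :: (u ++ v)).Pairwise (Generic S) :=
    pairwise_generic_perm hS hl List.perm_middle
  rw [listFF_move hS hF u v a hl, huv]
  rw [huv] at h1
  have h2 := listFF_move hS hF (a :: u') v' a h1
  rw [List.cons_append] at h2
  rw [h2]
  have h3 : (a :: ((a :: u') ++ v')).Pairwise (Generic S) :=
    pairwise_generic_perm hS h1 (List.perm_middle (l₁ := a :: u'))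
  have h4 := listFF_exchange hS hF (u := []) h3
  rw [sub_self, hS.at_zero] at h4
  have h5 : listFF F (a :: ((a :: u') ++ v')) = 0 := by
    simp only [List.nil_append] at h4
    rw [List.cons_append]
    linear_combination h4 / 2
  rw [h5]; simp

omit hS in
theorem listFF_kinematical {l : List ℂ} {z : ℂ} (hl : l.Pairwise (Generic S))
    (hS : IsScatteringMatrix S)
    (hz : ∀ y ∈ l, S (z - y) ≠ 0 ∧ sinh (z - y) ≠ 0) :
    Tendsto (fun w : ℂ => -I * ((w - z) * listFF F ((w + Real.pi * I) :: z :: l))) (𝓝[≠] z)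
      (𝓝 ((1 - (l.map fun y => S (z - y)).prod) * listFF F l)) := by
  have h := hF.kinematical l.length l.get z (regular_get hS hl) (kin_get_ne_zero hl)
    (fun k => hz _ (List.get_mem l k))
  have e : (l.map fun y => S (z - y)).prod = ∏ k, S (z - l.get k) := by
    rw [← List.prod_ofFn]
    congr 1
    refine List.ext_getElem (by simp) fun i h1 h2 => ?_
    simp
  rw [e]
  refine h.congr fun w => ?_
  rw [← listFF_ofFn F, List.ofFn_cons, List.ofFn_cons, List.ofFn_get]

end

/-! ### The form factor near the diagonal -/

/-- `F_{2N}(x_1 + iπ, …, x_N + iπ, t_N, …, t_1)`. -/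
noncomputable def diagFF (F : (n : ℕ) → (Fin n → ℂ) → ℂ) {N : ℕ} (x t : Fin N → ℂ) : ℂ :=
  F (N + N) (Fin.append (fun i => x i + Real.pi * I) (fun i => t (Fin.rev i)))

theorem ofFn_diag {N : ℕ} (x t : Fin N → ℂ) :
    List.ofFn (Fin.append (fun i => x i + Real.pi * I) (fun i => t (Fin.rev i)))
      = List.ofFn (fun i => x i + Real.pi * I) ++ (List.ofFn t).reverse := by
  rw [List.ofFn_fin_append]
  congr 1
  refine List.ext_getElem (by simp) fun i h1 h2 => ?_
  simp only [List.getElem_ofFn, List.getElem_reverse, List.length_ofFn]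
  congr 1
  ext
  simp [Fin.rev]
  omega

theorem diagFF_eq_listFF (F : (n : ℕ) → (Fin n → ℂ) → ℂ) {N : ℕ} (x t : Fin N → ℂ) :
    diagFF F x t = listFF F (List.ofFn (fun i => x i + Real.pi * I) ++ (List.ofFn t).reverse) := by
  rw [diagFF, ← listFF_ofFn F, ofFn_diag]

/-- The differences of the `y`'s are regular points of `S`, and are nonzero modulo `iπ` unless they
vanish. -/
def Admissible (S : ℂ → ℂ) {ι : Type*} (y : ι → ℂ) : Prop :=
  ∀ a b, S (y a - y b) ≠ 0 ∧ (y a ≠ y b → sinh (y a - y b) ≠ 0)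

theorem eventually_sinh_ne_zero : ∀ᶠ z in 𝓝 (0 : ℂ), z ≠ 0 → sinh z ≠ 0 := by
  have h : HasDerivAt sinh (cosh 0) 0 := Complex.hasDerivAt_sinh 0
  have h2 := h.eventually_ne (c := 0) (by simp)
  rw [eventually_nhdsWithin_iff] at h2
  exact h2

theorem cosh_half_ne_zero {d : ℂ} (h : d ≠ 0 → sinh d ≠ 0) : cosh (d / 2) ≠ 0 := by
  intro hc
  by_cases hd : d = 0
  · simp [hd] at hc
  · apply h hd
    rw [show d = 2 * (d / 2) by ring, sinh_two_mul, hc]; simp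

theorem cosh_half_add_pi (d : ℂ) : cosh ((d + Real.pi * I) / 2) = I * sinh (d / 2) := by
  have : (d + Real.pi * I) / 2 = d / 2 + (Real.pi / 2) * I := by ring
  rw [this, cosh_add, cosh_mul_I, sinh_mul_I]
  simp [Complex.cos_pi_div_two, Complex.sin_pi_div_two]
  ring

theorem sinh_half_ne_zero {d : ℂ} (h : sinh d ≠ 0) : sinh (d / 2) ≠ 0 := by
  intro hc
  apply h
  rw [show d = 2 * (d / 2) by ring, sinh_two_mul, hc]; simp

section

variable {S : ℂ → ℂ} (hS : IsScatteringMatrix S)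
include hS

theorem eventually_admissible {ι : Type*} [Finite ι] {y₀ : ι → ℂ} (h : Admissible S y₀) :
    ∀ᶠ y in 𝓝 y₀, Admissible S y := by
  unfold Admissible
  simp only [Filter.eventually_all]
  intro a b
  have hc : Tendsto (fun y : ι → ℂ => y a - y b) (𝓝 y₀) (𝓝 (y₀ a - y₀ b)) := by
    have : Continuous fun y : ι → ℂ => y a - y b := by fun_prop
    exact this.tendsto _
  refine ((hS.analyticAt (h a b).1).continuousAt.tendsto.comp hc).eventually_ne (h a b).1 |>.and ?_
  by_cases hab : y₀ a = y₀ b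
  · rw [hab, sub_self] at hc
    filter_upwards [hc.eventually eventually_sinh_ne_zero] with y hy hne
    exact hy (sub_ne_zero.2 hne)
  · have h1 : Tendsto (fun y : ι → ℂ => sinh (y a - y b)) (𝓝 y₀) (𝓝 (sinh (y₀ a - y₀ b))) :=
      (Complex.continuous_sinh.tendsto _).comp hc
    filter_upwards [h1.eventually_ne ((h a b).2 hab)] with y hy _ using hy

theorem eventually_admissible_pair {N : ℕ} {θ₀ : Fin N → ℂ} (h : Admissible S θ₀) :
    ∀ᶠ p in 𝓝 (θ₀, θ₀), Admissible S (Sum.elim p.1 p.2 : Fin N ⊕ Fin N → ℂ) := by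
  have h0 : Admissible S (Sum.elim θ₀ θ₀ : Fin N ⊕ Fin N → ℂ) := by
    rintro (a | a) (b | b) <;> exact h a b
  have hc : Tendsto (fun p : (Fin N → ℂ) × (Fin N → ℂ) => (Sum.elim p.1 p.2 : Fin N ⊕ Fin N → ℂ))
      (𝓝 (θ₀, θ₀)) (𝓝 (Sum.elim θ₀ θ₀)) := by
    refine tendsto_pi_nhds.2 ?_
    rintro (a | a)
    · have : Continuous fun p : (Fin N → ℂ) × (Fin N → ℂ) => p.1 a := by fun_prop
      exact this.tendsto _
    · have : Continuous fun p : (Fin N → ℂ) × (Fin N → ℂ) => p.2 a := by fun_prop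
      exact this.tendsto _
  exact hc.eventually (eventually_admissible hS h0)

omit hS in
theorem generic_of_admissible {ι : Type*} {y : ι → ℂ} (h : Admissible S y) (a b : ι) :
    Generic S (y a) (y b) :=
  ⟨(h a b).1, cosh_half_ne_zero fun hd => (h a b).2 (sub_ne_zero.1 hd)⟩

theorem generic_add_pi_of_admissible {ι : Type*} {y : ι → ℂ} (h : Admissible S y) {a b : ι}
    (hab : y a ≠ y b) : Generic S (y a + Real.pi * I) (y b) := by
  have e : y a + Real.pi * I - y b = (y a - y b) + Real.pi * I := by ring
  refine ⟨?_, ?_⟩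
  · rw [e, hS.add_pi]; exact inv_ne_zero (h a b).1
  · rw [e, cosh_half_add_pi]
    exact mul_ne_zero I_ne_zero (sinh_half_ne_zero ((h a b).2 hab))

theorem pairwise_generic_diag {N : ℕ} {x t : Fin N → ℂ}
    (h : Admissible S (Sum.elim x t : Fin N ⊕ Fin N → ℂ)) (hxt : ∀ i j, x i ≠ t j) :
    (List.ofFn (fun i => x i + Real.pi * I) ++ (List.ofFn t).reverse).Pairwise (Generic S) := by
  rw [List.pairwise_append, List.pairwise_reverse, List.pairwise_ofFn, List.pairwise_ofFn]
  refine ⟨fun i j _ => ?_, fun i j _ => generic_of_admissible h (.inr j) (.inr i), ?_⟩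
  · have := generic_of_admissible h (.inl i) (.inl j)
    simpa [Generic] using this
  · intro a ha b hb
    rw [List.mem_ofFn] at ha
    rw [List.mem_reverse, List.mem_ofFn] at hb
    obtain ⟨i, rfl⟩ := ha
    obtain ⟨j, rfl⟩ := hb
    exact generic_add_pi_of_admissible hS h (a := .inl i) (b := .inr j) (hxt i j)

variable {F : (n : ℕ) → (Fin n → ℂ) → ℂ} (hF : IsFormFactor S F)
include hF

theorem diagFF_eq_zero {N : ℕ} {x t : Fin N → ℂ}
    (h : Admissible S (Sum.elim x t : Fin N ⊕ Fin N → ℂ)) (hxt : ∀ i j, x i ≠ t j)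
    {i j : Fin N} (hij : i ≠ j) (he : x i = x j ∨ t i = t j) : diagFF F x t = 0 := by
  rw [diagFF_eq_listFF]
  refine listFF_eq_zero hS hF (pairwise_generic_diag hS h hxt) fun hn => ?_
  rw [List.nodup_append, List.nodup_reverse, List.nodup_ofFn, List.nodup_ofFn] at hn
  rcases he with he | he
  · exact hij (hn.1 (by simp [he]))
  · exact hij (hn.2.1 he)

end

/-! ### Products over pairs -/

theorem prod_prod_eq_diag_mul {N : ℕ} (f : Fin N → Fin N → ℂ) :
    ∏ i, ∏ j, f i j = (∏ i, f i i) * ∏ i, ∏ j, if i < j then f i j * f j i else 1 := by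
  have h1 : ∀ i j, f i j = (if i = j then f i i else 1) *
      ((if i < j then f i j else 1) * if j < i then f i j else 1) := by
    intro i j
    rcases lt_trichotomy i j with h | h | h
    · simp [h, h.ne, h.not_gt]
    · simp [h]
    · simp [h, h.ne', h.not_gt]
  have h2 : ∀ i j, (if i < j then f i j * f j i else 1)
      = (if i < j then f i j else 1) * if i < j then f j i else 1 := by
    intro i j; split_ifs <;> simp
  simp_rw [h2]
  conv_lhs => enter [2, i, 2, j]; rw [h1]
  simp_rw [Finset.prod_mul_distrib]
  rw [Finset.prod_comm (f := fun i j => if j < i then f i j else 1)]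
  simp

theorem kin_append {M N : ℕ} (f : Fin M → ℂ) (g : Fin N → ℂ) :
    kin (Fin.append f g) = kin f * kin g * ∏ i, ∏ j, cosh ((f i - g j) / 2) := by
  have h : ∀ {n : ℕ} (x : Fin n → ℂ), kin x = ∏ i, ∏ j, if i < j then cosh ((x i - x j) / 2)
      else 1 := by
    intro n x
    unfold kin
    refine Finset.prod_congr rfl fun i _ => ?_
    rw [← Finset.prod_filter]
    congr 1; ext j; simp
  rw [h, h, h, Fin.prod_univ_add]
  simp only [Fin.prod_univ_add, Fin.append_left, Fin.append_right]
  have h1 : ∀ (i j : Fin M), Fin.castAdd N i < Fin.castAdd N j ↔ i < j := fun i j => Iff.rfl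
  have h2 : ∀ (i : Fin M) (j : Fin N), Fin.castAdd N i < Fin.natAdd M j := fun i j => by
    simp [Fin.lt_def]; omega
  have h3 : ∀ (i : Fin M) (j : Fin N), ¬ Fin.natAdd M j < Fin.castAdd N i := fun i j =>
    (h2 i j).not_gt
  have h4 : ∀ (i j : Fin N), Fin.natAdd M i < Fin.natAdd M j ↔ i < j := fun i j => by simp
  simp only [h1, h2, h3, h4, if_true, if_false, Finset.prod_mul_distrib, Finset.prod_const_one]
  ring

/-- The cross ratio of the pairs `(x_i, t_i)` and `(x_j, t_j)`. -/
noncomputable def pairRatio {N : ℕ} (x t : Fin N → ℂ) (i j : Fin N) : ℂ :=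
  (x i - x j) * (t j - t i) / ((x i - t j) * (x j - t i))

/-- The product of the cross ratios over all pairs of labels that coincide at `θ₀`. -/
noncomputable def pairProd {N : ℕ} (θ₀ x t : Fin N → ℂ) : ℂ :=
  ∏ i, ∏ j, if i < j ∧ θ₀ i = θ₀ j then pairRatio x t i j else 1

/-- The analytic function `H` is what remains of the form factor near the diagonal point `θ₀` after
its Cauchy determinants have been split off. -/
structure IsRegularPart (F : (n : ℕ) → (Fin n → ℂ) → ℂ) {N : ℕ} (θ₀ : Fin N → ℂ)
    (H : (Fin N → ℂ) × (Fin N → ℂ) → ℂ) : Prop where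
  analytic : AnalyticAt ℂ H (θ₀, θ₀)
  eq : ∀ᶠ p in 𝓝 (θ₀, θ₀), (∀ i j, p.1 i ≠ p.2 j) →
    diagFF F p.1 p.2 * ∏ i, (p.1 i - p.2 i) = H p * pairProd θ₀ p.1 p.2

section

variable {N : ℕ}

theorem analyticAt_fst_apply (i : Fin N) (p₀ : (Fin N → ℂ) × (Fin N → ℂ)) :
    AnalyticAt ℂ (fun p : (Fin N → ℂ) × (Fin N → ℂ) => p.1 i) p₀ :=
  ((ContinuousLinearMap.proj (R := ℂ) (φ := fun _ : Fin N => ℂ) i).comp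
    (ContinuousLinearMap.fst ℂ _ _)).analyticAt p₀

theorem analyticAt_snd_apply (i : Fin N) (p₀ : (Fin N → ℂ) × (Fin N → ℂ)) :
    AnalyticAt ℂ (fun p : (Fin N → ℂ) × (Fin N → ℂ) => p.2 i) p₀ :=
  ((ContinuousLinearMap.proj (R := ℂ) (φ := fun _ : Fin N => ℂ) i).comp
    (ContinuousLinearMap.snd ℂ _ _)).analyticAt p₀

/-- `sinh (w / 2) / w`, continued to `w = 0`. -/
noncomputable def sinhc : ℂ → ℂ := dslope (fun w => sinh (w / 2)) 0

theorem mul_sinhc (w : ℂ) : w * sinhc w = sinh (w / 2) := by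
  have := sub_smul_dslope (fun w : ℂ => sinh (w / 2)) 0 w
  simpa [sinhc] using this

theorem analyticAt_sinhc_zero : AnalyticAt ℂ sinhc 0 := by
  have h : AnalyticAt ℂ (fun w : ℂ => sinh (w / 2)) 0 := by
    have : Differentiable ℂ (fun w : ℂ => sinh (w / 2)) := by fun_prop
    exact this.analyticAt 0
  obtain ⟨p, hp⟩ := h
  exact hp.has_fpower_series_dslope_fslope.analyticAt

theorem sinhc_zero : sinhc 0 ≠ 0 := by
  have h : HasDerivAt (fun w : ℂ => sinh (w / 2)) (cosh (0 / 2) * (1 / 2)) 0 := by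
    exact (Complex.hasDerivAt_sinh (0 / 2)).comp (0 : ℂ) ((hasDerivAt_id' (0 : ℂ)).div_const 2)
  rw [sinhc, dslope_same, h.deriv]
  simp

/-- The analytic factor of `kin` that does not vanish near the diagonal. -/
noncomputable def kinUnit (θ₀ x t : Fin N → ℂ) : ℂ :=
  kin (fun i => x i + Real.pi * I) * kin (fun i => t (Fin.rev i)) *
    ∏ i, ∏ j, if θ₀ i = θ₀ j then I * sinhc (x i - t j) else cosh ((x i + Real.pi * I - t j) / 2)

theorem kin_diag (θ₀ x t : Fin N → ℂ) :
    kin (Fin.append (fun i => x i + Real.pi * I) (fun i => t (Fin.rev i)))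
      = kinUnit θ₀ x t * ∏ i, ∏ j, if θ₀ i = θ₀ j then x i - t j else 1 := by
  rw [kin_append, kinUnit, mul_assoc _ _ (∏ i, ∏ j, if θ₀ i = θ₀ j then x i - t j else 1)]
  congr 1
  rw [← Finset.prod_mul_distrib]
  refine Finset.prod_congr rfl fun i _ => ?_
  rw [← Finset.prod_mul_distrib]
  rw [← Equiv.prod_comp Fin.revPerm]
  refine Finset.prod_congr rfl fun j _ => ?_
  simp only [Fin.revPerm_apply, Fin.rev_rev]
  split_ifs with h
  · have e : (x i + Real.pi * I - t j) / 2 = ((x i - t j) + Real.pi * I) / 2 := by ring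
    rw [e, cosh_half_add_pi, ← mul_sinhc]; ring
  · simp

theorem analyticAt_kin_comp {M : ℕ} {E : Type*} [NormedAddCommGroup E] [NormedSpace ℂ E]
    {f : E → Fin M → ℂ} {p₀ : E} (hf : ∀ i, AnalyticAt ℂ (fun p => f p i) p₀) :
    AnalyticAt ℂ (fun p => kin (f p)) p₀ := by
  unfold kin
  refine Finset.analyticAt_fun_prod _ fun i _ => Finset.analyticAt_fun_prod _ fun j _ => ?_
  have h : AnalyticAt ℂ cosh ((f p₀ i - f p₀ j) / 2) := Complex.differentiable_cosh.analyticAt _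
  exact h.fun_comp (f := fun p => (f p i - f p j) / 2) (((hf i).sub (hf j)).div_const)

theorem analyticAt_kinUnit (θ₀ : Fin N → ℂ) :
    AnalyticAt ℂ (fun p : (Fin N → ℂ) × (Fin N → ℂ) => kinUnit θ₀ p.1 p.2) (θ₀, θ₀) := by
  unfold kinUnit
  refine ((analyticAt_kin_comp fun i => ?_).mul (analyticAt_kin_comp fun i => ?_)).mul
    (Finset.analyticAt_fun_prod _ fun i _ => Finset.analyticAt_fun_prod _ fun j _ => ?_)
  · exact (analyticAt_fst_apply i _).add analyticAt_const
  · exact analyticAt_snd_apply _ _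
  · split_ifs with h
    · have h1 : AnalyticAt ℂ sinhc (θ₀ i - θ₀ j) := by
        rw [h, sub_self]; exact analyticAt_sinhc_zero
      exact analyticAt_const.mul (h1.fun_comp
        (f := fun p : (Fin N → ℂ) × (Fin N → ℂ) => p.1 i - p.2 j)
        ((analyticAt_fst_apply i _).sub (analyticAt_snd_apply j _)))
    · have h1 : AnalyticAt ℂ cosh ((θ₀ i + Real.pi * I - θ₀ j) / 2) :=
        Complex.differentiable_cosh.analyticAt _
      exact h1.fun_comp
        (f := fun p : (Fin N → ℂ) × (Fin N → ℂ) => (p.1 i + Real.pi * I - p.2 j) / 2)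
        ((((analyticAt_fst_apply i _).add analyticAt_const).sub
          (analyticAt_snd_apply j _)).div_const)

theorem kinUnit_ne_zero {S : ℂ → ℂ} {θ₀ : Fin N → ℂ} (h : Admissible S θ₀) :
    kinUnit θ₀ θ₀ θ₀ ≠ 0 := by
  unfold kinUnit kin
  refine mul_ne_zero (mul_ne_zero ?_ ?_) ?_
  · refine Finset.prod_ne_zero_iff.2 fun i _ => Finset.prod_ne_zero_iff.2 fun j _ => ?_
    have := (generic_of_admissible h i j).2
    simpa using this
  · refine Finset.prod_ne_zero_iff.2 fun i _ => Finset.prod_ne_zero_iff.2 fun j _ => ?_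
    exact (generic_of_admissible h _ _).2
  · refine Finset.prod_ne_zero_iff.2 fun i _ => Finset.prod_ne_zero_iff.2 fun j _ => ?_
    split_ifs with hij
    · rw [hij, sub_self]; exact mul_ne_zero I_ne_zero sinhc_zero
    · have e : (θ₀ i + Real.pi * I - θ₀ j) / 2 = ((θ₀ i - θ₀ j) + Real.pi * I) / 2 := by ring
      rw [e, cosh_half_add_pi]
      exact mul_ne_zero I_ne_zero (sinh_half_ne_zero ((h i j).2 hij))

/-- The linear forms `x_i - x_j` and `t_j - t_i`. -/
noncomputable def diffForm (a : Bool × Fin N × Fin N) : (Fin N → ℂ) × (Fin N → ℂ) →L[ℂ] ℂ :=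
  if a.1 then
    ((ContinuousLinearMap.proj a.2.2 : (Fin N → ℂ) →L[ℂ] ℂ) - ContinuousLinearMap.proj a.2.1).comp
      (ContinuousLinearMap.snd ℂ _ _)
  else
    ((ContinuousLinearMap.proj a.2.1 : (Fin N → ℂ) →L[ℂ] ℂ) - ContinuousLinearMap.proj a.2.2).comp
      (ContinuousLinearMap.fst ℂ _ _)

/-- The linear forms `x_i - t_j`. -/
noncomputable def crossForm (a : Fin N × Fin N) : (Fin N → ℂ) × (Fin N → ℂ) →L[ℂ] ℂ :=
  (ContinuousLinearMap.proj a.1 : (Fin N → ℂ) →L[ℂ] ℂ).comp (ContinuousLinearMap.fst ℂ _ _)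
    - (ContinuousLinearMap.proj a.2 : (Fin N → ℂ) →L[ℂ] ℂ).comp (ContinuousLinearMap.snd ℂ _ _)

theorem diffForm_false (i j : Fin N) (p : (Fin N → ℂ) × (Fin N → ℂ)) :
    diffForm (false, i, j) p = p.1 i - p.1 j := by simp [diffForm]

theorem diffForm_true (i j : Fin N) (p : (Fin N → ℂ) × (Fin N → ℂ)) :
    diffForm (true, i, j) p = p.2 j - p.2 i := by simp [diffForm]

theorem crossForm_apply (i j : Fin N) (p : (Fin N → ℂ) × (Fin N → ℂ)) :
    crossForm (i, j) p = p.1 i - p.2 j := by simp [crossForm]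

/-- A generic point of the kernel of `diffForm`. -/
noncomputable def diffPoint (a : Bool × Fin N × Fin N) : (Fin N → ℂ) × (Fin N → ℂ) :=
  (fun k => if a.1 = false ∧ k = a.2.2 then ((a.2.1 : ℕ) : ℂ) else ((k : ℕ) : ℂ),
    fun k => if a.1 = true ∧ k = a.2.2 then ((N + a.2.1 : ℕ) : ℂ) else ((N + k : ℕ) : ℂ))

theorem diffForm_diffPoint {a b : Bool × Fin N × Fin N} (ha : a.2.1 < a.2.2) (hb : b.2.1 < b.2.2) :
    diffForm b (diffPoint a) = 0 ↔ a = b := by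
  obtain ⟨s, i, j⟩ := a
  obtain ⟨s', i', j'⟩ := b
  simp only at ha hb
  rw [Fin.lt_def] at ha hb
  cases s <;> cases s' <;>
    simp only [diffForm_false, diffForm_true, diffPoint, Prod.mk.injEq, sub_eq_zero, true_and,
      false_and, if_false, Bool.false_eq_true, reduceCtorEq, iff_false, Fin.ext_iff] <;>
    (try split_ifs) <;> norm_cast <;> omega

theorem crossForm_diffPoint (a : Bool × Fin N × Fin N) (b : Fin N × Fin N) :
    crossForm b (diffPoint a) ≠ 0 := by
  obtain ⟨s, i, j⟩ := a
  obtain ⟨i', j'⟩ := b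
  rw [crossForm_apply, sub_ne_zero, diffPoint]
  simp only
  split_ifs <;> norm_cast <;> omega

theorem crossProd_ne_zero (θ₀ : Fin N → ℂ) {x t : Fin N → ℂ} (hne : ∀ i j, x i ≠ t j) :
    (∏ i, ∏ j, if i < j then (if θ₀ i = θ₀ j then x i - t j else 1) *
      (if θ₀ j = θ₀ i then x j - t i else 1) else 1) ≠ 0 := by
  refine Finset.prod_ne_zero_iff.2 fun i _ => Finset.prod_ne_zero_iff.2 fun j _ => ?_
  have h4 := sub_ne_zero.2 (hne i j)
  have h5 := sub_ne_zero.2 (hne j i)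
  split_ifs <;> simp [h4, h5]

theorem pairProd_mul_crossProd (θ₀ : Fin N → ℂ) {x t : Fin N → ℂ} (hne : ∀ i j, x i ≠ t j) :
    pairProd θ₀ x t * (∏ i, ∏ j, if i < j then (if θ₀ i = θ₀ j then x i - t j else 1) *
      (if θ₀ j = θ₀ i then x j - t i else 1) else 1)
    = (∏ i, ∏ j, if i < j ∧ θ₀ i = θ₀ j then t j - t i else 1) *
      ∏ i, ∏ j, if i < j ∧ θ₀ i = θ₀ j then x i - x j else 1 := by
  simp only [pairProd, ← Finset.prod_mul_distrib]
  refine Finset.prod_congr rfl fun i _ => Finset.prod_congr rfl fun j _ => ?_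
  have h4 := sub_ne_zero.2 (hne i j)
  have h5 := sub_ne_zero.2 (hne j i)
  by_cases hij : i < j
  · by_cases he : θ₀ i = θ₀ j
    · have hc : i < j ∧ θ₀ i = θ₀ j := And.intro hij he
      simp only [if_pos hc, if_pos hij, if_pos he, if_pos he.symm]
      rw [pairRatio, div_mul_cancel₀ _ (mul_ne_zero h4 h5), mul_comm]
    · simp [he, Ne.symm he]
  · simp [hij]

theorem exists_isRegularPart {S : ℂ → ℂ} (hS : IsScatteringMatrix S)
    {F : (n : ℕ) → (Fin n → ℂ) → ℂ} (hF : IsFormFactor S F) {θ₀ : Fin N → ℂ}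
    (hθ : Admissible S θ₀) : ∃ H, IsRegularPart F θ₀ H := by
  set X : (Fin N → ℂ) × (Fin N → ℂ) → Fin (N + N) → ℂ := fun p =>
    Fin.append (fun i => p.1 i + Real.pi * I) (fun i => p.2 (Fin.rev i)) with hX
  have hXan : AnalyticAt ℂ X (θ₀, θ₀) := by
    rw [analyticAt_pi_iff]
    intro k
    refine Fin.addCases (fun i => ?_) (fun i => ?_) k
    · simp only [Fin.append_left]
      exact (analyticAt_fst_apply i _).add analyticAt_const
    · simp only [Fin.append_right]
      exact analyticAt_snd_apply _ _
  have hreg : Regular S (X (θ₀, θ₀)) := by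
    have hb : ∀ i j, S (θ₀ i + Real.pi * I - θ₀ j) ≠ 0 := fun i j => by
      have e : θ₀ i + Real.pi * I - θ₀ j = (θ₀ i - θ₀ j) + Real.pi * I := by ring
      rw [e, hS.add_pi]; exact inv_ne_zero (hθ i j).1
    intro k l _
    refine Fin.addCases (fun i => ?_) (fun i => ?_) k <;>
    refine Fin.addCases (fun j => ?_) (fun j => ?_) l <;>
    simp only [hX, Fin.append_left, Fin.append_right]
    · simpa using (hθ i j).1
    · exact hb _ _
    · exact hS.sub_ne_zero_symm (hb _ _)
    · exact (hθ _ _).1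
  obtain ⟨G, hG, hGF⟩ := hF.analytic _ _ hreg
  set U : (Fin N → ℂ) × (Fin N → ℂ) → ℂ := fun p => kinUnit θ₀ p.1 p.2 with hU
  have hUan : AnalyticAt ℂ U (θ₀, θ₀) := analyticAt_kinUnit θ₀
  have hU0 : U (θ₀, θ₀) ≠ 0 := kinUnit_ne_zero hθ
  set Ψ : (Fin N → ℂ) × (Fin N → ℂ) → ℂ := fun p => G (X p) / U p with hΨ
  have hΨan : AnalyticAt ℂ Ψ (θ₀, θ₀) := (hG.fun_comp hXan).div hUan hU0
  have hΦ : ∀ᶠ p in 𝓝 (θ₀, θ₀), (∀ i j, p.1 i ≠ p.2 j) →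
      diagFF F p.1 p.2 * (∏ i, ∏ j, if θ₀ i = θ₀ j then p.1 i - p.2 j else 1) = Ψ p := by
    filter_upwards [hXan.continuousAt.tendsto.eventually hGF,
      hUan.continuousAt.eventually_ne hU0] with p hp hUp hne
    have hPr : (∏ i, ∏ j, if θ₀ i = θ₀ j then p.1 i - p.2 j else 1) ≠ 0 := by
      refine Finset.prod_ne_zero_iff.2 fun i _ => Finset.prod_ne_zero_iff.2 fun j _ => ?_
      split_ifs
      · exact sub_ne_zero.2 (hne i j)
      · exact one_ne_zero
    have hk : kin (X p) = U p * _ := kin_diag θ₀ p.1 p.2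
    have h1 := hp (by rw [hk]; exact mul_ne_zero hUp hPr)
    rw [diagFF, h1, hk, hΨ]
    field_simp
  set s : Finset (Bool × Fin N × Fin N) :=
    Finset.univ.filter fun a => a.2.1 < a.2.2 ∧ θ₀ a.2.1 = θ₀ a.2.2 with hs
  have hmem : ∀ a ∈ s, a.2.1 < a.2.2 ∧ θ₀ a.2.1 = θ₀ a.2.2 := fun a ha => by
    simpa [hs] using ha
  have hz : ∀ a ∈ s, ∀ᶠ p in 𝓝 (θ₀, θ₀), diffForm a p = 0 → Ψ p = 0 := by
    intro a ha
    refine eventually_eq_zero_of_generic Finset.univ crossForm (diffForm a) (diffPoint a)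
      ((diffForm_diffPoint (hmem a ha).1 (hmem a ha).1).2 rfl)
      (fun b _ => crossForm_diffPoint a b)
      (hΨan.eventually_analyticAt.mono fun x hx => hx.continuousAt) ?_
    filter_upwards [hΦ, eventually_admissible_pair hS hθ] with p h1 h2 h3 h4
    have hne : ∀ i j, p.1 i ≠ p.2 j := fun i j => by
      have := h4 (i, j) (Finset.mem_univ _)
      rwa [crossForm_apply, sub_ne_zero] at this
    rw [← h1 hne]
    obtain ⟨b, i, j⟩ := a
    have hij : i ≠ j := (hmem _ ha).1.ne
    have : diagFF F p.1 p.2 = 0 := by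
      refine diagFF_eq_zero hS hF h2 hne hij ?_
      cases b
      · rw [diffForm_false, sub_eq_zero] at h3; exact Or.inl h3
      · rw [diffForm_true, sub_eq_zero] at h3; exact Or.inr h3.symm
    rw [this, zero_mul]
  have hne : ∀ a ∈ s, ∀ b ∈ s, a ≠ b → diffForm b (diffPoint a) ≠ 0 := fun a ha b hb hab h =>
    hab ((diffForm_diffPoint (hmem a ha).1 (hmem b hb).1).1 h)
  obtain ⟨H, hH, hΨH⟩ := exists_analyticAt_eq_prod_mul s diffForm diffPoint
    (fun a ha => (diffForm_diffPoint (hmem a ha).1 (hmem a ha).1).2 rfl) hne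
    (fun a ha h0 => by
      have h1 := diffForm_diffPoint (a := (!a.1, a.2)) (b := a) (hmem a ha).1 (hmem a ha).1
      rw [h0] at h1
      have h2 := congrArg Prod.fst (h1.1 rfl)
      simp at h2)
    (fun a ha => by
      obtain ⟨b, i, j⟩ := a
      have := (hmem _ ha).2
      simp only at this
      cases b
      · rw [diffForm_false]; simp [this]
      · rw [diffForm_true]; simp [this]) hΨan hz
  refine ⟨H, hH, ?_⟩
  filter_upwards [hΦ, hΨH] with p h1 h2 hne
  have h3 := h1 hne
  rw [h2, hs, Finset.prod_filter, Fintype.prod_prod_type] at h3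
  simp only [Fintype.prod_bool, Fintype.prod_prod_type, diffForm_true, diffForm_false] at h3
  rw [prod_prod_eq_diag_mul] at h3
  simp only [if_true] at h3
  apply mul_right_cancel₀ (crossProd_ne_zero θ₀ hne)
  linear_combination h3 - H p * pairProd_mul_crossProd θ₀ hne

end

/-! ### The kinematical residue of the regular part -/

theorem exists_ofFn_insertNth {N : ℕ} (p : Fin (N + 1)) (f : Fin N → ℂ) :
    ∃ u v : List ℂ, List.ofFn f = u ++ v ∧
      (∀ a : ℂ, List.ofFn (p.insertNth (α := fun _ => ℂ) a f) = u ++ a :: v) ∧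
      (∀ g : ℂ → ℂ, (u.map g).prod = ∏ k, if k.castSucc < p then g (f k) else 1) ∧
      ∀ g : ℂ → ℂ, (v.map g).prod = ∏ k, if k.castSucc < p then 1 else g (f k) := by
  induction N with
  | zero =>
    have : p = 0 := Fin.ext (by omega)
    subst this
    exact ⟨[], [], by simp, by intro a; simp, by simp, by simp⟩
  | succ N ih =>
    refine Fin.cases ?_ (fun p => ?_) p
    · refine ⟨[], List.ofFn f, rfl, fun a => ?_, fun g => by simp, fun g => ?_⟩
      · rw [Fin.insertNth_zero', List.ofFn_cons]; rfl
      · simp only [Fin.not_lt_zero, if_false, List.map_ofFn, List.prod_ofFn, Function.comp]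
    · obtain ⟨u, v, h1, h2, h3, h4⟩ := ih p (fun k => f k.succ)
      refine ⟨f 0 :: u, v, ?_, fun a => ?_, fun g => ?_, fun g => ?_⟩
      · rw [List.ofFn_succ, h1]; rfl
      · have e : (fun i : Fin (N + 1) => p.succ.insertNth (α := fun _ => ℂ) a f i.succ)
            = p.insertNth (α := fun _ => ℂ) a (fun k => f k.succ) := by
          ext i
          refine Fin.succAboveCases p ?_ (fun j => ?_) i
          · simp
          · rw [Fin.insertNth_apply_succAbove, ← Fin.succ_succAbove_succ,
              Fin.insertNth_apply_succAbove]
        have e0 : p.succ.insertNth (α := fun _ => ℂ) a f 0 = f 0 := by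
          have := Fin.insertNth_apply_succAbove (α := fun _ => ℂ) p.succ a f 0
          rwa [Fin.succ_succAbove_zero] at this
        rw [List.ofFn_succ, e, h2, e0]; rfl
      · rw [List.map_cons, List.prod_cons, h3, Fin.prod_univ_succ]
        simp [Fin.castSucc_succ]
      · rw [h4, Fin.prod_univ_succ]
        simp [Fin.castSucc_succ]

/-- The scattering phase of the pair `p` with the other pairs. -/
noncomputable def phaseProd (S : ℂ → ℂ) {N : ℕ} (p : Fin (N + 1)) (x t : Fin (N + 1) → ℂ) : ℂ :=
  ∏ k : Fin N, S (t p - t (p.succAbove k)) / S (t p - x (p.succAbove k))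

/-- The ratio of the regular part at `x_p = t_p` to the regular part without the pair `p`. -/
noncomputable def residueFactor (S : ℂ → ℂ) {N : ℕ} (p : Fin (N + 1))
    (x t : Fin (N + 1) → ℂ) : ℂ :=
  (∏ k : Fin N, (if k.castSucc < p then S (x (p.succAbove k) - t p)
    else S (t (p.succAbove k) - t p)) / S (x (p.succAbove k) - t p)) *
    (I * (1 - phaseProd S p x t))

section

variable {S : ℂ → ℂ} (hS : IsScatteringMatrix S) {N : ℕ}
include hS

theorem analyticAt_comp_S {E : Type*} [NormedAddCommGroup E] [NormedSpace ℂ E] {f : E → ℂ} {e : E}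
    (hf : AnalyticAt ℂ f e) (h : S (f e) ≠ 0) : AnalyticAt ℂ (fun y => S (f y)) e :=
  (hS.analyticAt h).fun_comp hf

theorem analyticAt_residueFactor {θ₀ : Fin (N + 1) → ℂ} (hθ : Admissible S θ₀) (p : Fin (N + 1)) :
    AnalyticAt ℂ (fun q : (Fin (N + 1) → ℂ) × (Fin (N + 1) → ℂ) => residueFactor S p q.1 q.2)
      (θ₀, θ₀) := by
  have h1 : ∀ i j, AnalyticAt ℂ (fun q : (Fin (N + 1) → ℂ) × (Fin (N + 1) → ℂ) =>
      S (q.1 i - q.2 j)) (θ₀, θ₀) := fun i j =>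
    analyticAt_comp_S hS (f := fun q : (Fin (N + 1) → ℂ) × (Fin (N + 1) → ℂ) => q.1 i - q.2 j)
      ((analyticAt_fst_apply i _).sub (analyticAt_snd_apply j _)) (hθ i j).1
  have h2 : ∀ i j, AnalyticAt ℂ (fun q : (Fin (N + 1) → ℂ) × (Fin (N + 1) → ℂ) =>
      S (q.2 i - q.2 j)) (θ₀, θ₀) := fun i j =>
    analyticAt_comp_S hS (f := fun q : (Fin (N + 1) → ℂ) × (Fin (N + 1) → ℂ) => q.2 i - q.2 j)
      ((analyticAt_snd_apply i _).sub (analyticAt_snd_apply j _)) (hθ i j).1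
  have h3 : ∀ i j, AnalyticAt ℂ (fun q : (Fin (N + 1) → ℂ) × (Fin (N + 1) → ℂ) =>
      S (q.2 i - q.1 j)) (θ₀, θ₀) := fun i j =>
    analyticAt_comp_S hS (f := fun q : (Fin (N + 1) → ℂ) × (Fin (N + 1) → ℂ) => q.2 i - q.1 j)
      ((analyticAt_snd_apply i _).sub (analyticAt_fst_apply j _)) (hθ i j).1
  unfold residueFactor phaseProd
  refine (Finset.analyticAt_fun_prod _ fun k _ => ?_).mul (analyticAt_const.mul
    (analyticAt_const.sub (Finset.analyticAt_fun_prod _ fun k _ =>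
      (h2 _ _).div (h3 _ _) (hθ _ _).1)))
  refine AnalyticAt.div ?_ (h1 _ _) (hθ _ _).1
  split_ifs
  · exact h1 _ _
  · exact h2 _ _

omit hS in
theorem pairProd_succAbove {θ₀ x t : Fin (N + 1) → ℂ} {p : Fin (N + 1)} (hp : x p = t p)
    (hne : ∀ k, x (p.succAbove k) ≠ t p ∧ t (p.succAbove k) ≠ t p) :
    pairProd θ₀ x t = pairProd (fun k => θ₀ (p.succAbove k)) (fun k => x (p.succAbove k))
      (fun k => t (p.succAbove k)) := by
  unfold pairProd
  have h1 : ∀ k, pairRatio x t p (p.succAbove k) = 1 := fun k => by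
    have a := sub_ne_zero.2 (hne k).1
    have b := sub_ne_zero.2 (hne k).2.symm
    rw [pairRatio, hp, div_eq_one_iff_eq (mul_ne_zero b a)]; ring
  have h2 : ∀ k, pairRatio x t (p.succAbove k) p = 1 := fun k => by
    have a := sub_ne_zero.2 (hne k).1
    have b := sub_ne_zero.2 (hne k).2.symm
    rw [pairRatio, hp, div_eq_one_iff_eq (mul_ne_zero a b)]
  rw [Fin.prod_univ_succAbove _ p, Fin.prod_univ_succAbove _ p]
  simp only [lt_irrefl, false_and, if_false, h1, ite_self, Finset.prod_const_one, one_mul]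
  refine Finset.prod_congr rfl fun i _ => ?_
  rw [Fin.prod_univ_succAbove _ p]
  simp only [h2, ite_self, one_mul, Fin.succAbove_lt_succAbove_iff]
  rfl

omit hS in
theorem pairProd_ne_zero {θ₀ x t : Fin N → ℂ} (hne : ∀ i j, i ≠ j → x i ≠ t j)
    (hx : Function.Injective x) (ht : Function.Injective t) : pairProd θ₀ x t ≠ 0 := by
  refine Finset.prod_ne_zero_iff.2 fun i _ => Finset.prod_ne_zero_iff.2 fun j _ => ?_
  split_ifs with h
  · have hij : i ≠ j := h.1.ne
    exact div_ne_zero (mul_ne_zero (sub_ne_zero.2 (hx.ne hij)) (sub_ne_zero.2 (ht.ne hij.symm)))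
      (mul_ne_zero (sub_ne_zero.2 (hne i j hij)) (sub_ne_zero.2 (hne j i hij.symm)))
  · exact one_ne_zero

omit hS in
theorem continuousAt_pairProd {θ₀ : Fin N → ℂ} {q : (Fin N → ℂ) × (Fin N → ℂ)}
    (hne : ∀ i j, i ≠ j → q.1 i ≠ q.2 j) :
    ContinuousAt (fun q : (Fin N → ℂ) × (Fin N → ℂ) => pairProd θ₀ q.1 q.2) q := by
  unfold pairProd
  refine tendsto_finsetProd _ fun i _ => tendsto_finsetProd _ fun j _ => ?_
  split_ifs with h
  · have hij : i ≠ j := h.1.ne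
    unfold pairRatio
    refine ContinuousAt.tendsto (ContinuousAt.div (by fun_prop) (by fun_prop) ?_)
    exact mul_ne_zero (sub_ne_zero.2 (hne i j hij)) (sub_ne_zero.2 (hne j i hij.symm))
  · exact tendsto_const_nhds

variable {F : (n : ℕ) → (Fin n → ℂ) → ℂ} (hF : IsFormFactor S F)
include hF

/-- The form factor with the pair `p` moved to the front. -/
theorem diagFF_insertNth {p : Fin (N + 1)} {x' : Fin N → ℂ} {t : Fin (N + 1) → ℂ} {w : ℂ}
    (hadm : Admissible S (Sum.elim (p.insertNth (α := fun _ => ℂ) w x') t :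
      Fin (N + 1) ⊕ Fin (N + 1) → ℂ))
    (hne : ∀ i j, p.insertNth (α := fun _ => ℂ) w x' i ≠ t j) :
    diagFF F (p.insertNth (α := fun _ => ℂ) w x') t =
      (∏ k : Fin N, (if k.castSucc < p then S (x' k - w)
        else S (t (p.succAbove k) - t p)) / S (x' k - t p)) *
      listFF F ((w + Real.pi * I) :: t p :: (List.ofFn (fun i => x' i + Real.pi * I) ++
        (List.ofFn fun k => t (p.succAbove k)).reverse)) := by
  have hpw := pairwise_generic_diag hS hadm hne
  rw [diagFF_eq_listFF]
  obtain ⟨u, v, h1, h2, h3, h4⟩ := exists_ofFn_insertNth p (fun k => x' k + Real.pi * I)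
  obtain ⟨u', v', h1', h2', h3', h4'⟩ := exists_ofFn_insertNth p (fun k => t (p.succAbove k))
  have e1 : (fun i => p.insertNth (α := fun _ => ℂ) w x' i + Real.pi * I)
      = p.insertNth (α := fun _ => ℂ) (w + Real.pi * I) (fun k => x' k + Real.pi * I) := by
    ext i
    refine Fin.succAboveCases p ?_ (fun j => ?_) i <;> simp
  have e2 : t = p.insertNth (α := fun _ => ℂ) (t p) (fun k => t (p.succAbove k)) := by
    ext i
    refine Fin.succAboveCases p ?_ (fun j => ?_) i <;> simp
  have e3 : List.ofFn (fun i => p.insertNth (α := fun _ => ℂ) w x' i + Real.pi * I) ++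
      (List.ofFn t).reverse
      = u ++ (w + Real.pi * I) :: (v ++ (v'.reverse ++ t p :: u'.reverse)) := by
    rw [e1, h2, e2, h2']; simp
  have hz0 : S (w + Real.pi * I - t p) ≠ 0 := by
    have := (generic_add_pi_of_admissible hS hadm (a := .inl p) (b := .inr p) (hne p p)).1
    simpa using this
  rw [e3] at hpw ⊢
  have hpw2 := pairwise_generic_perm hS hpw List.perm_middle
  have e4 : (w + Real.pi * I) :: (u ++ (v ++ (v'.reverse ++ t p :: u'.reverse)))
      = ((w + Real.pi * I) :: (u ++ v ++ v'.reverse)) ++ t p :: u'.reverse := by simp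
  rw [listFF_move hS hF _ _ _ hpw, e4]
  rw [e4] at hpw2
  have hpw3 := pairwise_generic_perm hS hpw2 List.perm_middle
  rw [listFF_move hS hF _ _ _ hpw2, List.cons_append]
  rw [List.cons_append] at hpw3
  have h5 := listFF_exchange hS hF (u := []) hpw3
  simp only [List.nil_append] at h5
  rw [h5, h1, h1', List.reverse_append]
  have e5 : u ++ v ++ v'.reverse ++ u'.reverse = u ++ v ++ (v'.reverse ++ u'.reverse) := by simp
  rw [e5]
  simp only [List.map_cons, List.prod_cons, List.map_append, List.prod_append, List.map_reverse,
    List.prod_reverse]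
  rw [h3, h3, h4, h4', ← neg_sub (w + Real.pi * I) (t p), hS.unitarity]
  have e6 : ∀ a b : ℂ, a + Real.pi * I - (b + Real.pi * I) = a - b := fun a b => by ring
  have e7 : ∀ a b : ℂ, S (a + Real.pi * I - b) = (S (a - b))⁻¹ := fun a b => by
    rw [← hS.add_pi]; congr 1; ring
  have e8 : (∏ k : Fin N, (if k.castSucc < p then S (x' k - w)
        else S (t (p.succAbove k) - t p)) / S (x' k - t p))
      = (∏ k : Fin N, if k.castSucc < p then S (x' k - w) else 1) *
        ((∏ k : Fin N, if k.castSucc < p then (S (x' k - t p))⁻¹ else 1) *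
        (∏ k : Fin N, if k.castSucc < p then 1 else (S (x' k - t p))⁻¹) *
        (∏ k : Fin N, if k.castSucc < p then 1 else S (t (p.succAbove k) - t p))) := by
    simp only [← Finset.prod_mul_distrib]
    refine Finset.prod_congr rfl fun k _ => ?_
    split_ifs <;> ring
  simp only [e6, e7 (x' _)]
  rw [e8]
  field_simp

theorem regularPart_residue {θ₀ : Fin (N + 1) → ℂ} (hθ : Admissible S θ₀) (p : Fin (N + 1))
    {H : (Fin (N + 1) → ℂ) × (Fin (N + 1) → ℂ) → ℂ} (hH : IsRegularPart F θ₀ H)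
    {H' : (Fin N → ℂ) × (Fin N → ℂ) → ℂ}
    (hH' : IsRegularPart F (fun k => θ₀ (p.succAbove k)) H') :
    ∀ᶠ q in 𝓝 (θ₀, θ₀), q.1 p = q.2 p → H q = residueFactor S p q.1 q.2 *
      H' (fun k => q.1 (p.succAbove k), fun k => q.2 (p.succAbove k)) := by
  set R : (Fin (N + 1) → ℂ) × (Fin (N + 1) → ℂ) → (Fin N → ℂ) × (Fin N → ℂ) := fun q =>
    (fun k => q.1 (p.succAbove k), fun k => q.2 (p.succAbove k)) with hR
  have hRan : AnalyticAt ℂ R (θ₀, θ₀) := by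
    refine AnalyticAt.prod ?_ ?_
    · exact analyticAt_pi_iff.2 fun k => analyticAt_fst_apply _ _
    · exact analyticAt_pi_iff.2 fun k => analyticAt_snd_apply _ _
  have hfan : AnalyticAt ℂ (fun q => H q - residueFactor S p q.1 q.2 * H' (R q)) (θ₀, θ₀) :=
    hH.analytic.sub ((analyticAt_residueFactor hS hθ p).mul
      (AnalyticAt.fun_comp (g := H') (f := R) hH'.analytic hRan))
  have hmain : ∀ᶠ q in 𝓝 (θ₀, θ₀), crossForm (p, p) q = 0 →
      H q - residueFactor S p q.1 q.2 * H' (R q) = 0 := by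
    refine eventually_eq_zero_of_generic
      (Finset.univ.filter fun a : (Fin (N + 1) × Fin (N + 1)) ⊕ (Bool × Fin (N + 1) × Fin (N + 1)) =>
        a ≠ .inl (p, p) ∧ ∀ b, a = .inr b → b.2.1 ≠ b.2.2)
      (Sum.elim crossForm diffForm) (crossForm (p, p))
      (fun k => ((k : ℕ) : ℂ), fun k => if k = p then ((p : ℕ) : ℂ) else ((N + 1 + k : ℕ) : ℂ))
      (by simp [crossForm_apply]) ?_
      (hfan.eventually_analyticAt.mono fun x hx => hx.continuousAt) ?_
    · rintro (⟨i, j⟩ | ⟨b, i, j⟩) ha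
      · simp only [Finset.mem_filter, Finset.mem_univ, true_and, ne_eq, Sum.inl.injEq,
          Prod.mk.injEq, reduceCtorEq, false_implies, implies_true, and_true, Fin.ext_iff] at ha
        simp only [Sum.elim_inl, crossForm_apply, Fin.ext_iff]
        rw [sub_ne_zero]
        split_ifs with h
        · norm_cast; omega
        · norm_cast; omega
      · have hij : (i : ℕ) ≠ j := by
          simp only [Finset.mem_filter, Finset.mem_univ, true_and] at ha
          exact fun h => ha.2 _ rfl (Fin.ext h)
        cases b
        · simp only [Sum.elim_inr, diffForm_false]
          rw [sub_ne_zero]; norm_cast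
        · simp only [Sum.elim_inr, diffForm_true, Fin.ext_iff]
          rw [sub_ne_zero]
          split_ifs <;> norm_cast <;> omega
    · filter_upwards [eventually_eventually_nhds.2 hH.eq, hRan.continuousAt.eventually hH'.eq,
        eventually_eventually_nhds.2 (eventually_admissible_pair hS hθ),
        hH.analytic.eventually_analyticAt] with q hq hq' hadm hHq hqp hgen
      obtain ⟨x, t⟩ := q
      rw [crossForm_apply, sub_eq_zero] at hqp
      simp only at hqp hq'
      have hcross : ∀ i j, (i ≠ p ∨ j ≠ p) → x i ≠ t j := by
        intro i j hij
        have := hgen (.inl (i, j)) (by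
          simp only [Finset.mem_filter, Finset.mem_univ, true_and, ne_eq, Sum.inl.injEq,
            Prod.mk.injEq, reduceCtorEq, false_implies, implies_true, and_true]
          tauto)
        simpa [crossForm_apply, sub_eq_zero] using this
      have hxinj : Function.Injective x := by
        intro i j hij
        by_contra hne
        have := hgen (.inr (false, i, j)) (by simpa using hne)
        simp [diffForm_false, hij] at this
      have htinj : Function.Injective t := by
        intro i j hij
        by_contra hne
        have := hgen (.inr (true, i, j)) (by simpa using hne)
        simp [diffForm_true, hij] at this
      have hsne : ∀ k, p.succAbove k ≠ p := fun k => Fin.succAbove_ne p k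
      set x' : Fin N → ℂ := fun k => x (p.succAbove k) with hx'
      set t' : Fin N → ℂ := fun k => t (p.succAbove k) with ht'
      have hadm0 := hadm.self_of_nhds
      -- the approach to the pole
      set c : ℂ → (Fin (N + 1) → ℂ) × (Fin (N + 1) → ℂ) := fun w =>
        (p.insertNth (α := fun _ => ℂ) w x', t) with hc
      have hcz : c (t p) = (x, t) := by
        simp only [hc, Prod.mk.injEq, and_true]
        ext i
        refine Fin.succAboveCases p ?_ (fun j => ?_) i <;> simp [hqp, hx']
      have hccont : Continuous c := by
        refine Continuous.prodMk ?_ continuous_const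
        refine continuous_pi fun i => ?_
        refine Fin.succAboveCases p ?_ (fun j => ?_) i
        · simp only [Fin.insertNth_apply_same]
          exact continuous_id
        · simpa using continuous_const
      have hct : Tendsto c (𝓝[≠] (t p)) (𝓝 (x, t)) := by
        have := hccont.tendsto (t p)
        rw [hcz] at this
        exact this.mono_left nhdsWithin_le_nhds
      have hwne : ∀ᶠ w in 𝓝[≠] (t p), ∀ i j, (c w).1 i ≠ (c w).2 j := by
        rw [Filter.eventually_all]
        intro i
        rw [Filter.eventually_all]
        intro j
        refine Fin.succAboveCases p ?_ (fun k => ?_) i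
        · by_cases hj : j = p
          · subst hj
            filter_upwards [self_mem_nhdsWithin] with w hw
            simpa [hc] using hw
          · have h1 : t p ≠ t j := fun h => hj (htinj h).symm
            have h2 : Tendsto (fun w : ℂ => w) (𝓝[≠] (t p)) (𝓝 (t p)) :=
              tendsto_id.mono_left nhdsWithin_le_nhds
            filter_upwards [h2.eventually_ne h1] with w hw
            simpa [hc] using hw
        · refine Filter.Eventually.of_forall fun w => ?_
          simpa [hc] using hcross (p.succAbove k) j (Or.inl (hsne k))
      -- the rest of the arguments
      set rest := List.ofFn (fun i => x' i + Real.pi * I) ++ (List.ofFn t').reverse with hrest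
      have hadm' : Admissible S (Sum.elim x' t' : Fin N ⊕ Fin N → ℂ) := by
        rintro (a | a) (b | b)
        · exact hadm0 (.inl _) (.inl _)
        · exact hadm0 (.inl _) (.inr _)
        · exact hadm0 (.inr _) (.inl _)
        · exact hadm0 (.inr _) (.inr _)
      have hne' : ∀ i j, x' i ≠ t' j := fun i j => hcross _ _ (Or.inl (hsne i))
      have hkin := listFF_kinematical hF (pairwise_generic_diag hS hadm' hne') hS (z := t p) (by
        intro y hy
        rw [List.mem_append, List.mem_ofFn, List.mem_reverse, List.mem_ofFn] at hy
        rcases hy with ⟨k, rfl⟩ | ⟨k, rfl⟩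
        · have h1 := hadm0 (.inr p) (.inl (p.succAbove k))
          simp only [Sum.elim_inl, Sum.elim_inr] at h1
          have e : t p - (x' k + Real.pi * I) = t p - x' k - Real.pi * I := by ring
          rw [e, hS.sub_pi]
          refine ⟨inv_ne_zero h1.1, ?_⟩
          rw [sinh_sub, cosh_mul_I, sinh_mul_I, Complex.cos_pi, Complex.sin_pi]
          simpa using h1.2 (hcross _ _ (Or.inl (hsne k))).symm
        · have h1 := hadm0 (.inr p) (.inr (p.succAbove k))
          simp only [Sum.elim_inr] at h1
          exact ⟨h1.1, h1.2 (htinj.ne (hsne k).symm)⟩)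
      have hP : (rest.map fun y => S (t p - y)).prod = phaseProd S p x t := by
        rw [hrest, List.map_append, List.prod_append, List.map_reverse, List.prod_reverse,
          List.map_ofFn, List.map_ofFn, List.prod_ofFn, List.prod_ofFn, phaseProd,
          ← Finset.prod_mul_distrib]
        refine Finset.prod_congr rfl fun k _ => ?_
        simp only [Function.comp, hx', ht']
        rw [show t p - (x (p.succAbove k) + Real.pi * I) = t p - x (p.succAbove k) - Real.pi * I
          by ring, hS.sub_pi]
        ring
      rw [hP] at hkin
      have hE : Tendsto (fun w => ∏ k : Fin N, (if k.castSucc < p then S (x' k - w)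
          else S (t (p.succAbove k) - t p)) / S (x' k - t p)) (𝓝[≠] (t p))
          (𝓝 (∏ k : Fin N, (if k.castSucc < p then S (x' k - t p)
          else S (t (p.succAbove k) - t p)) / S (x' k - t p))) := by
        refine tendsto_finsetProd _ fun k _ => Tendsto.div_const ?_ _
        split_ifs
        · have h1 := (hadm0 (.inl (p.succAbove k)) (.inr p)).1
          simp only [Sum.elim_inl, Sum.elim_inr] at h1
          have h2 := (hS.analyticAt h1).continuousAt.tendsto
          have h3 : Tendsto (fun w => x' k - w) (𝓝[≠] (t p)) (𝓝 (x' k - t p)) := by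
            have : Continuous fun w => x' k - w := by fun_prop
            exact (this.tendsto _).mono_left nhdsWithin_le_nhds
          exact h2.comp h3
        · exact tendsto_const_nhds
      have hlhs : Tendsto (fun w => diagFF F (c w).1 (c w).2 * ∏ i, ((c w).1 i - (c w).2 i))
          (𝓝[≠] (t p)) (𝓝 (residueFactor S p x t * (listFF F rest * ∏ k, (x' k - t' k)))) := by
        have h1 := (hE.mul (hkin.const_mul I)).mul_const (∏ k, (x' k - t' k))
        refine (h1.congr' ?_).trans (le_of_eq ?_)
        · filter_upwards [hwne, hct.eventually hadm] with w hw hwadm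
          rw [diagFF_insertNth hS hF hwadm hw, Fin.prod_univ_succAbove _ p]
          simp only [hc, Fin.insertNth_apply_same, Fin.insertNth_apply_succAbove]
          linear_combination (-(∏ k : Fin N, (if k.castSucc < p then S (x' k - w)
            else S (t (p.succAbove k) - t p)) / S (x' k - t p)) * ((w - t p) *
            listFF F ((w + Real.pi * I) :: t p :: rest)) * ∏ k, (x' k - t' k)) * I_mul_I
        · congr 1
          simp only [residueFactor, hx']
          ring
      have hrhs : Tendsto (fun w => H (c w) * pairProd θ₀ (c w).1 (c w).2) (𝓝[≠] (t p))
          (𝓝 (H (x, t) * pairProd θ₀ x t)) := by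
        refine (hHq.continuousAt.tendsto.comp hct).mul ?_
        have := continuousAt_pairProd (θ₀ := θ₀) (q := (x, t)) (fun i j hij => hcross i j (by
          by_contra! h; exact hij (h.1.trans h.2.symm)))
        exact this.tendsto.comp hct
      have heq := tendsto_nhds_unique (hlhs.congr' (by
        filter_upwards [hwne, hct.eventually hq] with w hw hw' using hw' hw)) hrhs
      have h2 := hq' hne'
      rw [diagFF_eq_listFF] at h2
      rw [h2] at heq
      rw [pairProd_succAbove hqp (fun k => ⟨hcross _ _ (Or.inl (hsne k)), htinj.ne (hsne k)⟩)]
        at heq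
      have hpp : pairProd (fun k => θ₀ (p.succAbove k)) x' t' ≠ 0 :=
        pairProd_ne_zero (fun i j _ => hne' i j)
          (hxinj.comp Fin.succAbove_right_injective) (htinj.comp Fin.succAbove_right_injective)
      rw [sub_eq_zero]
      apply mul_right_cancel₀ hpp
      rw [← heq]
      ring
  filter_upwards [hmain] with q hq hqp
  exact sub_eq_zero.1 (hq (by rw [crossForm_apply, hqp, sub_self]))

end

/-! ### The leading term of the regular part -/

/-- The regular part as a function of the displacements `η = x - t`. -/
def slice {N : ℕ} (H : (Fin N → ℂ) × (Fin N → ℂ) → ℂ) (t : Fin N → ℂ) : (Fin N → ℂ) → ℂ :=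
  fun η => H (t + η, t)

/-- The insertion of a zero in position `p`. -/
noncomputable def insertZero {N : ℕ} (p : Fin (N + 1)) : (Fin N → ℂ) →L[ℂ] (Fin (N + 1) → ℂ) :=
  ContinuousLinearMap.pi fun i => p.insertNth
    (α := fun _ => (Fin N → ℂ) →L[ℂ] ℂ) 0 (fun k => ContinuousLinearMap.proj k) i

section

variable {N : ℕ}

@[simp] theorem insertZero_same (p : Fin (N + 1)) (v : Fin N → ℂ) : insertZero p v p = 0 := by
  simp [insertZero]

@[simp] theorem insertZero_succAbove (p : Fin (N + 1)) (v : Fin N → ℂ) (k : Fin N) :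
    insertZero p v (p.succAbove k) = v k := by
  simp [insertZero]

theorem insertZero_single (p : Fin (N + 1)) (k : Fin N) :
    insertZero p (Pi.single k 1) = Pi.single (p.succAbove k) 1 := by
  ext i
  refine Fin.succAboveCases p ?_ (fun j => ?_) i
  · rw [insertZero_same, Pi.single_eq_of_ne (Fin.succAbove_ne p k).symm]
  · rw [insertZero_succAbove]
    by_cases h : j = k
    · subst h; simp
    · rw [Pi.single_eq_of_ne h,
        Pi.single_eq_of_ne (fun h' => h (Fin.succAbove_right_injective h'))]

variable {H : (Fin N → ℂ) × (Fin N → ℂ) → ℂ} {t : Fin N → ℂ}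

theorem analyticAt_slice (hH : AnalyticAt ℂ H (t, t)) : AnalyticAt ℂ (slice H t) 0 := by
  have h : AnalyticAt ℂ H ((fun η : Fin N → ℂ => (t + η, t)) 0) := by simpa using hH
  exact AnalyticAt.fun_comp (g := H) (f := fun η : Fin N → ℂ => (t + η, t)) h
    ((analyticAt_const.add analyticAt_id).prod analyticAt_const)

theorem iteratedFDeriv_slice (hH : AnalyticAt ℂ H (t, t)) (n : ℕ) (v : Fin n → Fin N → ℂ) :
    iteratedFDeriv ℂ n (slice H t) 0 v
      = iteratedFDeriv ℂ n H (t, t) (fun i => (v i, 0)) := by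
  have := iteratedFDeriv_comp_add_clm (ContinuousLinearMap.inl ℂ (Fin N → ℂ) (Fin N → ℂ)) hH n v
  have e : slice H t = fun y =>
      H ((t, t) + ContinuousLinearMap.inl ℂ (Fin N → ℂ) (Fin N → ℂ) y) := by
    ext y; simp [slice]
  rw [e, this]
  simp

theorem multilinear_eq_zero_of_insertZero {k : ℕ} (hk : k < N + 1)
    (D : ContinuousMultilinearMap ℂ (fun _ : Fin k => Fin (N + 1) → ℂ) ℂ)
    (hD : ∀ (p : Fin (N + 1)) (v : Fin k → Fin N → ℂ), D (fun i => insertZero p (v i)) = 0) :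
    D = 0 := by
  apply ContinuousMultilinearMap.toMultilinearMap_injective
  refine Module.Basis.ext_multilinear (fun _ => Pi.basisFun ℂ (Fin (N + 1))) fun c => ?_
  obtain ⟨p, hp⟩ : ∃ p, ∀ i, c i ≠ p := by
    by_contra! h
    have := Fintype.card_le_of_surjective c h
    simp at this
    omega
  choose j hj using fun i => Fin.exists_succAbove_eq (hp i)
  have e : (fun i => Pi.basisFun ℂ (Fin (N + 1)) (c i))
      = fun i => insertZero p (Pi.single (j i) 1) := by
    ext1 i; rw [insertZero_single, hj, Pi.basisFun_apply]
  change D (fun i => Pi.basisFun ℂ (Fin (N + 1)) (c i)) = 0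
  rw [e]; exact hD p _

end

theorem tendsto_diag {N : ℕ} (θ₀ : Fin N → ℂ) :
    Tendsto (fun t : Fin N → ℂ => (t, t)) (𝓝 θ₀) (𝓝 (θ₀, θ₀)) := by
  have : Continuous fun t : Fin N → ℂ => (t, t) := by fun_prop
  exact this.tendsto _

section

variable {S : ℂ → ℂ} (hS : IsScatteringMatrix S) {N : ℕ}

theorem residueFactor_self {t : Fin (N + 1) → ℂ} (ht : Admissible S t) (p : Fin (N + 1)) :
    residueFactor S p t t = 0 := by
  have : phaseProd S p t t = 1 :=
    Finset.prod_eq_one fun k _ => div_self (ht _ _).1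
  rw [residueFactor, this]; simp

include hS

omit hS in
theorem Admissible.succAbove {t : Fin (N + 1) → ℂ} (ht : Admissible S t) (p : Fin (N + 1)) :
    Admissible S (fun k => t (p.succAbove k)) := fun _ _ => ht _ _

theorem analyticAt_residueFactor_slice {t : Fin (N + 1) → ℂ} (ht : Admissible S t)
    (p : Fin (N + 1)) :
    AnalyticAt ℂ (fun η : Fin N → ℂ => residueFactor S p (t + insertZero p η) t) 0 := by
  have h : AnalyticAt ℂ (fun q : (Fin (N + 1) → ℂ) × (Fin (N + 1) → ℂ) =>
      residueFactor S p q.1 q.2) ((fun η : Fin N → ℂ => (t + insertZero p η, t)) 0) := by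
    simpa using analyticAt_residueFactor hS ht p
  exact AnalyticAt.fun_comp (f := fun η : Fin N → ℂ => (t + insertZero p η, t)) h
    ((analyticAt_const.add ((insertZero p).analyticAt 0)).prod analyticAt_const)

variable {F : (n : ℕ) → (Fin n → ℂ) → ℂ} (hF : IsFormFactor S F)
include hF

theorem slice_insertZero {θ₀ : Fin (N + 1) → ℂ} (hθ : Admissible S θ₀) (p : Fin (N + 1))
    {H : (Fin (N + 1) → ℂ) × (Fin (N + 1) → ℂ) → ℂ} (hH : IsRegularPart F θ₀ H)
    {H' : (Fin N → ℂ) × (Fin N → ℂ) → ℂ}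
    (hH' : IsRegularPart F (fun k => θ₀ (p.succAbove k)) H') :
    ∀ᶠ t in 𝓝 θ₀, (fun η => slice H t (insertZero p η)) =ᶠ[𝓝 0] fun η =>
      residueFactor S p (t + insertZero p η) t * slice H' (fun k => t (p.succAbove k)) η := by
  filter_upwards [(tendsto_diag θ₀).eventually (eventually_eventually_nhds.2
    (regularPart_residue hS hF hθ p hH hH'))] with t ht
  have hc : Tendsto (fun η : Fin N → ℂ => (t + insertZero p η, t)) (𝓝 0) (𝓝 (t, t)) := by
    have : Continuous fun η : Fin N → ℂ => (t + insertZero p η, t) := by fun_prop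
    simpa using this.tendsto 0
  filter_upwards [hc.eventually ht] with η hη
  rw [slice, hη (by simp), slice]
  congr 2
  ext1
  · ext k; simp
  · rfl

theorem iteratedFDeriv_slice_eq_zero : ∀ {N : ℕ} {θ₀ : Fin N → ℂ}, Admissible S θ₀ →
    ∀ {H : (Fin N → ℂ) × (Fin N → ℂ) → ℂ}, IsRegularPart F θ₀ H →
    ∀ᶠ t in 𝓝 θ₀, ∀ k < N, iteratedFDeriv ℂ k (slice H t) 0 = 0 := by
  intro N
  induction N with
  | zero => intro θ₀ _ H _; simp
  | succ N ih =>
    intro θ₀ hθ H hH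
    have hR : ∀ p : Fin (N + 1), ∃ H' : (Fin N → ℂ) × (Fin N → ℂ) → ℂ,
        IsRegularPart F (fun k => θ₀ (p.succAbove k)) H' := fun p =>
      exists_isRegularPart hS hF (hθ.succAbove p)
    choose H' hH' using hR
    have ht : ∀ p : Fin (N + 1), Tendsto (fun (t : Fin (N + 1) → ℂ) k => t (p.succAbove k))
        (𝓝 θ₀) (𝓝 fun k => θ₀ (p.succAbove k)) := fun p => by
      have : Continuous fun (t : Fin (N + 1) → ℂ) (k : Fin N) => t (p.succAbove k) := by fun_prop
      exact this.tendsto _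
    filter_upwards [Filter.eventually_all.2 fun p => slice_insertZero hS hF hθ p hH (hH' p),
      Filter.eventually_all.2 fun p => (ht p).eventually (ih (hθ.succAbove p) (hH' p)),
      Filter.eventually_all.2 fun p => (ht p).eventually ((tendsto_diag _).eventually
        (hH' p).analytic.eventually_analyticAt),
      (tendsto_diag θ₀).eventually hH.analytic.eventually_analyticAt,
      eventually_admissible hS hθ] with t h1 h2 h3 h4 h5 k hk
    refine multilinear_eq_zero_of_insertZero hk _ fun p v => ?_
    have h6 := iteratedFDeriv_comp_clm (insertZero p) (f := slice H t) (x := 0)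
      (by rw [map_zero]; exact analyticAt_slice h4) k
    rw [map_zero] at h6
    have h7 := DFunLike.congr_fun h6 v
    rw [ContinuousMultilinearMap.compContinuousLinearMap_apply] at h7
    rw [← h7, ((h1 p).iteratedFDeriv ℂ k).self_of_nhds,
      iteratedFDeriv_mul_eq_zero (a := 1) (b := N) (analyticAt_residueFactor_slice hS h5 p)
        (analyticAt_slice (h3 p)) ?_ (h2 p) (by omega)]
    · rfl
    · intro i hi
      obtain rfl : i = 0 := by omega
      ext
      simp [residueFactor_self h5]

end

section

variable {S : ℂ → ℂ} (hS : IsScatteringMatrix S) {N : ℕ}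

/-- The linear form `η ↦ ∑_k φ(t_p - t_k) η_k`. -/
noncomputable def phiForm (S : ℂ → ℂ) {N : ℕ} (p : Fin (N + 1)) (t : Fin (N + 1) → ℂ) :
    (Fin N → ℂ) →L[ℂ] ℂ :=
  ∑ k : Fin N, phi S (t p - t (p.succAbove k)) • ContinuousLinearMap.proj k

theorem phiForm_apply (p : Fin (N + 1)) (t : Fin (N + 1) → ℂ) (η : Fin N → ℂ) :
    phiForm S p t η = ∑ k : Fin N, phi S (t p - t (p.succAbove k)) * η k := by
  simp [phiForm]

include hS

theorem fderiv_residueFactor {t : Fin (N + 1) → ℂ} (ht : Admissible S t) (p : Fin (N + 1)) :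
    fderiv ℂ (fun η : Fin N → ℂ => residueFactor S p (t + insertZero p η) t) 0
      = phiForm S p t := by
  ext1 η
  have han := analyticAt_residueFactor_slice hS ht p
  have h1 : HasDerivAt (fun z : ℂ => z • η) η 0 := by
    simpa using (hasDerivAt_id (0 : ℂ)).smul_const η
  have h2 : HasDerivAt (fun z : ℂ => residueFactor S p (t + insertZero p (z • η)) t)
      (fderiv ℂ (fun η : Fin N → ℂ => residueFactor S p (t + insertZero p η) t) 0 η) 0 := by
    have h3 : HasFDerivAt (fun η : Fin N → ℂ => residueFactor S p (t + insertZero p η) t)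
        (fderiv ℂ (fun η : Fin N → ℂ => residueFactor S p (t + insertZero p η) t) 0)
        ((0 : ℂ) • η) := by
      rw [zero_smul]; exact han.differentiableAt.hasFDerivAt
    exact h3.comp_hasDerivAt 0 h1
  refine h2.unique ?_
  have hlin : ∀ (a b : ℂ), HasDerivAt (fun z : ℂ => a - (b + z * 1)) (-1) 0 := fun a b => by
    simpa using (((hasDerivAt_id (0 : ℂ)).mul_const 1).const_add b).const_sub a
  have hf : ∀ k : Fin N, HasDerivAt (fun z : ℂ => S (t p - t (p.succAbove k)) /
      S (t p - (t (p.succAbove k) + z * η k)))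
      (logDeriv S (t p - t (p.succAbove k)) * η k) 0 := by
    intro k
    set a := t p - t (p.succAbove k) with ha
    have ha0 : S a ≠ 0 := (ht _ _).1
    have e : t p - (t (p.succAbove k) + 0 * η k) = a := by rw [ha]; ring
    have h3 : HasDerivAt (fun z : ℂ => t p - (t (p.succAbove k) + z * η k)) (-(η k)) 0 := by
      simpa using (((hasDerivAt_id (0 : ℂ)).mul_const (η k)).const_add
        (t (p.succAbove k))).const_sub (t p)
    have h4 : HasDerivAt S (deriv S a) (t p - (t (p.succAbove k) + 0 * η k)) := by
      rw [e]; exact (hS.analyticAt ha0).differentiableAt.hasDerivAt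
    have h5 := (hasDerivAt_const (0 : ℂ) (S a)).fun_div (h4.comp (0 : ℂ) h3)
      (by simp only [Function.comp]; rw [e]; exact ha0)
    refine h5.congr_deriv ?_
    simp only [Function.comp]
    rw [e, logDeriv_apply]
    field_simp
    ring
  have hP : HasDerivAt (fun z : ℂ => phaseProd S p (t + insertZero p (z • η)) t)
      (∑ k : Fin N, logDeriv S (t p - t (p.succAbove k)) * η k) 0 := by
    have h3 := HasDerivAt.fun_finsetProd (u := Finset.univ) (fun k _ => hf k)
    have e : (fun z : ℂ => phaseProd S p (t + insertZero p (z • η)) t)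
        = fun z => ∏ k : Fin N, S (t p - t (p.succAbove k)) /
          S (t p - (t (p.succAbove k) + z * η k)) := by
      ext z
      simp [phaseProd]
    rw [e]
    refine h3.congr_deriv (Finset.sum_congr rfl fun k _ => ?_)
    rw [Finset.prod_eq_one, one_smul]
    intro j _
    simp only [zero_mul, add_zero]
    exact div_self (ht _ _).1
  set E : ℂ → ℂ := fun z => ∏ k : Fin N, (if k.castSucc < p then
    S ((t + insertZero p (z • η)) (p.succAbove k) - t p)
    else S (t (p.succAbove k) - t p)) / S ((t + insertZero p (z • η)) (p.succAbove k) - t p) with hE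
  have hE0 : E 0 = 1 := by
    refine Finset.prod_eq_one fun k _ => ?_
    simp [div_self (ht (p.succAbove k) p).1]
  have hSan : ∀ k : Fin N, DifferentiableAt ℂ
      (fun z : ℂ => S ((t + insertZero p (z • η)) (p.succAbove k) - t p)) 0 := fun k => by
    have h3 : AnalyticAt ℂ S ((t + insertZero p ((0 : ℂ) • η)) (p.succAbove k) - t p) := by
      refine hS.analyticAt ?_
      simpa using (ht (p.succAbove k) p).1
    have h4 : DifferentiableAt ℂ
        (fun z : ℂ => (t + insertZero p (z • η)) (p.succAbove k) - t p) 0 := by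
      simp only [Pi.add_apply, insertZero_succAbove, Pi.smul_apply, smul_eq_mul]
      fun_prop
    exact h3.differentiableAt.comp (0 : ℂ) h4
  have hEd : DifferentiableAt ℂ E 0 := by
    refine DifferentiableAt.fun_finsetProd fun k _ => DifferentiableAt.fun_div ?_ (hSan k) ?_
    · split_ifs
      · exact hSan k
      · exact differentiableAt_const _
    · simpa using (ht (p.succAbove k) p).1
  have h6 := hEd.hasDerivAt.mul ((hP.const_sub 1).const_mul I)
  have h7 : phaseProd S p (t + insertZero p ((0 : ℂ) • η)) t = 1 := by
    rw [zero_smul, map_zero, add_zero]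
    exact Finset.prod_eq_one fun k _ => div_self (ht _ _).1
  refine HasDerivAt.congr_deriv (f := fun z : ℂ => residueFactor S p (t + insertZero p (z • η)) t)
    h6 ?_
  rw [h7, hE0, phiForm_apply, sub_self, mul_zero, mul_zero, zero_add, one_mul, mul_neg,
    Finset.mul_sum, ← Finset.sum_neg_distrib]
  refine Finset.sum_congr rfl fun k _ => ?_
  rw [phi]; ring

variable {F : (n : ℕ) → (Fin n → ℂ) → ℂ} (hF : IsFormFactor S F)
include hF

/-- The leading term of the regular part at `η_p = 0`. -/
theorem leading_insertZero {θ₀ : Fin (N + 1) → ℂ} (hθ : Admissible S θ₀) (p : Fin (N + 1))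
    {H : (Fin (N + 1) → ℂ) × (Fin (N + 1) → ℂ) → ℂ} (hH : IsRegularPart F θ₀ H)
    {H' : (Fin N → ℂ) × (Fin N → ℂ) → ℂ}
    (hH' : IsRegularPart F (fun k => θ₀ (p.succAbove k)) H') (v : Fin (N + 1) → Fin N → ℂ) :
    iteratedFDeriv ℂ (N + 1) (slice H θ₀) 0 (fun i => insertZero p (v i))
      = ∑ k, phiForm S p θ₀ (v k) *
        iteratedFDeriv ℂ N (slice H' fun k => θ₀ (p.succAbove k)) 0
          (fun i => v (k.succAbove i)) := by
  set h' := slice H' fun k => θ₀ (p.succAbove k) with hh'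
  set K : (Fin N → ℂ) → ℂ := fun η => residueFactor S p (θ₀ + insertZero p η) θ₀ with hK
  set κ := phiForm S p θ₀ with hκ
  have hKan : AnalyticAt ℂ K 0 := analyticAt_residueFactor_slice hS hθ p
  have hhan : AnalyticAt ℂ h' 0 := analyticAt_slice hH'.analytic
  have hκan : AnalyticAt ℂ (fun η => κ η) 0 := κ.analyticAt 0
  have h1 := iteratedFDeriv_comp_clm (insertZero p) (f := slice H θ₀) (x := 0)
      (by rw [map_zero]; exact analyticAt_slice hH.analytic) (N + 1)
  rw [map_zero] at h1
  have h2 := DFunLike.congr_fun h1 v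
  rw [ContinuousMultilinearMap.compContinuousLinearMap_apply] at h2
  have h3 := (slice_insertZero hS hF hθ p hH hH').self_of_nhds
  rw [← h2, (h3.iteratedFDeriv ℂ (N + 1)).self_of_nhds]
  have e : (fun η => residueFactor S p (θ₀ + insertZero p η) θ₀ *
      slice H' (fun k => θ₀ (p.succAbove k)) η)
      = (fun η => κ η * h' η) + fun η => (K η - κ η) * h' η := by
    ext η; simp only [Pi.add_apply, hK, hh']; ring
  have hz : iteratedFDeriv ℂ (N + 1) (fun η => (K η - κ η) * h' η) 0 = 0 := by
    refine iteratedFDeriv_mul_eq_zero (a := 2) (b := N) (hKan.sub hκan) hhan ?_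
      (iteratedFDeriv_slice_eq_zero hS hF (hθ.succAbove p) hH').self_of_nhds (by omega)
    intro i hi
    interval_cases i
    · ext
      simp [hK, residueFactor_self hθ]
    · ext w
      rw [iteratedFDeriv_one_apply]
      have h4 : HasFDerivAt (fun η => K η - κ η) (fderiv ℂ K 0 - κ) 0 :=
        hKan.differentiableAt.hasFDerivAt.sub κ.hasFDerivAt
      have h5 : fderiv ℂ K 0 = κ := fderiv_residueFactor hS hθ p
      have h6 : fderiv ℂ (fun η => K η - κ η) 0 = 0 := by rw [h4.fderiv, h5, sub_self]
      exact DFunLike.congr_fun h6 (w 0)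
  rw [e, iteratedFDeriv_add_apply (f := fun η => κ η * h' η) (g := fun η => (K η - κ η) * h' η)
    (hκan.mul hhan).contDiffAt ((hKan.sub hκan).mul hhan).contDiffAt, hz, add_zero,
    iteratedFDeriv_linear_mul κ N hhan v]
  simp

omit hF hS in
theorem pairProd_self {θ₀ t : Fin N → ℂ} (ht : Function.Injective t) : pairProd θ₀ t t = 1 := by
  refine Finset.prod_eq_one fun i _ => Finset.prod_eq_one fun j _ => ?_
  split_ifs with h
  · have h1 := sub_ne_zero.2 (ht.ne h.1.ne)
    have h2 := sub_ne_zero.2 (ht.ne h.1.ne')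
    exact div_self (mul_ne_zero h1 h2)
  · rfl

omit hF hS in
theorem isFinitePiece_unique {θ : Fin N → ℂ} {c c' : ℂ} (h : IsFinitePiece F θ c)
    (h' : IsFinitePiece F θ c') : c = c' := by
  obtain ⟨G, hG, hGF, rfl⟩ := h
  obtain ⟨G', hG', hGF', rfl⟩ := h'
  have h1 : ∀ᶠ η in 𝓝 (0 : Fin N → ℂ), (0 : (Fin N → ℂ) →L[ℂ] ℂ) η = 0 → G η - G' η = 0 := by
    refine eventually_eq_zero_of_generic Finset.univ
      (fun i : Fin N => (ContinuousLinearMap.proj i : (Fin N → ℂ) →L[ℂ] ℂ)) 0 (fun _ => 1)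
      (by simp) (by simp) ((hG.sub hG').eventually_analyticAt.mono fun x hx => hx.continuousAt) ?_
    filter_upwards [hGF, hGF'] with η h2 h3 _ h4
    have h5 : ∀ i, η i ≠ 0 := fun i => h4 i (Finset.mem_univ i)
    have h6 : ∏ i, η i ≠ 0 := Finset.prod_ne_zero_iff.2 fun i _ => h5 i
    have h7 := (h2 h5).symm.trans (h3 h5)
    rw [div_left_inj' h6] at h7
    rw [h7, sub_self]
  have h2 : G =ᶠ[𝓝 0] G' := h1.mono fun η hη => sub_eq_zero.1 (hη rfl)
  rw [(h2.iteratedFDeriv ℂ N).self_of_nhds]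

omit hF hS in
theorem connected_eq {θ : Fin N → ℂ} {c : ℂ} (h : IsFinitePiece F θ c) : connected F θ = c := by
  have h1 : ∃ c, IsFinitePiece F θ c := ⟨c, h⟩
  rw [connected, dif_pos h1]
  exact isFinitePiece_unique h1.choose_spec h

/-- The leading term of the regular part of the form factor. -/
noncomputable def leading (H : (Fin N → ℂ) × (Fin N → ℂ) → ℂ) (t : Fin N → ℂ) :
    ContinuousMultilinearMap ℂ (fun _ : Fin N => Fin N → ℂ) ℂ :=
  iteratedFDeriv ℂ N (slice H t) 0

theorem eventually_connected_eq {θ₀ : Fin N → ℂ} (hθ : Admissible S θ₀)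
    {H : (Fin N → ℂ) × (Fin N → ℂ) → ℂ} (hH : IsRegularPart F θ₀ H) :
    ∀ᶠ t in 𝓝 θ₀, Function.Injective t →
      connected F t = leading H t (fun i => Pi.single i 1) := by
  filter_upwards [(tendsto_diag θ₀).eventually (eventually_eventually_nhds.2 hH.eq),
    (tendsto_diag θ₀).eventually hH.analytic.eventually_analyticAt,
    iteratedFDeriv_slice_eq_zero hS hF hθ hH] with t h1 h2 h3 ht
  set m : (Fin N → ℂ) → ℂ := fun η => pairProd θ₀ (t + η) t with hm
  have hadd : Tendsto (fun η : Fin N → ℂ => (t + η, t)) (𝓝 0) (𝓝 (t, t)) := by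
    have : Continuous fun η : Fin N → ℂ => (t + η, t) := by fun_prop
    simpa using this.tendsto 0
  have hsl := analyticAt_slice h2
  have hmd : AnalyticAt ℂ m 0 := by
    have hp : ∀ i, AnalyticAt ℂ (fun η : Fin N → ℂ => (t + η) i) 0 := fun i =>
      analyticAt_const.add ((ContinuousLinearMap.proj (R := ℂ)
        (φ := fun _ : Fin N => ℂ) i).analyticAt 0)
    refine Finset.analyticAt_fun_prod _ fun i _ => Finset.analyticAt_fun_prod _ fun j _ => ?_
    split_ifs with h
    · unfold pairRatio
      refine AnalyticAt.div ?_ ?_ ?_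
      · exact ((hp i).sub (hp j)).mul analyticAt_const
      · exact ((hp i).sub analyticAt_const).mul ((hp j).sub analyticAt_const)
      · simp only [add_zero]
        exact mul_ne_zero (sub_ne_zero.2 (ht.ne h.1.ne)) (sub_ne_zero.2 (ht.ne h.1.ne'))
    · exact analyticAt_const
  have hm0 : m 0 = 1 := by simp only [hm, add_zero]; exact pairProd_self ht
  refine connected_eq ⟨fun η => slice H t η * m η, hsl.mul hmd, ?_, ?_⟩
  · have hne : ∀ᶠ η in 𝓝 (0 : Fin N → ℂ), ∀ i j, i ≠ j → (t + η) i ≠ t j := by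
      simp only [Filter.eventually_all]
      intro i j hij
      have hc : Tendsto (fun η : Fin N → ℂ => (t + η) i) (𝓝 0) (𝓝 (t i)) := by
        have : Continuous fun η : Fin N → ℂ => (t + η) i := by fun_prop
        simpa using this.tendsto 0
      exact hc.eventually_ne (ht.ne hij)
    filter_upwards [hadd.eventually h1, hne] with η h4 h5 h6
    have h7 : ∏ i, η i ≠ 0 := Finset.prod_ne_zero_iff.2 fun i _ => h6 i
    rw [eq_div_iff h7]
    have h8 := h4 (fun i j => by
      by_cases hij : i = j
      · subst hij; simpa using h6 i
      · exact h5 i j hij)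
    simp only [Pi.add_apply, add_sub_cancel_left] at h8
    rw [slice, hm, ← h8, diagFF, diagArgs]
    congr 3
    ext i; simp only [Pi.add_apply]; ring
  · have e : (fun η => slice H t η * m η)
        = slice H t + fun η => slice H t η * (m η - 1) := by
      ext η; simp only [Pi.add_apply]; ring
    have hmd' : AnalyticAt ℂ (fun η => m η - 1) 0 := hmd.sub analyticAt_const
    have hz : iteratedFDeriv ℂ N (fun η => slice H t η * (m η - 1)) 0 = 0 := by
      refine iteratedFDeriv_mul_eq_zero (a := N) (b := 1) hsl hmd' h3 ?_ (by omega)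
      intro i hi
      obtain rfl : i = 0 := by omega
      ext
      simp [hm0]
    rw [e, iteratedFDeriv_add_apply (g := fun η => slice H t η * (m η - 1)) hsl.contDiffAt
      (hsl.mul hmd').contDiffAt, hz, add_zero,
      leading]

theorem hasDegenerateValue_leading {θ₀ : Fin N → ℂ} (hθ : Admissible S θ₀)
    {H : (Fin N → ℂ) × (Fin N → ℂ) → ℂ} (hH : IsRegularPart F θ₀ H) :
    HasDegenerateValue F θ₀ (leading H θ₀ fun i => Pi.single i 1) := by
  have h1 : ContinuousAt (fun t : Fin N → ℂ => iteratedFDeriv ℂ N H (t, t)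
      (fun i => (Pi.single i 1, 0))) θ₀ := by
    have h2 := (analyticAt_iteratedFDeriv hH.analytic N).continuousAt
    have h3 : ContinuousAt (fun t : Fin N → ℂ => iteratedFDeriv ℂ N H (t, t)) θ₀ :=
      h2.tendsto.comp (tendsto_diag θ₀)
    exact ((ContinuousMultilinearMap.apply ℂ
      (fun _ : Fin N => (Fin N → ℂ) × (Fin N → ℂ)) ℂ
      (fun i => (Pi.single i 1, 0))).continuous.continuousAt).comp h3
  have h4 := h1.tendsto
  rw [← iteratedFDeriv_slice hH.analytic] at h4
  refine (h4.mono_left nhdsWithin_le_nhds).congr' ?_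
  have h5 := (eventually_connected_eq hS hF hθ hH).filter_mono
    (nhdsWithin_le_nhds (s := {t : Fin N → ℂ | Function.Injective t}))
  have h6 := ((tendsto_diag θ₀).eventually hH.analytic.eventually_analyticAt).filter_mono
    (nhdsWithin_le_nhds (s := {t : Fin N → ℂ | Function.Injective t}))
  filter_upwards [h5, h6, self_mem_nhdsWithin] with t h7 h8 h9
  rw [h7 h9, leading, iteratedFDeriv_slice h8]

end

/-! ### Exchange symmetry -/

theorem regular_of_pairwise {S : ℂ → ℂ} (hS : IsScatteringMatrix S) {n : ℕ} {x : Fin n → ℂ}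
    (h : (List.ofFn x).Pairwise (Generic S)) : Regular S x ∧ kin x ≠ 0 := by
  rw [List.pairwise_ofFn] at h
  refine ⟨fun i j hij => ?_, ?_⟩
  · rcases lt_or_gt_of_ne hij with h1 | h1
    · exact (h h1).1
    · exact hS.sub_ne_zero_symm (h h1).1
  · exact Finset.prod_ne_zero_iff.2 fun i _ => Finset.prod_ne_zero_iff.2 fun j hj =>
      (h (Finset.mem_Ioi.1 hj)).2

section

variable {N : ℕ}

theorem diagFF_swap {S : ℂ → ℂ} (hS : IsScatteringMatrix S) {F : (n : ℕ) → (Fin n → ℂ) → ℂ}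
    (hF : IsFormFactor S F) {x t : Fin N → ℂ}
    (h : Admissible S (Sum.elim x t : Fin N ⊕ Fin N → ℂ)) (hxt : ∀ i j, x i ≠ t j)
    {i i' : Fin N} (hi : (i' : ℕ) = i + 1) :
    diagFF F x t = S (x i - x i') * diagFF F (x ∘ Equiv.swap i i') t := by
  have hp := pairwise_generic_diag hS h hxt
  rw [← ofFn_diag] at hp
  obtain ⟨h1, h2⟩ := regular_of_pairwise hS hp
  have h3 := hF.exchange _ _ h1 h2 i (by omega)
  have e1 : (⟨(i : ℕ), by omega⟩ : Fin (N + N)) = Fin.castAdd N i := rfl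
  have e2 : (⟨(i : ℕ) + 1, by omega⟩ : Fin (N + N)) = Fin.castAdd N i' := Fin.ext hi.symm
  rw [e1, e2, Fin.append_left, Fin.append_left] at h3
  rw [diagFF, h3, diagFF]
  congr 1
  · congr 1; ring
  · congr 1
    ext k
    refine Fin.addCases (fun a => ?_) (fun a => ?_) k
    · simp only [Function.comp, Fin.append_left]
      by_cases ha : a = i
      · subst ha; simp
      · by_cases ha' : a = i'
        · subst ha'; simp
        · rw [Equiv.swap_apply_of_ne_of_ne ha ha', Equiv.swap_apply_of_ne_of_ne, Fin.append_left]
          · exact fun h => ha (Fin.castAdd_injective _ _ h)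
          · exact fun h => ha' (Fin.castAdd_injective _ _ h)
    · have hne : ∀ b : Fin N, Fin.natAdd N a ≠ Fin.castAdd N b := fun b h => by
        have := congrArg Fin.val h
        simp at this
        omega
      simp only [Function.comp]
      rw [Equiv.swap_apply_of_ne_of_ne (hne _) (hne _), Fin.append_right, Fin.append_right]

/-- The Vandermonde product over the pairs of labels that coincide at `θ₀` is antisymmetric. -/
theorem vandermonde_swap {θ₀ : Fin N → ℂ} {i i' : Fin N} (hi : (i' : ℕ) = i + 1)
    (hθ : θ₀ i = θ₀ i') (x : Fin N → ℂ) :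
    (∏ a, ∏ b, if a < b ∧ θ₀ a = θ₀ b then x (Equiv.swap i i' a) - x (Equiv.swap i i' b) else 1)
      = -∏ a, ∏ b, if a < b ∧ θ₀ a = θ₀ b then x a - x b else 1 := by
  set s := Equiv.swap i i' with hs
  have hθs : ∀ a, θ₀ (s a) = θ₀ a := fun a => by
    by_cases ha : a = i
    · subst ha; rw [hs, Equiv.swap_apply_left, hθ]
    · by_cases ha' : a = i'
      · subst ha'; rw [hs, Equiv.swap_apply_right, hθ]
      · rw [hs, Equiv.swap_apply_of_ne_of_ne ha ha']
  have hlt : ∀ a b, (a, b) ≠ (i, i') → a < b → s a < s b := by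
    intro a b hab h
    rw [Ne, Prod.mk.injEq] at hab
    simp only [hs, Equiv.swap_apply_def, Fin.ext_iff] at *
    rw [Fin.lt_def] at *
    split_ifs <;> omega
  have hii : i < i' := by rw [Fin.lt_def]; omega
  set T : Finset (Fin N × Fin N) := Finset.univ.filter fun a => a.1 < a.2 ∧ θ₀ a.1 = θ₀ a.2 with hT
  have hmem : (i, i') ∈ T := by simp [hT, hii, hθ]
  have key : ∀ f : Fin N → Fin N → ℂ, (∏ a, ∏ b, if a < b ∧ θ₀ a = θ₀ b then f a b else 1)
      = f i i' * ∏ a ∈ T.erase (i, i'), f a.1 a.2 := by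
    intro f
    rw [Finset.mul_prod_erase T (fun a => f a.1 a.2) hmem, hT, Finset.prod_filter,
      Fintype.prod_prod_type]
  rw [key fun a b => x (s a) - x (s b), key fun a b => x a - x b]
  have h1 : ∏ a ∈ T.erase (i, i'), (x (s a.1) - x (s a.2))
      = ∏ a ∈ T.erase (i, i'), (x a.1 - x a.2) := by
    have hss : ∀ a, s (s a) = a := fun a => by simp [hs]
    have hmap : ∀ a ∈ T.erase (i, i'), (s a.1, s a.2) ∈ T.erase (i, i') := by
      intro a ha
      rw [Finset.mem_erase, hT, Finset.mem_filter] at ha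
      rw [Finset.mem_erase, hT, Finset.mem_filter]
      refine ⟨fun h => ?_, Finset.mem_univ _, hlt _ _ ha.1 ha.2.2.1, by
        simp only [hθs]; exact ha.2.2.2⟩
      rw [Prod.mk.injEq] at h
      have h2 : a.1 = i' := by rw [← hss a.1, h.1, hs, Equiv.swap_apply_left]
      have h3 : a.2 = i := by rw [← hss a.2, h.2, hs, Equiv.swap_apply_right]
      have := ha.2.2.1
      rw [h2, h3] at this
      exact absurd this hii.not_gt
    refine Finset.prod_nbij' (fun a => (s a.1, s a.2)) (fun a => (s a.1, s a.2)) hmap hmap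
      (fun a _ => by simp [hss]) (fun a _ => by simp [hss]) (fun a _ => rfl)
  rw [h1, hs, Equiv.swap_apply_left, Equiv.swap_apply_right]
  ring

/-- The Cauchy determinant `pairProd / ∏ (x_i - t_i)` is antisymmetric. -/
theorem cauchy_swap {θ₀ : Fin N → ℂ} {i i' : Fin N} (hi : (i' : ℕ) = i + 1)
    (hθ : θ₀ i = θ₀ i') {x t : Fin N → ℂ} (hne : ∀ a b, x a ≠ t b) :
    pairProd θ₀ (x ∘ Equiv.swap i i') t * ∏ a, (x a - t a)
      = - (pairProd θ₀ x t * ∏ a, ((x ∘ Equiv.swap i i') a - t a)) := by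
  set s := Equiv.swap i i' with hs
  have hθs : ∀ a, θ₀ (s a) = θ₀ a := fun a => by
    by_cases ha : a = i
    · subst ha; rw [hs, Equiv.swap_apply_left, hθ]
    · by_cases ha' : a = i'
      · subst ha'; rw [hs, Equiv.swap_apply_right, hθ]
      · rw [hs, Equiv.swap_apply_of_ne_of_ne ha ha']
  have hne' : ∀ a b, (x ∘ s) a ≠ t b := fun a b => hne _ _
  have h1 := pairProd_mul_crossProd θ₀ hne
  have h2 := pairProd_mul_crossProd θ₀ hne'
  have h3 := vandermonde_swap hi hθ x
  rw [← hs] at h3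
  have hprod : ∀ y : Fin N → ℂ, (∏ a, ∏ b, if θ₀ a = θ₀ b then y a - t b else 1)
      = (∏ a, (y a - t a)) * ∏ a, ∏ b, if a < b then (if θ₀ a = θ₀ b then y a - t b else 1) *
      (if θ₀ b = θ₀ a then y b - t a else 1) else 1 := fun y => by
    rw [prod_prod_eq_diag_mul]; simp
  have h4 := hprod x
  have h5 := hprod (x ∘ s)
  have h6 : (∏ a, ∏ b, if θ₀ a = θ₀ b then (x ∘ s) a - t b else 1)
      = ∏ a, ∏ b, if θ₀ a = θ₀ b then x a - t b else 1 := by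
    rw [← Equiv.prod_comp s (fun a => ∏ b, if θ₀ a = θ₀ b then x a - t b else 1)]
    simp only [hθs, Function.comp]
  have hD := crossProd_ne_zero θ₀ hne
  have hD' := crossProd_ne_zero θ₀ hne'
  simp only [Function.comp] at h2 h5 h6 hD' ⊢
  rw [h3] at h2
  rw [h6, h4] at h5
  set D := ∏ a, ∏ b, if a < b then (if θ₀ a = θ₀ b then x a - t b else 1) *
      (if θ₀ b = θ₀ a then x b - t a else 1) else 1
  set D' := ∏ a, ∏ b, if a < b then (if θ₀ a = θ₀ b then x (s a) - t b else 1) *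
      (if θ₀ b = θ₀ a then x (s b) - t a else 1) else 1
  apply mul_right_cancel₀ (mul_ne_zero hD hD')
  linear_combination (∏ a, (x a - t a)) * D * h2 + (∏ a, (x (s a) - t a)) * D' * h1
    - (∏ a, ∏ b, if a < b ∧ θ₀ a = θ₀ b then t b - t a else 1) *
      (∏ a, ∏ b, if a < b ∧ θ₀ a = θ₀ b then x a - x b else 1) * h5

variable {S : ℂ → ℂ} (hS : IsScatteringMatrix S)
  {F : (n : ℕ) → (Fin n → ℂ) → ℂ} (hF : IsFormFactor S F)
include hS hF

theorem regularPart_swap {θ₀ : Fin N → ℂ} (hθ : Admissible S θ₀)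
    {H : (Fin N → ℂ) × (Fin N → ℂ) → ℂ} (hH : IsRegularPart F θ₀ H)
    {i i' : Fin N} (hi : (i' : ℕ) = i + 1) (hii : θ₀ i = θ₀ i') :
    ∀ᶠ q in 𝓝 (θ₀, θ₀), H q = -S (q.1 i - q.1 i') * H (q.1 ∘ Equiv.swap i i', q.2) := by
  set s := Equiv.swap i i' with hs
  set R : (Fin N → ℂ) × (Fin N → ℂ) → (Fin N → ℂ) × (Fin N → ℂ) := fun q => (q.1 ∘ s, q.2) with hR
  have hθs : θ₀ ∘ s = θ₀ := by
    ext a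
    by_cases ha : a = i
    · subst ha; simp [hs, hii]
    · by_cases ha' : a = i'
      · subst ha'; simp [hs, hii]
      · simp [hs, Equiv.swap_apply_of_ne_of_ne ha ha']
  have hR0 : R (θ₀, θ₀) = (θ₀, θ₀) := by simp [hR, hθs]
  have hRan : AnalyticAt ℂ R (θ₀, θ₀) := by
    refine AnalyticAt.prod ?_ ?_
    · exact analyticAt_pi_iff.2 fun k => analyticAt_fst_apply _ _
    · exact analyticAt_pi_iff.2 fun k => analyticAt_snd_apply _ _
  have hRt : Tendsto R (𝓝 (θ₀, θ₀)) (𝓝 (θ₀, θ₀)) := by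
    have := hRan.continuousAt.tendsto
    rwa [hR0] at this
  have hHR : AnalyticAt ℂ (fun q => H (R q)) (θ₀, θ₀) :=
    AnalyticAt.fun_comp (g := H) (f := R) (by rw [hR0]; exact hH.analytic) hRan
  have hSan : AnalyticAt ℂ (fun q : (Fin N → ℂ) × (Fin N → ℂ) => S (q.1 i - q.1 i')) (θ₀, θ₀) :=
    analyticAt_comp_S hS (f := fun q : (Fin N → ℂ) × (Fin N → ℂ) => q.1 i - q.1 i')
      ((analyticAt_fst_apply i _).sub (analyticAt_fst_apply i' _)) (hθ i i').1
  have hfan : AnalyticAt ℂ (fun q => H q - -S (q.1 i - q.1 i') * H (R q)) (θ₀, θ₀) :=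
    hH.analytic.sub (hSan.neg.mul hHR)
  have hmain : ∀ᶠ q in 𝓝 (θ₀, θ₀), (0 : (Fin N → ℂ) × (Fin N → ℂ) →L[ℂ] ℂ) q = 0 →
      H q - -S (q.1 i - q.1 i') * H (R q) = 0 := by
    refine eventually_eq_zero_of_generic
      (Finset.univ.filter fun a : (Fin N × Fin N) ⊕ (Bool × Fin N × Fin N) =>
        ∀ b, a = .inr b → b.2.1 ≠ b.2.2)
      (Sum.elim crossForm diffForm) 0
      (fun k => ((k : ℕ) : ℂ), fun k => ((N + k : ℕ) : ℂ)) (by simp) ?_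
      (hfan.eventually_analyticAt.mono fun x hx => hx.continuousAt) ?_
    · rintro (⟨a, b⟩ | ⟨c, a, b⟩) hab
      · simp only [Sum.elim_inl, crossForm_apply]
        rw [sub_ne_zero]; norm_cast; omega
      · have hab : (a : ℕ) ≠ b := by
          simp only [Finset.mem_filter, Finset.mem_univ, true_and] at hab
          exact fun h => hab _ rfl (Fin.ext h)
        cases c
        · simp only [Sum.elim_inr, diffForm_false]
          rw [sub_ne_zero]; norm_cast
        · simp only [Sum.elim_inr, diffForm_true]
          rw [sub_ne_zero]; norm_cast; omega
    · filter_upwards [hH.eq, hRt.eventually hH.eq, eventually_admissible_pair hS hθ]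
        with q h1 h2 h3 _ hgen
      have hne : ∀ a b, q.1 a ≠ q.2 b := fun a b => by
        have := hgen (.inl (a, b)) (by simp)
        simpa [crossForm_apply, sub_eq_zero] using this
      have hxinj : Function.Injective q.1 := by
        intro a b hab
        by_contra hc
        have := hgen (.inr (false, a, b)) (by simpa using hc)
        simp [diffForm_false, hab] at this
      have htinj : Function.Injective q.2 := by
        intro a b hab
        by_contra hc
        have := hgen (.inr (true, a, b)) (by simpa using hc)
        simp [diffForm_true, hab] at this
      have h4 := h1 hne
      have h5 := h2 (fun a b => hne (s a) b)
      have h6 := diagFF_swap hS hF h3 hne hi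
      rw [← hs] at h6
      have h7 := cauchy_swap hi hii hne
      rw [← hs] at h7
      have hpp : pairProd θ₀ q.1 q.2 ≠ 0 := pairProd_ne_zero (fun a b _ => hne a b) hxinj htinj
      have hP : ∏ a, ((q.1 ∘ s) a - q.2 a) ≠ 0 :=
        Finset.prod_ne_zero_iff.2 fun a _ => sub_ne_zero.2 (hne _ _)
      simp only [hR] at h5 ⊢
      apply mul_right_cancel₀ (mul_ne_zero hpp hP)
      rw [h6] at h4
      linear_combination (-(∏ a, ((q.1 ∘ s) a - q.2 a))) * h4
        + S (q.1 i - q.1 i') * (∏ a, (q.1 a - q.2 a)) * h5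
        + S (q.1 i - q.1 i') * H (q.1 ∘ s, q.2) * h7
  filter_upwards [hmain] with q hq
  exact sub_eq_zero.1 (hq rfl)

end

/-! ### The leading term depends only on sums over coinciding rapidities -/

section

variable {S : ℂ → ℂ} (hS : IsScatteringMatrix S) {N : ℕ}
  {F : (n : ℕ) → (Fin n → ℂ) → ℂ} (hF : IsFormFactor S F)

theorem leading_comp_perm {H : (Fin N → ℂ) × (Fin N → ℂ) → ℂ} {t : Fin N → ℂ}
    (hH : AnalyticAt ℂ H (t, t)) (v : Fin N → Fin N → ℂ) (σ : Equiv.Perm (Fin N)) :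
    leading H t (v ∘ σ) = leading H t v :=
  (analyticAt_slice hH).contDiffAt.iteratedFDeriv_comp_perm v σ

include hS hF

theorem tendsto_leading {θ₀ : Fin N → ℂ} (hθ : Admissible S θ₀)
    {H : (Fin N → ℂ) × (Fin N → ℂ) → ℂ} (hH : IsRegularPart F θ₀ H) (ξ τ : Fin N → ℂ) :
    Tendsto (fun z : ℂ => H (θ₀ + z • τ + z • ξ, θ₀ + z • τ) / z ^ N) (𝓝[≠] 0)
      (𝓝 (leading H θ₀ (fun _ => ξ) / N.factorial)) := by
  set R : ℂ × ℂ → ℂ := fun q => H (θ₀ + q.2 • τ + q.1 • ξ, θ₀ + q.2 • τ) with hR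
  have hRan : AnalyticAt ℂ R 0 := by
    have h2 : ∀ v : Fin N → ℂ, AnalyticAt ℂ (fun q : ℂ × ℂ => q.2 • v) 0 := fun v =>
      ((ContinuousLinearMap.toSpanSingleton ℂ v).comp
        (ContinuousLinearMap.snd ℂ ℂ ℂ)).analyticAt 0
    have h1 : ∀ v : Fin N → ℂ, AnalyticAt ℂ (fun q : ℂ × ℂ => q.1 • v) 0 := fun v =>
      ((ContinuousLinearMap.toSpanSingleton ℂ v).comp
        (ContinuousLinearMap.fst ℂ ℂ ℂ)).analyticAt 0
    refine AnalyticAt.fun_comp (g := H)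
      (f := fun q : ℂ × ℂ => (θ₀ + q.2 • τ + q.1 • ξ, θ₀ + q.2 • τ)) (by simpa using hH.analytic) ?_
    exact ((analyticAt_const.add (h2 τ)).add (h1 ξ)).prod (analyticAt_const.add (h2 τ))
  have hw : Tendsto (fun w : ℂ => θ₀ + w • τ) (𝓝 0) (𝓝 θ₀) := by
    have : Continuous fun w : ℂ => θ₀ + w • τ := by fun_prop
    simpa using this.tendsto 0
  have hder : ∀ {t : Fin N → ℂ}, AnalyticAt ℂ H (t, t) → ∀ k,
      iteratedDeriv k (fun z : ℂ => H (t + z • ξ, t)) 0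
        = iteratedFDeriv ℂ k (slice H t) 0 (fun _ => ξ) := by
    intro t ht k
    have h1 := iteratedFDeriv_comp_clm (ContinuousLinearMap.toSpanSingleton ℂ ξ) (f := slice H t)
      (x := 0) (by rw [map_zero]; exact analyticAt_slice ht) k
    rw [map_zero] at h1
    have h2 := DFunLike.congr_fun h1 (fun _ => 1)
    rw [ContinuousMultilinearMap.compContinuousLinearMap_apply] at h2
    simp only [ContinuousLinearMap.toSpanSingleton_apply, one_smul] at h2
    rw [← h2, iteratedDeriv_eq_iteratedFDeriv]
    rfl
  have h := tendsto_diag_div_pow N hRan (by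
    filter_upwards [hw.eventually (iteratedFDeriv_slice_eq_zero hS hF hθ hH),
      hw.eventually ((tendsto_diag θ₀).eventually hH.analytic.eventually_analyticAt)]
      with w h1 h2 k hk
    have := hder h2 k
    simp only [hR]
    rw [this, h1 k hk]; rfl)
  have h3 := hder hH.analytic N
  simp only [hR, zero_smul, add_zero] at h
  rwa [h3] at h

theorem leading_translation {θ₀ : Fin N → ℂ} (hθ : Admissible S θ₀)
    {H : (Fin N → ℂ) × (Fin N → ℂ) → ℂ} (hH : IsRegularPart F θ₀ H)
    {i i' : Fin N} (hi : (i' : ℕ) = i + 1) (hii : θ₀ i = θ₀ i') (ξ τ : Fin N → ℂ) :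
    leading H θ₀ (fun _ => ξ)
      = leading H θ₀ (fun _ => ξ ∘ Equiv.swap i i' + (τ ∘ Equiv.swap i i' - τ)) := by
  set s := Equiv.swap i i' with hs
  have hθs : θ₀ ∘ s = θ₀ := by
    ext a
    by_cases ha : a = i
    · subst ha; simp [hs, hii]
    · by_cases ha' : a = i'
      · subst ha'; simp [hs, hii]
      · simp [hs, Equiv.swap_apply_of_ne_of_ne ha ha']
  have h1 := tendsto_leading hS hF hθ hH ξ τ
  have h2 := tendsto_leading hS hF hθ hH (ξ ∘ s + (τ ∘ s - τ)) τ
  have hc : Tendsto (fun z : ℂ => (θ₀ + z • τ + z • ξ, θ₀ + z • τ)) (𝓝[≠] 0) (𝓝 (θ₀, θ₀)) := by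
    have : Continuous fun z : ℂ => (θ₀ + z • τ + z • ξ, θ₀ + z • τ) := by fun_prop
    have := this.tendsto 0
    simp only [zero_smul, add_zero] at this
    exact this.mono_left nhdsWithin_le_nhds
  have hS1 : Tendsto (fun z : ℂ => -S ((θ₀ + z • τ + z • ξ) i - (θ₀ + z • τ + z • ξ) i'))
      (𝓝[≠] 0) (𝓝 1) := by
    have h3 : Tendsto (fun z : ℂ => (θ₀ + z • τ + z • ξ) i - (θ₀ + z • τ + z • ξ) i')
        (𝓝[≠] 0) (𝓝 0) := by
      have : Continuous fun z : ℂ => (θ₀ + z • τ + z • ξ) i - (θ₀ + z • τ + z • ξ) i' := by fun_prop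
      have := this.tendsto 0
      simp only [zero_smul, add_zero, hii, sub_self] at this
      exact this.mono_left nhdsWithin_le_nhds
    have h4 : ContinuousAt S 0 := (hS.analyticAt (by rw [hS.at_zero]; norm_num)).continuousAt
    have h5 := (h4.tendsto.comp h3).neg
    rw [hS.at_zero, neg_neg] at h5
    exact h5
  have h3 := tendsto_nhds_unique (h1.congr' (by
    filter_upwards [hc.eventually (regularPart_swap hS hF hθ hH hi hii)] with z hz
    rw [hz, mul_div_assoc])) (hS1.mul (h2.congr (fun z => by
      show _ = H ((θ₀ + z • τ + z • ξ) ∘ s, θ₀ + z • τ) / z ^ N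
      congr 3
      ext a
      have := congrFun hθs a
      simp only [Function.comp] at this
      simp only [Pi.add_apply, Pi.smul_apply, smul_eq_mul, Function.comp, Pi.sub_apply, this]
      ring)))
  rw [one_mul, div_left_inj' (by exact_mod_cast Nat.factorial_ne_zero N)] at h3
  exact h3

theorem leading_single_adjacent {θ₀ : Fin N → ℂ} (hθ : Admissible S θ₀)
    {H : (Fin N → ℂ) × (Fin N → ℂ) → ℂ} (hH : IsRegularPart F θ₀ H)
    {i i' : Fin N} (hi : (i' : ℕ) = i + 1) (hii : θ₀ i = θ₀ i') (v : Fin N → Fin N → ℂ)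
    (k : Fin N) :
    leading H θ₀ (Function.update v k (Pi.single i 1))
      = leading H θ₀ (Function.update v k (Pi.single i' 1)) := by
  rw [← sub_eq_zero, ← ContinuousMultilinearMap.map_update_sub]
  obtain ⟨M, rfl⟩ : ∃ M, N = M + 1 := ⟨N - 1, by have := k.isLt; omega⟩
  refine apply_eq_zero_of_translation (leading H θ₀) (leading_comp_perm hH.analytic)
    (τ := Pi.single i 1 - Pi.single i' 1) (fun ξ c => ?_) _ k (by simp)
  have h1 := leading_translation hS hF hθ hH hi hii ξ (c • Pi.single i 1)
  have h2 := leading_translation hS hF hθ hH hi hii (ξ + c • (Pi.single i 1 - Pi.single i' 1)) 0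
  rw [h1, h2]
  congr 1
  ext _ a
  have hne : i ≠ i' := fun h => by rw [h] at hi; omega
  simp only [Pi.add_apply, Function.comp, Pi.sub_apply, Pi.smul_apply, Pi.zero_apply, smul_eq_mul]
  by_cases ha : a = i
  · subst ha; simp [hne.symm]
  · by_cases ha' : a = i'
    · subst ha'; simp [hne, hne.symm]
    · simp [Equiv.swap_apply_of_ne_of_ne ha ha', Pi.single_eq_of_ne ha, Pi.single_eq_of_ne ha']

/-- The leading term does not distinguish coinciding rapidities. -/
theorem leading_single_congr {l : Fin N → ℕ} (hl : Monotone l) {θ : ℕ → ℂ}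
    (hθ : Admissible S (fun i => θ (l i)))
    {H : (Fin N → ℂ) × (Fin N → ℂ) → ℂ} (hH : IsRegularPart F (fun i => θ (l i)) H)
    {c c' : Fin N → Fin N} (hc : ∀ k, l (c k) = l (c' k)) :
    leading H (fun i => θ (l i)) (fun k => Pi.single (c k) 1)
      = leading H (fun i => θ (l i)) (fun k => Pi.single (c' k) 1) := by
  set D := leading H (fun i => θ (l i)) with hD
  have h1 : ∀ (d : ℕ) (i i' : Fin N), (i' : ℕ) = i + d → l i = l i' → ∀ v k,
      D (Function.update v k (Pi.single i 1)) = D (Function.update v k (Pi.single i' 1)) := by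
    intro d
    induction d with
    | zero => intro i i' h _ v k; rw [Fin.ext h]
    | succ d ih =>
      intro i i' h hl' v k
      have hlt : (i : ℕ) + d < N := by have := i'.isLt; omega
      have e1 : l i ≤ l ⟨i + d, hlt⟩ := hl (by simp [Fin.le_def])
      have e2 : l ⟨i + d, hlt⟩ ≤ l i' := hl (by simp [Fin.le_def, h])
      have e3 : l i = l ⟨i + d, hlt⟩ := le_antisymm e1 (e2.trans hl'.ge)
      rw [ih i ⟨i + d, hlt⟩ rfl e3 v k]
      exact leading_single_adjacent hS hF hθ hH (by simp [h]; ring)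
        (by show θ (l _) = θ (l _); rw [← e3, hl']) v k
  have h2 : ∀ (i i' : Fin N), l i = l i' → ∀ v k,
      D (Function.update v k (Pi.single i 1)) = D (Function.update v k (Pi.single i' 1)) := by
    intro i i' hl' v k
    rcases le_total (i : ℕ) i' with h | h
    · exact h1 (i' - i) i i' (by omega) hl' v k
    · exact (h1 (i - i') i' i (by omega) hl'.symm v k).symm
  have h3 : ∀ s : Finset (Fin N), D (fun k => Pi.single (c k) 1)
      = D (fun k => Pi.single (if k ∈ s then c' k else c k) 1) := by
    intro s
    induction s using Finset.induction_on with
    | empty => simp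
    | insert a s ha ih =>
      rw [ih]
      set v : Fin N → Fin N → ℂ := fun k => Pi.single (if k ∈ s then c' k else c k) 1 with hv
      have e1 : v = Function.update v a (Pi.single (c a) 1) := by
        rw [eq_comm, Function.update_eq_self_iff, hv]; simp [ha]
      have e2 : (fun k => Pi.single (if k ∈ insert a s then c' k else c k) 1)
          = Function.update v a (Pi.single (c' a) (1 : ℂ)) := by
        ext1 k
        by_cases hk : k = a
        · subst hk; simp
        · rw [Function.update_of_ne hk, hv]; simp [hk]
      rw [e2, e1, Function.update_idem]
      exact h2 _ _ (hc a) v a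
  rw [h3 Finset.univ]; simp

end

/-! ### Coefficients labelled by multisets -/

section

theorem exists_perm_of_map_eq {N : ℕ} {f g : Fin N → ℕ}
    (h : Finset.univ.val.map f = Finset.univ.val.map g) : ∃ σ : Equiv.Perm (Fin N), f = g ∘ σ := by
  have hc : ∀ (f : Fin N → ℕ) (c : ℕ),
      Fintype.card {a // f a = c} = (Finset.univ.val.map f).count c := by
    intro f c
    rw [Fintype.card_subtype, Multiset.count_map]
    simp only [Finset.card_def, Finset.filter_val, eq_comm]
  have e : ∀ c, Nonempty ({a // f a = c} ≃ {b // g b = c}) := fun c =>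
    ⟨Fintype.equivOfCardEq (by rw [hc, hc, h])⟩
  refine ⟨Equiv.ofFiberEquiv fun c => (e c).some, ?_⟩
  ext a
  exact (Equiv.ofFiberEquiv_map _ a).symm

theorem eq_of_monotone_of_map_eq {N : ℕ} {f g : Fin N → ℕ} (hf : Monotone f) (hg : Monotone g)
    (h : Finset.univ.val.map f = Finset.univ.val.map g) : f = g := by
  obtain ⟨σ, rfl⟩ := exists_perm_of_map_eq h
  exact Tuple.unique_monotone (f := g) (τ := 1) hf (by simpa using hg)

theorem map_succAbove {N : ℕ} (b : Fin (N + 1) → ℕ) (k : Fin (N + 1)) :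
    Finset.univ.val.map (b ∘ k.succAbove) = (Finset.univ.val.map b).erase (b k) := by
  rw [Fin.univ_succAbove N k]
  simp [Function.comp_def]

/-- The order of the group permuting equal members of a multiset. -/
noncomputable def symFactor (M : Multiset ℕ) : ℂ := ∏ x ∈ M.toFinset, ((M.count x).factorial : ℂ)

theorem symFactor_ne_zero (M : Multiset ℕ) : symFactor M ≠ 0 :=
  Finset.prod_ne_zero_iff.2 fun _ _ => by exact_mod_cast Nat.factorial_ne_zero _

theorem symFactor_erase {M : Multiset ℕ} {x : ℕ} (hx : x ∈ M) :
    symFactor M = M.count x * symFactor (M.erase x) := by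
  have h1 : symFactor (M.erase x) = ∏ y ∈ M.toFinset, (((M.erase x).count y).factorial : ℂ) := by
    refine Finset.prod_subset (Multiset.toFinset_subset.2 (Multiset.erase_subset _ _)) ?_
    intro y _ hy
    rw [Multiset.mem_toFinset] at hy
    rw [Multiset.count_eq_zero_of_notMem hy]; simp
  have hx' := Multiset.mem_toFinset.2 hx
  rw [h1, symFactor, ← Finset.mul_prod_erase _ _ hx', ← Finset.mul_prod_erase _ _ hx', ← mul_assoc]
  congr 1
  · rw [Multiset.count_erase_self]
    have := Multiset.count_pos.2 hx
    obtain ⟨d, hd⟩ : ∃ d, M.count x = d + 1 := ⟨M.count x - 1, by omega⟩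
    rw [hd, Nat.factorial_succ]; simp
  · refine Finset.prod_congr rfl fun y hy => ?_
    rw [Multiset.count_erase_of_ne (Finset.ne_of_mem_erase hy)]

theorem symFactor_eq_one {M : Multiset ℕ} (hM : M.Nodup) : symFactor M = 1 :=
  Finset.prod_eq_one fun x hx => by
    rw [Multiset.count_eq_one_of_mem hM (Multiset.mem_toFinset.1 hx)]; simp

open Classical in
/-- A regular part of the form factor at `θ₀`. -/
noncomputable def regularPart (F : (n : ℕ) → (Fin n → ℂ) → ℂ) {N : ℕ} (θ₀ : Fin N → ℂ) :
    (Fin N → ℂ) × (Fin N → ℂ) → ℂ :=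
  if h : ∃ H, IsRegularPart F θ₀ H then h.choose else 0

open Classical in
/-- The coefficient of the leading term at the rapidities labelled by `l` in the directions
labelled by `b`. -/
noncomputable def leadingLabel (F : (n : ℕ) → (Fin n → ℂ) → ℂ) (θ : ℕ → ℂ) {N : ℕ}
    (l b : Fin N → ℕ) : ℂ :=
  if h : ∃ c : Fin N → Fin N, l ∘ c = b then
    leading (regularPart F fun i => θ (l i)) (fun i => θ (l i)) fun k => Pi.single (h.choose k) 1
  else 0

open Classical in
/-- `leadingLabel` as a function of multisets of labels. -/
noncomputable def leadingCoeff (F : (n : ℕ) → (Fin n → ℂ) → ℂ) (θ : ℕ → ℂ)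
    (A M : Multiset ℕ) : ℂ :=
  if h : ∃ (N : ℕ) (p : (Fin N → ℕ) × (Fin N → ℕ)), Monotone p.1 ∧
      Finset.univ.val.map p.1 = A ∧ Finset.univ.val.map p.2 = M then
    leadingLabel F θ h.choose_spec.choose.1 h.choose_spec.choose.2 / symFactor M
  else 0

variable {S : ℂ → ℂ} (hS : IsScatteringMatrix S) {N : ℕ}
  {F : (n : ℕ) → (Fin n → ℂ) → ℂ} (hF : IsFormFactor S F)
include hS hF

theorem isRegularPart_regularPart {θ₀ : Fin N → ℂ} (hθ : Admissible S θ₀) :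
    IsRegularPart F θ₀ (regularPart F θ₀) := by
  have h := exists_isRegularPart hS hF hθ
  rw [regularPart, dif_pos h]
  exact h.choose_spec

theorem leadingLabel_eq {l : Fin N → ℕ} (hl : Monotone l) {θ : ℕ → ℂ}
    (hθ : Admissible S (fun i => θ (l i))) (c : Fin N → Fin N) :
    leadingLabel F θ l (l ∘ c) = leading (regularPart F fun i => θ (l i)) (fun i => θ (l i))
      fun k => Pi.single (c k) 1 := by
  have h : ∃ c' : Fin N → Fin N, l ∘ c' = l ∘ c := ⟨c, rfl⟩
  rw [leadingLabel, dif_pos h]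
  exact leading_single_congr hS hF hl hθ (isRegularPart_regularPart hS hF hθ)
    fun k => congrFun h.choose_spec k

theorem leadingLabel_perm {l : Fin N → ℕ} (hl : Monotone l) {θ : ℕ → ℂ}
    (hθ : Admissible S (fun i => θ (l i))) (b : Fin N → ℕ) (σ : Equiv.Perm (Fin N)) :
    leadingLabel F θ l (b ∘ σ) = leadingLabel F θ l b := by
  by_cases h : ∃ c : Fin N → Fin N, l ∘ c = b
  · obtain ⟨c, rfl⟩ := h
    rw [Function.comp_assoc, leadingLabel_eq hS hF hl hθ, leadingLabel_eq hS hF hl hθ]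
    exact leading_comp_perm (isRegularPart_regularPart hS hF hθ).analytic
      (fun k => Pi.single (c k) 1) σ
  · have h' : ¬ ∃ c : Fin N → Fin N, l ∘ c = b ∘ σ := by
      rintro ⟨c, hc⟩
      refine h ⟨c ∘ σ.symm, ?_⟩
      rw [← Function.comp_assoc, hc]; ext; simp
    rw [leadingLabel, leadingLabel, dif_neg h, dif_neg h']

theorem leadingLabel_succ {l : Fin (N + 1) → ℕ} (hl : Monotone l) {θ : ℕ → ℂ}
    (hθ : Admissible S (fun i => θ (l i))) (p : Fin (N + 1)) (d : Fin (N + 1) → Fin N) :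
    leadingLabel F θ l (l ∘ p.succAbove ∘ d) = ∑ k, phi S (θ (l p) - θ (l (p.succAbove (d k)))) *
      leadingLabel F θ (l ∘ p.succAbove) ((l ∘ p.succAbove ∘ d) ∘ k.succAbove) := by
  have h := leading_insertZero hS hF hθ p (isRegularPart_regularPart hS hF hθ)
    (isRegularPart_regularPart hS hF (hθ.succAbove p)) (fun k => Pi.single (d k) 1)
  rw [leadingLabel_eq hS hF hl hθ (p.succAbove ∘ d), leading]
  simp only [insertZero_single] at h
  refine h.trans (Finset.sum_congr rfl fun k _ => ?_)
  have hl' : Monotone (l ∘ p.succAbove) := hl.comp (Fin.strictMono_succAbove p).monotone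
  have e : (l ∘ p.succAbove ∘ d) ∘ k.succAbove = (l ∘ p.succAbove) ∘ (d ∘ k.succAbove) := rfl
  rw [e, leadingLabel_eq hS hF hl' (hθ.succAbove p), leading, phiForm_apply]
  congr 1
  rw [Finset.sum_eq_single (d k)]
  · simp
  · intro j _ hj; simp [hj]
  · simp

theorem leadingCoeff_eq {l : Fin N → ℕ} (hl : Monotone l) {θ : ℕ → ℂ}
    (hθ : Admissible S (fun i => θ (l i))) (b : Fin N → ℕ) :
    leadingCoeff F θ (Finset.univ.val.map l) (Finset.univ.val.map b)
      = leadingLabel F θ l b / symFactor (Finset.univ.val.map b) := by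
  have h : ∃ (N' : ℕ) (p : (Fin N' → ℕ) × (Fin N' → ℕ)), Monotone p.1 ∧
      Finset.univ.val.map p.1 = Finset.univ.val.map l ∧
      Finset.univ.val.map p.2 = Finset.univ.val.map b := ⟨N, (l, b), hl, rfl, rfl⟩
  rw [leadingCoeff, dif_pos h]
  congr 1
  generalize_proofs hp
  have h1 := hp.choose_spec
  set p := hp.choose
  clear_value p
  have hN : h.choose = N := by
    have := congrArg Multiset.card h1.2.1
    simpa using this
  revert p
  generalize h.choose = N' at *
  subst hN
  intro p h1
  obtain ⟨σ, hσ⟩ := exists_perm_of_map_eq h1.2.2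
  rw [hσ, eq_of_monotone_of_map_eq h1.1 hl h1.2.1, leadingLabel_perm hS hF hl hθ]

omit hS hF in
theorem exists_monotone_map (A : Multiset ℕ) (hN : A.card = N) :
    ∃ l : Fin N → ℕ, Monotone l ∧ Finset.univ.val.map l = A := by
  have hlen : A.sort.length = N := by simp [hN]
  subst hlen
  refine ⟨A.sort.get, (Multiset.pairwise_sort A (· ≤ ·)).sortedLE.monotone_get, ?_⟩
  rw [Fin.univ_val_map, List.ofFn_get, Multiset.sort_eq]

/-- Rapidities labelled by members of `A` are admissible. -/
def AdmissibleLabels (S : ℂ → ℂ) (θ : ℕ → ℂ) (A : Multiset ℕ) : Prop :=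
  ∀ a ∈ A, ∀ b ∈ A, S (θ a - θ b) ≠ 0 ∧ (θ a ≠ θ b → Complex.sinh (θ a - θ b) ≠ 0)

omit hS hF in
theorem AdmissibleLabels.mono {θ : ℕ → ℂ} {A A' : Multiset ℕ} (h : AdmissibleLabels S θ A)
    (hA : A' ⊆ A) : AdmissibleLabels S θ A' := fun a ha b hb => h a (hA ha) b (hA hb)

omit hS hF in
theorem AdmissibleLabels.admissible {θ : ℕ → ℂ} {l : Fin N → ℕ}
    (h : AdmissibleLabels S θ (Finset.univ.val.map l)) : Admissible S (fun i => θ (l i)) :=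
  fun i j => h _ (Multiset.mem_map_of_mem l (Finset.mem_univ i)) _
    (Multiset.mem_map_of_mem l (Finset.mem_univ j))

theorem leadingCoeff_succ {θ : ℕ → ℂ} {A M : Multiset ℕ} (hA : AdmissibleLabels S θ A)
    (hcard : M.card = A.card) {a : ℕ} (ha : a ∈ A) (hM : M ⊆ A.erase a) :
    leadingCoeff F θ A M = ∑ x ∈ M.toFinset, phi S (θ a - θ x) *
      leadingCoeff F θ (A.erase a) (M.erase x) := by
  obtain ⟨N, hN⟩ : ∃ N, A.card = N + 1 :=
    ⟨A.card - 1, by have := Multiset.card_pos_iff_exists_mem.2 ⟨a, ha⟩; omega⟩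
  obtain ⟨l, hl, rfl⟩ := exists_monotone_map A hN
  obtain ⟨b, -, rfl⟩ := exists_monotone_map M (hcard.trans hN)
  obtain ⟨p, -, rfl⟩ := Multiset.mem_map.1 ha
  rw [← map_succAbove] at hM ⊢
  have hd : ∀ k, ∃ j : Fin N, l (p.succAbove j) = b k := fun k => by
    obtain ⟨j, -, hj⟩ := Multiset.mem_map.1 (hM (Multiset.mem_map_of_mem b (Finset.mem_univ k)))
    exact ⟨j, hj⟩
  choose d hd using hd
  have hb : b = l ∘ p.succAbove ∘ d := by ext k; exact (hd k).symm
  have hl' : Monotone (l ∘ p.succAbove) := hl.comp (Fin.strictMono_succAbove p).monotone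
  have hadm := hA.admissible
  have h1 : leadingLabel F θ l b = ∑ k, phi S (θ (l p) - θ (b k)) *
      (leadingCoeff F θ (Finset.univ.val.map (l ∘ p.succAbove))
        ((Finset.univ.val.map b).erase (b k)) *
        symFactor ((Finset.univ.val.map b).erase (b k))) := by
    rw [hb, leadingLabel_succ hS hF hl hadm p d, ← hb]
    refine Finset.sum_congr rfl fun k _ => ?_
    rw [hd, ← map_succAbove, leadingCoeff_eq hS hF hl' (hadm.succAbove p),
      div_mul_cancel₀ _ (symFactor_ne_zero _)]
  rw [leadingCoeff_eq hS hF hl hadm, h1, div_eq_iff (symFactor_ne_zero _), Finset.sum_mul]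
  set M := Finset.univ.val.map b with hMdef
  have h2 := Finset.sum_multiset_map_count M fun x => phi S (θ (l p) - θ x) *
    (leadingCoeff F θ (Finset.univ.val.map (l ∘ p.succAbove)) (M.erase x) *
      symFactor (M.erase x))
  rw [hMdef, Multiset.map_map, ← hMdef] at h2
  refine h2.trans (Finset.sum_congr rfl fun x hx => ?_)
  rw [symFactor_erase (Multiset.mem_toFinset.1 hx), nsmul_eq_mul]
  ring

omit hS hF in
theorem map_get (L : List ℕ) : Finset.univ.val.map L.get = (L : Multiset ℕ) := by
  rw [Fin.univ_val_map, List.ofFn_get]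

theorem hasDegenerateValue_rapidities {θ : ℕ → ℂ} {L : List ℕ} (hL : L.SortedLE)
    (hA : AdmissibleLabels S θ L) :
    HasDegenerateValue F (rapidities θ L) (symFactor L * leadingCoeff F θ L L) := by
  rw [← map_get L] at hA
  have hadm := hA.admissible
  have hl := hL.monotone_get
  have h1 := leadingCoeff_eq hS hF hl hadm L.get
  rw [map_get] at h1
  rw [h1, mul_div_cancel₀ _ (symFactor_ne_zero _)]
  have h2 := leadingLabel_eq hS hF hl hadm id
  rw [Function.comp_id] at h2
  rw [h2]
  exact hasDegenerateValue_leading hS hF hadm (isRegularPart_regularPart hS hF hadm)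

theorem connected_rapidities {θ : ℕ → ℂ} {L : List ℕ} (hL : L.SortedLE)
    (hA : AdmissibleLabels S θ L) (hnd : Function.Injective (rapidities θ L)) :
    connected F (rapidities θ L) = leadingCoeff F θ L L := by
  have hnd' : L.Nodup := List.nodup_iff_injective_get.2 fun i j h => hnd (congrArg θ h)
  have hs : symFactor (L : Multiset ℕ) = 1 := symFactor_eq_one (by simpa using hnd')
  rw [← map_get L] at hA
  have hadm := hA.admissible
  have hl := hL.monotone_get
  have h1 := leadingCoeff_eq hS hF hl hadm L.get
  rw [map_get, hs, div_one] at h1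
  have h2 := leadingLabel_eq hS hF hl hadm id
  rw [Function.comp_id] at h2
  rw [h1, h2]
  exact (eventually_connected_eq hS hF hadm
    (isRegularPart_regularPart hS hF hadm)).self_of_nhds hnd

end

/-! ### Sums over sequences -/

section

variable (S : ℂ → ℂ) (θ : ℕ → ℂ)

open Classical in
/-- The sum of `[s]_φ` over the sequences made of the members of `C` that start with `b` and
satisfy `P`. -/
noncomputable def bracketSum (P : List ℕ → Prop) (b : ℕ) (C : Multiset ℕ) : ℂ :=
  ∑ s ∈ C.lists.toFinset.filter (fun s => s.head? = some b ∧ P s), bracket S θ s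

/-- The sum of `[s]_φ` over `S_{b,r}(C)`. -/
noncomputable def pathSum (b r : ℕ) (C : Multiset ℕ) : ℂ := ∑ s ∈ paths b r C, bracket S θ s

theorem bracketSum_getLast (b r : ℕ) (C : Multiset ℕ) :
    bracketSum S θ (fun s => s.getLast? = some r) b C = pathSum S θ b r C := by
  classical
  rw [bracketSum, pathSum, paths]
  congr

variable {S θ}

theorem mem_lists_filter {P : List ℕ → Prop} [DecidablePred P] {b : ℕ} {C : Multiset ℕ}
    {s : List ℕ} : s ∈ C.lists.toFinset.filter (fun s => s.head? = some b ∧ P s) ↔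
      (s : Multiset ℕ) = C ∧ s.head? = some b ∧ P s := by
  rw [Finset.mem_filter, Multiset.mem_toFinset, Multiset.mem_lists_iff]
  simp [eq_comm]

theorem bracketSum_of_forall_not {P : List ℕ → Prop} {b : ℕ} {C : Multiset ℕ}
    (h : ∀ s : List ℕ, (s : Multiset ℕ) = C → s.head? = some b → ¬ P s) :
    bracketSum S θ P b C = 0 := by
  classical
  rw [bracketSum, Finset.sum_eq_zero]
  intro s hs
  rw [mem_lists_filter] at hs
  exact absurd hs.2.2 (h s hs.1 hs.2.1)

theorem bracketSum_of_notMem {P : List ℕ → Prop} {b : ℕ} {C : Multiset ℕ} (h : b ∉ C) :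
    bracketSum S θ P b C = 0 := by
  refine bracketSum_of_forall_not fun s hs hb => absurd ?_ h
  rw [← hs]
  exact Multiset.mem_coe.2 (List.mem_of_mem_head? hb)

theorem bracketSum_cons {P Q : List ℕ → Prop} {b : ℕ} {C : Multiset ℕ} (hC : C ≠ 0)
    (hPQ : ∀ b' s, ((b' :: s : List ℕ) : Multiset ℕ) = C → (P (b :: b' :: s) ↔ Q (b' :: s))) :
    bracketSum S θ P b (b ::ₘ C) = ∑ b' ∈ C.toFinset,
      phi S (θ b - θ b') * bracketSum S θ Q b' C := by
  classical
  simp only [bracketSum, Finset.mul_sum]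
  rw [Finset.sum_sigma']
  symm
  refine Finset.sum_bij' (fun x _ => b :: x.2) (fun s _ => ⟨s.tail.headD 0, s.tail⟩) ?_ ?_ ?_ ?_ ?_
  · rintro ⟨b', s⟩ hs
    rw [Finset.mem_sigma, mem_lists_filter] at hs
    obtain ⟨-, h1, h2, h3⟩ := hs
    dsimp only at h1 h2 h3
    rw [mem_lists_filter]
    obtain ⟨s, rfl⟩ := List.head?_eq_some_iff.1 h2
    exact ⟨by rw [← h1]; rfl, rfl, (hPQ _ _ h1).2 h3⟩
  · intro s hs
    rw [mem_lists_filter] at hs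
    obtain ⟨h1, h2, h3⟩ := hs
    obtain ⟨s, rfl⟩ := List.head?_eq_some_iff.1 h2
    rw [← Multiset.cons_coe, Multiset.cons_inj_right] at h1
    match s, h1, h3 with
    | [], h1, _ => exact absurd h1.symm hC
    | b' :: s, h1, h3 =>
      rw [Finset.mem_sigma, mem_lists_filter]
      refine ⟨?_, h1, rfl, (hPQ _ _ h1).1 h3⟩
      rw [Multiset.mem_toFinset, ← h1]; simp
  · rintro ⟨b', s⟩ hs
    rw [Finset.mem_sigma, mem_lists_filter] at hs
    obtain ⟨-, -, h2, -⟩ := hs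
    dsimp only at h2
    obtain ⟨s, rfl⟩ := List.head?_eq_some_iff.1 h2
    rfl
  · intro s hs
    rw [mem_lists_filter] at hs
    obtain ⟨s, rfl⟩ := List.head?_eq_some_iff.1 hs.2.1
    rfl
  · rintro ⟨b', s⟩ hs
    rw [Finset.mem_sigma, mem_lists_filter] at hs
    obtain ⟨-, -, h2, -⟩ := hs
    dsimp only at h2
    obtain ⟨s, rfl⟩ := List.head?_eq_some_iff.1 h2
    rfl

theorem pathSum_of_start_notMem {b r : ℕ} {C : Multiset ℕ} (h : b ∉ C) :
    pathSum S θ b r C = 0 := by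
  rw [← bracketSum_getLast]; exact bracketSum_of_notMem h

theorem pathSum_of_end_notMem {b r : ℕ} {C : Multiset ℕ} (h : r ∉ C) :
    pathSum S θ b r C = 0 := by
  rw [← bracketSum_getLast]
  refine bracketSum_of_forall_not fun s hs _ hr => h ?_
  rw [← hs]
  exact Multiset.mem_coe.2 (List.mem_of_mem_getLast? hr)

theorem pathSum_cons {b r : ℕ} {C : Multiset ℕ} (hC : C ≠ 0) :
    pathSum S θ b r (b ::ₘ C) = ∑ b' ∈ C.toFinset, phi S (θ b - θ b') * pathSum S θ b' r C := by
  simp only [← bracketSum_getLast]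
  exact bracketSum_cons hC fun b' s _ => by rw [List.getLast?_cons_cons]

theorem pathSum_singleton (r : ℕ) : pathSum S θ r r {r} = 1 := by
  have : paths r r {r} = {[r]} := by
    ext s
    rw [paths, mem_lists_filter, Finset.mem_singleton]
    constructor
    · rintro ⟨h, -⟩
      exact Multiset.coe_eq_singleton.1 h
    · rintro rfl; simp
  rw [pathSum, this, Finset.sum_singleton, bracket]

/-- The submultisets that contain `r` exactly once. -/
def subOne (r : ℕ) (A : Multiset ℕ) : Finset (Multiset ℕ) :=
  A.powerset.toFinset.filter fun V => V.count r = 1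

theorem mem_subOne {r : ℕ} {A V : Multiset ℕ} : V ∈ subOne r A ↔ V ≤ A ∧ V.count r = 1 := by
  simp [subOne]

/-- Resolution of a first-step recursion by the last occurrence of `r`. -/
theorem eq_sum_subOne_of_recursion {K : ℕ → Multiset ℕ → ℂ} {r : ℕ} {A₀ : Multiset ℕ}
    (hK : ∀ b A, b ::ₘ A ≤ A₀ → r ∈ A →
      K b (b ::ₘ A) = ∑ b' ∈ A.toFinset, phi S (θ b - θ b') * K b' A)
    {A : Multiset ℕ} (hA : A ≤ A₀) {b : ℕ} (hb : b ∈ A) (hr : r ∈ A) :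
    K b A = ∑ V ∈ subOne r A, pathSum S θ b r (A - V + {r}) * K r V := by
  induction A using Multiset.strongInductionOn generalizing b with
  | ih A ih =>
  obtain ⟨A, rfl⟩ := Multiset.exists_cons_of_mem hb
  by_cases hrA : r ∈ A
  · have hle : A ≤ b ::ₘ A := Multiset.le_cons_self A b
    rw [hK b A hA hrA]
    have h1 : ∀ b' ∈ A.toFinset, phi S (θ b - θ b') * K b' A
        = ∑ V ∈ subOne r A, phi S (θ b - θ b') * (pathSum S θ b' r (A - V + {r}) * K r V) := by
      intro b' hb'
      rw [ih A (Multiset.lt_cons_self A b) (hle.trans hA) (Multiset.mem_toFinset.1 hb') hrA,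
        Finset.mul_sum]
    rw [Finset.sum_congr rfl h1, Finset.sum_comm]
    have h2 : subOne r A ⊆ subOne r (b ::ₘ A) := fun V hV => by
      rw [mem_subOne] at hV ⊢; exact ⟨hV.1.trans hle, hV.2⟩
    rw [← Finset.sum_subset h2]
    · refine Finset.sum_congr rfl fun V hV => ?_
      rw [mem_subOne] at hV
      have e : b ::ₘ A - V + {r} = b ::ₘ (A - V + {r}) := by
        rw [Multiset.cons_sub_of_le _ hV.1, Multiset.cons_add]
      have hne : A - V + {r} ≠ 0 := by simp
      rw [e, pathSum_cons hne, Finset.sum_mul]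
      symm
      refine Finset.sum_subset_zero_on_sdiff ?_ ?_ ?_
      · intro x hx
        rw [Multiset.mem_toFinset, Multiset.mem_add, Multiset.mem_singleton] at hx
        rw [Multiset.mem_toFinset]
        rcases hx with hx | rfl
        · exact Multiset.mem_of_le (Multiset.sub_le_self _ _) hx
        · exact hrA
      · intro x hx
        rw [Finset.mem_sdiff, Multiset.mem_toFinset, Multiset.mem_toFinset] at hx
        rw [pathSum_of_start_notMem hx.2]; ring
      · intro x _; ring
    · intro V hV hV'
      rw [mem_subOne] at hV hV'
      have hVA : ¬ V ≤ A := fun h => hV' ⟨h, hV.2⟩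
      rw [pathSum_of_start_notMem, zero_mul]
      intro hmem
      rw [Multiset.mem_add, Multiset.mem_singleton] at hmem
      refine hVA (Multiset.le_iff_count.2 fun x => ?_)
      have h3 := Multiset.le_iff_count.1 hV.1 x
      by_cases hx : x = b
      · subst hx
        rcases hmem with hmem | rfl
        · have h4 := Multiset.count_pos.2 hmem
          rw [Multiset.count_sub, Multiset.count_cons_self] at h4
          omega
        · have := Multiset.count_pos.2 hrA
          omega
      · rwa [Multiset.count_cons_of_ne hx] at h3
  · obtain rfl : r = b := by
      rcases Multiset.mem_cons.1 hr with h | h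
      · exact h
      · exact absurd h hrA
    rw [Finset.sum_eq_single (r ::ₘ A)]
    · simp [pathSum_singleton]
    · intro V hV hne
      rw [mem_subOne] at hV
      obtain ⟨V, rfl⟩ := Multiset.exists_cons_of_mem (a := r) (s := V)
        (Multiset.count_pos.1 (by omega))
      have hVA : V ≤ A := (Multiset.cons_le_cons_iff r).1 hV.1
      have h0 : A - V ≠ 0 := fun h => hne (by
        rw [tsub_eq_zero_iff_le] at h; rw [le_antisymm h hVA])
      have e : r ::ₘ A - r ::ₘ V + {r} = r ::ₘ (A - V) := by
        rw [Multiset.sub_cons, Multiset.erase_cons_head, add_comm, Multiset.singleton_add]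
      rw [e, pathSum_cons h0, Finset.sum_eq_zero, zero_mul]
      intro x _
      rw [pathSum_of_end_notMem, mul_zero]
      exact fun h => hrA (Multiset.mem_of_le (Multiset.sub_le_self _ _) h)
    · intro h
      refine absurd (mem_subOne.2 ⟨le_rfl, ?_⟩) h
      rw [Multiset.count_cons_self, Multiset.count_eq_zero_of_notMem hrA]

/-- Splitting off the part of a sequence between the first and the last `r`. -/
theorem pathSum_eq_sum_subOne (b q r : ℕ) {C : Multiset ℕ} (hr : r ∈ C) :
    pathSum S θ b q C
      = ∑ V ∈ subOne r C, pathSum S θ r r (C - V + {r}) * pathSum S θ b q V := by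
  induction C using Multiset.strongInductionOn generalizing b with
  | ih C ih =>
  by_cases hbr : b = r
  · subst hbr
    refine eq_sum_subOne_of_recursion (K := fun b => pathSum S θ b q) (A₀ := C) ?_ le_rfl hr hr
    intro b' A _ hA
    exact pathSum_cons (fun h => by simp [h] at hA)
  by_cases hb : b ∈ C
  · obtain ⟨C, rfl⟩ := Multiset.exists_cons_of_mem hb
    have hrC : r ∈ C := (Multiset.mem_cons.1 hr).resolve_left fun h => hbr h.symm
    rw [pathSum_cons (fun h => by simp [h] at hrC)]
    have h1 : ∀ b' ∈ C.toFinset, phi S (θ b - θ b') * pathSum S θ b' q C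
        = ∑ V ∈ subOne r C, pathSum S θ r r (C - V + {r}) *
          (phi S (θ b - θ b') * pathSum S θ b' q V) := by
      intro b' _
      rw [ih C (Multiset.lt_cons_self C b) b' hrC, Finset.mul_sum]
      exact Finset.sum_congr rfl fun V _ => by ring
    rw [Finset.sum_congr rfl h1, Finset.sum_comm]
    have h2 : (subOne r C).image (fun V => b ::ₘ V) ⊆ subOne r (b ::ₘ C) := fun V' hV' => by
      obtain ⟨V, hV, rfl⟩ := Finset.mem_image.1 hV'
      rw [mem_subOne] at hV ⊢
      exact ⟨(Multiset.cons_le_cons_iff b).2 hV.1, by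
        simpa [Multiset.count_cons_of_ne (Ne.symm hbr)] using hV.2⟩
    rw [← Finset.sum_subset h2, Finset.sum_image fun V _ V' _ h => (Multiset.cons_inj_right b).1 h]
    · refine Finset.sum_congr rfl fun V hV => ?_
      rw [mem_subOne] at hV
      have hrV : r ∈ V := Multiset.count_pos.1 (by omega)
      rw [pathSum_cons (fun h => by simp [h] at hrV), Multiset.sub_cons,
        Multiset.erase_cons_head, ← Finset.mul_sum]
      congr 1
      symm
      refine Finset.sum_subset (Multiset.toFinset_subset.2 (Multiset.subset_of_le hV.1)) ?_
      intro x _ hx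
      rw [Multiset.mem_toFinset] at hx
      rw [pathSum_of_start_notMem hx, mul_zero]
    · intro V hV hV'
      rw [pathSum_of_start_notMem (b := b), mul_zero]
      intro hbV
      obtain ⟨V, rfl⟩ := Multiset.exists_cons_of_mem hbV
      rw [mem_subOne] at hV
      refine hV' (Finset.mem_image.2
        ⟨V, mem_subOne.2 ⟨(Multiset.cons_le_cons_iff b).1 hV.1, ?_⟩, rfl⟩)
      simpa [Multiset.count_cons_of_ne (Ne.symm hbr)] using hV.2
  · rw [pathSum_of_start_notMem hb, Finset.sum_eq_zero]
    intro V hV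
    rw [mem_subOne] at hV
    rw [pathSum_of_start_notMem (b := b) (fun h => hb (Multiset.mem_of_le hV.1 h)), mul_zero]

/-- The sum over `S̃_{1,2}` in terms of the part up to the last `1`. -/
theorem sum_paths'_eq {C : Multiset ℕ} (h1 : 1 ∈ C) :
    ∑ s ∈ paths' C, bracket S θ s = phi S (θ 1 - θ 2) *
      ∑ V ∈ subOne 1 C, pathSum S θ 1 1 (C - V + {1}) * pathSum S θ 2 2 (V.erase 1) := by
  classical
  set P : List ℕ → Prop := fun s => s.getLast? = some 2 ∧
    ∃ u v : List ℕ, s = u ++ 1 :: 2 :: v ∧ 1 ∉ v with hP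
  have e : ∑ s ∈ paths' C, bracket S θ s = bracketSum S θ P 1 C := by
    rw [bracketSum, paths', paths, Finset.filter_filter]
    refine Finset.sum_congr (Finset.ext fun s => ?_) fun _ _ => rfl
    simp only [Finset.mem_filter, hP, and_assoc]
  have hstep : ∀ b b' s, 1 ∈ b' :: s → (P (b :: b' :: s) ↔ P (b' :: s)) := by
    intro b b' s h
    simp only [hP, List.getLast?_cons_cons]
    refine and_congr_right fun _ => ⟨?_, ?_⟩
    · rintro ⟨u, v, huv, hv⟩
      cases u with
      | nil =>
        simp only [List.nil_append, List.cons.injEq] at huv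
        obtain ⟨-, rfl, rfl⟩ := huv
        exact absurd h (by simp [hv])
      | cons x u =>
        simp only [List.cons_append, List.cons.injEq] at huv
        exact ⟨u, v, huv.2, hv⟩
    · rintro ⟨u, v, huv, hv⟩
      exact ⟨b :: u, v, by rw [huv]; rfl, hv⟩
  rw [e, eq_sum_subOne_of_recursion (K := bracketSum S θ P) (A₀ := C) ?_ le_rfl h1 h1,
    Finset.mul_sum]
  · refine Finset.sum_congr rfl fun V hV => ?_
    rw [mem_subOne] at hV
    obtain ⟨V, rfl⟩ := Multiset.exists_cons_of_mem (a := 1) (s := V)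
      (Multiset.count_pos.1 (by omega))
    have h1V : 1 ∉ V := fun h => by
      have := Multiset.count_pos.2 h
      have := hV.2
      rw [Multiset.count_cons_self] at this
      omega
    have e2 : bracketSum S θ P 1 (1 ::ₘ V) = phi S (θ 1 - θ 2) * pathSum S θ 2 2 V := by
      by_cases h2 : 2 ∈ V
      · rw [bracketSum_cons (Q := fun s => s.head? = some 2 ∧ s.getLast? = some 2)
          (fun h => by simp [h] at h2), Finset.sum_eq_single 2]
        · rw [← bracketSum_getLast, bracketSum, bracketSum]
          congr 1
          refine Finset.sum_congr (Finset.ext fun s => ?_) fun _ _ => rfl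
          simp only [Finset.mem_filter]
          tauto
        · intro x _ hx
          rw [bracketSum_of_forall_not, mul_zero]
          intro s _ hs h
          rw [hs] at h
          exact hx (Option.some.inj h.1)
        · intro h
          exact absurd (Multiset.mem_toFinset.2 h2) h
        · intro b' s hs
          have h1s : 1 ∉ b' :: s := fun h => h1V (by rw [← hs]; exact Multiset.mem_coe.2 h)
          simp only [hP, List.getLast?_cons_cons, List.head?_cons, Option.some.injEq]
          rw [and_comm (a := b' = 2)]
          refine and_congr_right fun _ => ⟨?_, ?_⟩
          · rintro ⟨u, v, huv, hv⟩
            cases u with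
            | nil =>
              simp only [List.nil_append, List.cons.injEq] at huv
              exact huv.2.1
            | cons x u =>
              simp only [List.cons_append, List.cons.injEq] at huv
              exact absurd (by rw [huv.2]; simp) h1s
          · rintro rfl
            exact ⟨[], s, rfl, fun h => h1s (List.mem_cons_of_mem _ h)⟩
      · rw [pathSum_of_start_notMem h2, mul_zero]
        refine bracketSum_of_forall_not fun s hs _ h => h2 ?_
        have h3 : 2 ∈ (s : Multiset ℕ) := Multiset.mem_coe.2 (List.mem_of_mem_getLast? h.1)
        rw [hs] at h3
        simpa using h3
    rw [e2, Multiset.erase_cons_head]; ring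
  · intro b A _ hA
    refine bracketSum_cons (fun h => by simp [h] at hA) fun b' s hs => hstep _ _ _ ?_
    rw [← hs] at hA
    exact Multiset.mem_coe.1 hA

end

/-! ### Resolution of the degenerate form factor -/

section

/-- The submultisets that contain `1` and `2` the given numbers of times. -/
def subCount (i j : ℕ) (A : Multiset ℕ) : Finset (Multiset ℕ) :=
  A.powerset.toFinset.filter fun R => R.count 1 = i ∧ R.count 2 = j

theorem mem_subCount {i j : ℕ} {A R : Multiset ℕ} :
    R ∈ subCount i j A ↔ R ≤ A ∧ R.count 1 = i ∧ R.count 2 = j := by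
  simp [subCount]

variable {n m : ℕ} {A : Multiset ℕ} {B : Finset ℕ}

theorem sum_subCount (hB1 : 1 ∉ B) (hB2 : 2 ∉ B)
    (hA : A = Multiset.replicate n 1 + Multiset.replicate m 2 + B.val) {i j : ℕ} (hi : i ≤ n)
    (hj : j ≤ m) (f : Multiset ℕ → ℂ) :
    ∑ R ∈ subCount i j A, f R
      = ∑ D ∈ B.powerset, f (Multiset.replicate i 1 + Multiset.replicate j 2 + D.val) := by
  have e : subCount i j A = B.powerset.image fun D =>
      Multiset.replicate i 1 + Multiset.replicate j 2 + D.val := by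
    ext R
    rw [mem_subCount, Finset.mem_image]
    constructor
    · rintro ⟨hR, h1, h2⟩
      refine ⟨B.filter (· ∈ R), Finset.mem_powerset.2 (Finset.filter_subset _ _), ?_⟩
      ext x
      have hx := Multiset.le_iff_count.1 hR x
      have hBn := Multiset.nodup_iff_count_le_one.1 B.nodup x
      rw [hA] at hx
      simp only [Multiset.count_add, Multiset.count_replicate] at hx ⊢
      by_cases hx1 : 1 = x
      · subst hx1
        rw [Multiset.count_eq_zero_of_notMem (by simpa using fun h => absurd h hB1)]
        simp [h1]
      by_cases hx2 : 2 = x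
      · subst hx2
        rw [Multiset.count_eq_zero_of_notMem (by simpa using fun h => absurd h hB2)]
        simp [h2]
      simp only [hx1, hx2, if_false, zero_add] at hx ⊢
      by_cases hxR : x ∈ R
      · have h3 := Multiset.count_pos.2 hxR
        have hxB : x ∈ B := Multiset.count_pos.1 (by omega)
        rw [Multiset.count_eq_one_of_mem (Finset.nodup _) (by simp [hxB, hxR])]
        omega
      · rw [Multiset.count_eq_zero_of_notMem (by simp [hxR]),
          Multiset.count_eq_zero_of_notMem hxR]
    · rintro ⟨D, hD, rfl⟩
      rw [Finset.mem_powerset] at hD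
      refine ⟨?_, ?_, ?_⟩
      · rw [hA]
        exact add_le_add (add_le_add ((Multiset.replicate_le_replicate 1).2 hi)
          ((Multiset.replicate_le_replicate 2).2 hj)) (Finset.val_le_iff.2 hD)
      · simp [Multiset.count_add, Multiset.count_replicate,
          Multiset.count_eq_zero_of_notMem fun h => hB1 (hD h)]
      · simp [Multiset.count_add, Multiset.count_replicate,
          Multiset.count_eq_zero_of_notMem fun h => hB2 (hD h)]
  rw [e, Finset.sum_image]
  intro D _ D' _ h
  exact Finset.val_injective (add_left_cancel h)

theorem sum_subOne_shift {D P : Multiset ℕ} (hD : D ≤ A) (h1 : 1 ∉ D) (f : Multiset ℕ → ℂ) :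
    ∑ R ∈ (subOne 1 A).filter (P + D ≤ ·), f R
      = ∑ V ∈ (subOne 1 (A - D)).filter (P ≤ ·), f (V + D) := by
  have h1' := Multiset.count_eq_zero_of_notMem h1
  refine Finset.sum_nbij' (fun R => R - D) (fun V => V + D) ?_ ?_ ?_ ?_ ?_
  · intro R hR
    rw [Finset.mem_filter, mem_subOne] at hR ⊢
    exact ⟨⟨tsub_le_tsub_right hR.1.1 _, by rw [Multiset.count_sub, h1', hR.1.2]⟩,
      le_tsub_of_add_le_right hR.2⟩
  · intro V hV
    rw [Finset.mem_filter, mem_subOne] at hV ⊢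
    exact ⟨⟨(le_tsub_iff_right hD).1 hV.1.1, by rw [Multiset.count_add, h1', hV.1.2]⟩,
      add_le_add_left hV.2 _⟩
  · intro R hR
    rw [Finset.mem_filter] at hR
    exact tsub_add_cancel_of_le ((Multiset.le_add_left _ _).trans hR.2)
  · intro V _
    exact add_tsub_cancel_right _ _
  · intro R hR
    rw [Finset.mem_filter] at hR
    rw [tsub_add_cancel_of_le ((Multiset.le_add_left _ _).trans hR.2)]

variable {S : ℂ → ℂ} {θ : ℕ → ℂ}

theorem sum_subOne_single {D : Multiset ℕ} (hD : D ≤ A) (h1D : 1 ∉ D) (h1 : 1 ∈ A) :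
    ∑ R ∈ (subOne 1 A).filter ({2} + D ≤ ·),
        pathSum S θ 1 1 (A - R + {1}) * pathSum S θ 2 2 (R - ({2} + D) + {2})
      = pathSum S θ 2 2 (A - D) := by
  have h1C : 1 ∈ A - D := by
    rw [← Multiset.count_pos, Multiset.count_sub, Multiset.count_eq_zero_of_notMem h1D]
    exact Multiset.count_pos.2 h1
  rw [sum_subOne_shift hD h1D, pathSum_eq_sum_subOne 2 2 1 h1C, Finset.sum_filter]
  refine Finset.sum_congr rfl fun V _ => ?_
  split_ifs with hV
  · rw [add_tsub_add_eq_tsub_right, tsub_add_cancel_of_le hV, tsub_add_eq_tsub_tsub_swap]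
  · rw [pathSum_of_start_notMem (b := 2) (fun h => hV (Multiset.singleton_le.2 h)), mul_zero]

theorem sum_subOne_pair {D : Multiset ℕ} (hD : D ≤ A) (h1D : 1 ∉ D) (h1 : 1 ∈ A) :
    phi S (θ 1 - θ 2) * ∑ R ∈ (subOne 1 A).filter ({1} + {2} + D ≤ ·),
        pathSum S θ 1 1 (A - R + {1}) * pathSum S θ 2 2 (R - ({1} + {2} + D) + {2})
      = ∑ s ∈ paths' (A - D), bracket S θ s := by
  have h1C : 1 ∈ A - D := by
    rw [← Multiset.count_pos, Multiset.count_sub, Multiset.count_eq_zero_of_notMem h1D]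
    exact Multiset.count_pos.2 h1
  rw [sum_subOne_shift hD h1D, sum_paths'_eq h1C, Finset.sum_filter]
  congr 1
  refine Finset.sum_congr rfl fun V hV => ?_
  rw [mem_subOne] at hV
  obtain ⟨V, rfl⟩ := Multiset.exists_cons_of_mem (a := 1) (s := V)
    (Multiset.count_pos.1 (by omega))
  rw [Multiset.erase_cons_head]
  simp only [← Multiset.singleton_add, add_le_add_iff_left]
  split_ifs with hV2
  · rw [add_tsub_add_eq_tsub_right, add_tsub_add_eq_tsub_left, tsub_add_cancel_of_le hV2,
      tsub_add_eq_tsub_tsub_swap]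
  · rw [pathSum_of_start_notMem (b := 2) (fun h => hV2 (Multiset.singleton_le.2 h)), mul_zero]

/-- The sum over the partitions of `B`, for a function on multisets that can be resolved by
its dependence on each label. -/
theorem eq_sum_powerset_of_resolution (hB1 : 1 ∉ B) (hB2 : 2 ∉ B) (hn : 1 ≤ n) (hm : 1 ≤ m)
    (hA : A = Multiset.replicate n 1 + Multiset.replicate m 2 + B.val)
    (hphi : phi S (θ 1 - θ 2) ≠ 0) {c : Multiset ℕ → ℂ}
    (hc : ∀ r, ∀ A' ≤ A, r ∈ A' →
      c A' = ∑ V ∈ subOne r A', pathSum S θ r r (A' - V + {r}) * c V) :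
    c A = ∑ D ∈ B.powerset,
      (c (1 ::ₘ 2 ::ₘ D.val) / phi S (θ 1 - θ 2) * ∑ s ∈ paths' (A - D.val), bracket S θ s
        + c (1 ::ₘ D.val) * ∑ s ∈ paths 1 1 (A - D.val), bracket S θ s
        + c (2 ::ₘ D.val) * ∑ s ∈ paths 2 2 (A - D.val), bracket S θ s) := by
  have h1A : 1 ∈ A := by
    rw [hA, Multiset.mem_add, Multiset.mem_add, Multiset.mem_replicate]
    exact Or.inl (Or.inl ⟨by omega, rfl⟩)
  have hDA : ∀ D ∈ B.powerset, D.val ≤ A := fun D hD => by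
    rw [hA]
    exact (Finset.val_le_iff.2 (Finset.mem_powerset.1 hD)).trans (Multiset.le_add_left _ _)
  have h1D : ∀ D ∈ B.powerset, 1 ∉ D.val := fun D hD h => hB1 (Finset.mem_powerset.1 hD h)
  rw [hc 1 A le_rfl h1A, ← Finset.sum_filter_add_sum_filter_not _ (fun R => 2 ∈ R)]
  have hno : ∑ R ∈ (subOne 1 A).filter (fun R => 2 ∉ R), pathSum S θ 1 1 (A - R + {1}) * c R
      = ∑ D ∈ B.powerset, c (1 ::ₘ D.val) * ∑ s ∈ paths 1 1 (A - D.val), bracket S θ s := by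
    have e : (subOne 1 A).filter (fun R => 2 ∉ R) = subCount 1 0 A := by
      ext R
      rw [Finset.mem_filter, mem_subOne, mem_subCount, Multiset.count_eq_zero, and_assoc]
    rw [e, sum_subCount hB1 hB2 hA hn (Nat.zero_le m)]
    refine Finset.sum_congr rfl fun D hD => ?_
    have h1C : 1 ∈ A - D.val := by
      rw [← Multiset.count_pos, Multiset.count_sub,
        Multiset.count_eq_zero_of_notMem (h1D D hD)]
      exact Multiset.count_pos.2 h1A
    rw [Multiset.replicate_one, Multiset.replicate_zero, add_zero, Multiset.singleton_add,
      ← Multiset.singleton_add, tsub_add_eq_tsub_tsub_swap,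
      tsub_add_cancel_of_le (Multiset.singleton_le.2 h1C), Multiset.singleton_add, mul_comm,
      pathSum]
  have hyes : ∑ R ∈ (subOne 1 A).filter (fun R => 2 ∈ R), pathSum S θ 1 1 (A - R + {1}) * c R
      = ∑ R' ∈ subCount 0 1 A ∪ subCount 1 1 A, c R' *
        ∑ R ∈ (subOne 1 A).filter (R' ≤ ·),
          pathSum S θ 1 1 (A - R + {1}) * pathSum S θ 2 2 (R - R' + {2}) := by
    have h1 : ∀ R ∈ (subOne 1 A).filter (fun R => 2 ∈ R), pathSum S θ 1 1 (A - R + {1}) * c R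
        = ∑ R' ∈ subOne 2 R, c R' *
          (pathSum S θ 1 1 (A - R + {1}) * pathSum S θ 2 2 (R - R' + {2})) := by
      intro R hR
      rw [Finset.mem_filter, mem_subOne] at hR
      rw [hc 2 R hR.1.1 hR.2, Finset.mul_sum]
      exact Finset.sum_congr rfl fun _ _ => by ring
    simp only [Finset.mul_sum]
    rw [Finset.sum_congr rfl h1]
    refine Finset.sum_comm' fun R R' => ?_
    simp only [Finset.mem_filter, mem_subOne, Finset.mem_union, mem_subCount]
    constructor
    · rintro ⟨⟨⟨hR, h1R⟩, -⟩, hR', h2R'⟩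
      have h3 := Multiset.le_iff_count.1 hR' 1
      refine ⟨⟨⟨hR, h1R⟩, hR'⟩, ?_⟩
      have h4 := hR'.trans hR
      rcases Nat.eq_zero_or_pos (R'.count 1) with h5 | h5
      · exact Or.inl ⟨h4, h5, h2R'⟩
      · exact Or.inr ⟨h4, by omega, h2R'⟩
    · rintro ⟨⟨⟨hR, h1R⟩, hR'⟩, h2⟩
      have h3 : R'.count 2 = 1 := by tauto
      refine ⟨⟨⟨hR, h1R⟩, Multiset.mem_of_le hR' (Multiset.count_pos.1 (by omega))⟩, hR', h3⟩
  have hdisj : Disjoint (subCount 0 1 A) (subCount 1 1 A) := by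
    rw [Finset.disjoint_left]
    intro R h1 h2
    rw [mem_subCount] at h1 h2
    omega
  rw [hyes, hno, Finset.sum_union hdisj, sum_subCount hB1 hB2 hA (Nat.zero_le n) hm,
    sum_subCount hB1 hB2 hA hn hm, ← Finset.sum_add_distrib, ← Finset.sum_add_distrib]
  refine Finset.sum_congr rfl fun D hD => ?_
  rw [Multiset.replicate_one, Multiset.replicate_zero, zero_add, Multiset.replicate_one,
    sum_subOne_single (hDA D hD) (h1D D hD) h1A,
    ← sum_subOne_pair (hDA D hD) (h1D D hD) h1A, pathSum, add_assoc,
    Multiset.singleton_add 2 D.val, add_assoc {1}, Multiset.singleton_add 2 D.val,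
    Multiset.singleton_add 1]
  field_simp
  ring

variable (hS : IsScatteringMatrix S) {F : (n : ℕ) → (Fin n → ℂ) → ℂ} (hF : IsFormFactor S F)
include hS hF

theorem leadingCoeff_self_eq (hA : AdmissibleLabels S θ A) {r : ℕ} (hr : r ∈ A) :
    leadingCoeff F θ A A
      = ∑ V ∈ subOne r A, pathSum S θ r r (A - V + {r}) * leadingCoeff F θ V V := by
  have h := eq_sum_subOne_of_recursion (S := S) (θ := θ) (r := r) (A₀ := A)
    (K := fun b A => leadingCoeff F θ A ((r ::ₘ A).erase b)) ?_ le_rfl hr hr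
  · simpa only [Multiset.erase_cons_head] using h
  · intro b A' hA' hr'
    have e : (r ::ₘ b ::ₘ A').erase b = r ::ₘ A' := by
      rw [Multiset.cons_swap, Multiset.erase_cons_head]
    have hsub : r ::ₘ A' ⊆ A' := Multiset.cons_subset.2 ⟨hr', Multiset.Subset.refl _⟩
    have e2 : (r ::ₘ A').toFinset = A'.toFinset := by
      rw [Multiset.toFinset_cons, Finset.insert_eq_of_mem (Multiset.mem_toFinset.2 hr')]
    rw [e, leadingCoeff_succ hS hF (hA.mono (Multiset.subset_of_le hA')) (by simp)
      (Multiset.mem_cons_self b A') (by rwa [Multiset.erase_cons_head]),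
      Multiset.erase_cons_head, e2]

end

end DiagFF

theorem mainTheorem5
    (S : ℂ → ℂ) (hS : DiagFF.IsScatteringMatrix S)
    (F : (n : ℕ) → (Fin n → ℂ) → ℂ) (hF : DiagFF.IsFormFactor S F)
    (n m k : ℕ) (hn : 1 ≤ n) (hm : 1 ≤ m)
    (θ : ℕ → ℂ)
    (hdistinct : ∀ i ∈ Finset.Icc 1 (k + 2), ∀ j ∈ Finset.Icc 1 (k + 2), i ≠ j →
      Complex.sinh (θ i - θ j) ≠ 0)
    (hregular : ∀ i ∈ Finset.Icc 1 (k + 2), ∀ j ∈ Finset.Icc 1 (k + 2), i ≠ j →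
      S (θ i - θ j) ≠ 0)
    (hphi : DiagFF.phi S (θ 1 - θ 2) ≠ 0)
    (B : Finset ℕ) (hB : B = Finset.Icc 3 (k + 2))
    (A : Multiset ℕ) (hA : A = Multiset.replicate n 1 + Multiset.replicate m 2 + B.val) :
    DiagFF.HasDegenerateValue F
      (DiagFF.rapidities θ (List.replicate n 1 ++ List.replicate m 2 ++ B.sort))
      ((n.factorial : ℂ) * (m.factorial : ℂ) *
        ∑ Bp ∈ B.powerset,
          (DiagFF.connected F (DiagFF.rapidities θ (1 :: 2 :: Bp.sort)) /
                DiagFF.phi S (θ 1 - θ 2) *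
              ∑ s ∈ DiagFF.paths' (A - Bp.val), DiagFF.bracket S θ s
            + DiagFF.connected F (DiagFF.rapidities θ (1 :: Bp.sort)) *
              ∑ s ∈ DiagFF.paths 1 1 (A - Bp.val), DiagFF.bracket S θ s
            + DiagFF.connected F (DiagFF.rapidities θ (2 :: Bp.sort)) *
              ∑ s ∈ DiagFF.paths 2 2 (A - Bp.val), DiagFF.bracket S θ s)) := by
  have hB3 : ∀ x ∈ B, 3 ≤ x ∧ x ≤ k + 2 := fun x hx => by rw [hB] at hx; exact Finset.mem_Icc.1 hx
  have hB1 : 1 ∉ B := fun h => by have := hB3 1 h; omega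
  have hB2 : 2 ∉ B := fun h => by have := hB3 2 h; omega
  have hlab : ∀ {A' : Multiset ℕ}, (∀ a ∈ A', a ∈ Finset.Icc 1 (k + 2)) →
      DiagFF.AdmissibleLabels S θ A' := by
    intro A' h a ha b hb
    by_cases hab : a = b
    · subst hab
      refine ⟨?_, fun h => absurd rfl h⟩
      rw [sub_self, hS.at_zero]; norm_num
    · exact ⟨hregular a (h a ha) b (h b hb) hab, fun _ => hdistinct a (h a ha) b (h b hb) hab⟩
  have hconn : ∀ L : List ℕ, L.Pairwise (· < ·) → (∀ a ∈ L, a ∈ Finset.Icc 1 (k + 2)) →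
      DiagFF.connected F (DiagFF.rapidities θ L) = DiagFF.leadingCoeff F θ L L := by
    intro L hL hmem
    refine DiagFF.connected_rapidities hS hF (hL.imp le_of_lt).sortedLE
      (hlab fun a ha => hmem a (Multiset.mem_coe.1 ha)) fun i j hij => ?_
    by_contra hne
    refine hdistinct (L.get i) (hmem _ (List.get_mem L i)) (L.get j) (hmem _ (List.get_mem L j))
      (fun h => hne (List.nodup_iff_injective_get.1 (hL.imp ne_of_lt) h)) ?_
    rw [show θ (L.get i) = θ (L.get j) from hij, sub_self, Complex.sinh_zero]
  have hAmem : ∀ a ∈ A, a ∈ Finset.Icc 1 (k + 2) := by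
    intro a ha
    rw [hA] at ha
    simp only [Multiset.mem_add, Multiset.mem_replicate, Finset.mem_val] at ha
    rw [Finset.mem_Icc]
    rcases ha with (⟨-, rfl⟩ | ⟨-, rfl⟩) | ha
    · omega
    · omega
    · have := hB3 a ha; omega
  have hlist :
      ((List.replicate n 1 ++ List.replicate m 2 ++ B.sort : List ℕ) : Multiset ℕ) = A := by
    rw [hA, ← Multiset.coe_add, ← Multiset.coe_add, Multiset.coe_replicate,
      Multiset.coe_replicate, Finset.sort_eq]
  have hsorted : (List.replicate n 1 ++ List.replicate m 2 ++ B.sort).SortedLE := by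
    refine List.Pairwise.sortedLE ?_
    simp only [List.pairwise_append, List.pairwise_replicate, List.mem_append,
      List.mem_replicate, Finset.mem_sort]
    refine ⟨⟨by simp, by simp, ?_⟩, B.pairwise_sort _, ?_⟩
    · rintro a ⟨-, rfl⟩ b ⟨-, rfl⟩; omega
    · rintro a (⟨-, rfl⟩ | ⟨-, rfl⟩) b hb
      · have := hB3 b hb; omega
      · have := hB3 b hb; omega
  have hsym : DiagFF.symFactor A = (n.factorial : ℂ) * m.factorial := by
    have e : A.toFinset = insert 1 (insert 2 B) := by
      ext x
      rw [hA]
      simp only [Multiset.mem_toFinset, Multiset.mem_add, Multiset.mem_replicate,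
        Finset.mem_val, Finset.mem_insert]
      have h1 : n ≠ 0 := by omega
      have h2 : m ≠ 0 := by omega
      tauto
    have hcount : ∀ x, A.count x = (if 1 = x then n else 0) + (if 2 = x then m else 0)
        + B.val.count x := fun x => by
      rw [hA, Multiset.count_add, Multiset.count_add, Multiset.count_replicate,
        Multiset.count_replicate]
    rw [DiagFF.symFactor, e, Finset.prod_insert (by simp [hB1]), Finset.prod_insert hB2,
      Finset.prod_eq_one, mul_one]
    · rw [hcount, hcount, Multiset.count_eq_zero_of_notMem hB1,
        Multiset.count_eq_zero_of_notMem hB2]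
      simp
    · intro x hx
      have := hB3 x hx
      rw [hcount, Multiset.count_eq_one_of_mem B.nodup hx, if_neg (by omega), if_neg (by omega)]
      simp
  have h := DiagFF.hasDegenerateValue_rapidities hS hF (θ := θ) hsorted
    (by rw [hlist]; exact hlab hAmem)
  rw [hlist, hsym, DiagFF.eq_sum_powerset_of_resolution hB1 hB2 hn hm hA hphi
    (c := fun A => DiagFF.leadingCoeff F θ A A) (fun r A' hA' hr =>
      DiagFF.leadingCoeff_self_eq hS hF
        (hlab fun a ha => hAmem a (Multiset.mem_of_le hA' ha)) hr)] at h
  convert h using 2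
  refine Finset.sum_congr rfl fun D hD => ?_
  have hD3 : ∀ x ∈ D, 3 ≤ x ∧ x ≤ k + 2 := fun x hx => hB3 x (Finset.mem_powerset.1 hD hx)
  have hDs : (D.sort).Pairwise (· < ·) := (D.sortedLT_sort).pairwise
  have hcon := hconn (1 :: 2 :: D.sort) (by
    simp only [List.pairwise_cons, List.mem_cons, Finset.mem_sort, forall_eq_or_imp]
    exact ⟨⟨by omega, fun x hx => by have := hD3 x hx; omega⟩,
      fun x hx => by have := hD3 x hx; omega, hDs⟩) (by
    simp only [List.mem_cons, Finset.mem_sort, Finset.mem_Icc, forall_eq_or_imp]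
    exact ⟨by omega, by omega, fun x hx => by have := hD3 x hx; omega⟩)
  have hcon' : ∀ r, r = 1 ∨ r = 2 → DiagFF.connected F (DiagFF.rapidities θ (r :: D.sort))
      = DiagFF.leadingCoeff F θ (r ::ₘ D.val) (r ::ₘ D.val) := fun r hr => by
    have h := hconn (r :: D.sort) (by
      simp only [List.pairwise_cons, Finset.mem_sort]
      exact ⟨fun x hx => by have := hD3 x hx; omega, hDs⟩) (by
      simp only [List.mem_cons, Finset.mem_sort, Finset.mem_Icc, forall_eq_or_imp]
      exact ⟨by omega, fun x hx => by have := hD3 x hx; omega⟩)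
    rwa [← Multiset.cons_coe, Finset.sort_eq] at h
  rw [← Multiset.cons_coe, ← Multiset.cons_coe, Finset.sort_eq] at hcon
  rw [hcon, hcon' 1 (Or.inl rfl), hcon' 2 (Or.inr rfl)]
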